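/- Setting. Let $(M,g,I,J,K)$ be a compact hyperkähler manifold of real dimension $4m$, $m\ge 1$: $g$ is a Riemannian metric, $I,J,K$ are integrable complex structures with $IJK=-1$, and $g$ is Kähler with respect to each of them, with Kähler forms $\omega_I,\omega_J,\omega_K$. For $(a,b,c)\in S^2=\{a^2+b^2+c^2=1\}\subset\mathbb{R}^3$ the endomorphism $aI+bJ+cK$ is again a complex structure on $M$. Identify $\mathbb{CP}^1$ with $S^2$ carrying the complex structure $j_u(w)=u\times w$ ($w\in T_uS^2$), for which $(b+ic)/(1+a)$ is a holomorphic coordinate. Let $Y$ be a compact connected complex manifold and $\varphi=(a,b,c):Y\to S^2=\mathbb{CP}^1$ a nonconstant holomorphic map. The associated *greatly generalized Calabi–Gray manifold* $X=\varphi^*Z$, the pullback under $\varphi$ of the twistor fibration $Z\to\mathbb{CP}^1$ of $M$, is the smooth manifold $M\times Y$ with the complex structure which at $(p,y)$ is $$\big(a(y)I+b(y)J+c(y)K\big)_p\oplus (J_Y)_y .$$ Let $\omega$ be the fundamental form of a smooth Hermitian metric on a complex manifold of complex dimension $n$. The metric is *Kähler* if $d\omega=0$, *balanced* if $d(\omega^{n-1})=0$,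 *astheno-Kähler* if $i\partial\bar\partial(\omega^{n-2})=0$, and *plurisubharmonic* if $i\partial\bar\partial\omega\ge 0$ as a $(2,2)$-form, i.e. $i\partial\bar\partial\omega$ is nonnegative on every complex two-dimensional subspace of every tangent space. **Proposition.** (a) If $Y$ admits a balanced metric, then so does $X$. (b) $X$ does not admit both an astheno-Kähler metric and a plurisubharmonic metric (as two possibly different metrics). In particular, $X$ admits no Kähler metric. -/

import Mathlib

open Set Bundle
open scoped Manifold ContDiff

noncomputable section

namespace CalabiGray

/-! ### Exterior algebra on a topological vector space -/

section Algebra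

theorem comp_update_of_injective {ι κ V : Type*} [DecidableEq ι] [DecidableEq κ] (f : ι → κ)
    (hf : Function.Injective f) (v : κ → V) (i : ι) (w : V) :
    (fun j => Function.update v (f i) w (f j)) = Function.update (fun j => v (f j)) i w := by
  ext j
  by_cases h : j = i
  · subst h; simp
  · simp [Function.update_of_ne h, Function.update_of_ne (fun h' => h (hf h'))]

theorem comp_update_of_ne {ι κ V : Type*} [DecidableEq κ] (f : ι → κ) (v : κ → V) (i : κ)
    (hi : ∀ j, f j ≠ i) (w : V) :
    (fun j => Function.update v i w (f j)) = fun j => v (f j) := by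
  ext j
  exact Function.update_of_ne (hi j) _ _

variable {V : Type*} [TopologicalSpace V] [AddCommGroup V] [Module ℝ V]

/-- The tensor product `α ⊗ β` of two alternating forms, as a multilinear form. -/
def tensor {k l : ℕ} (α : V [⋀^Fin k]→L[ℝ] ℝ) (β : V [⋀^Fin l]→L[ℝ] ℝ) :
    ContinuousMultilinearMap ℝ (fun _ : Fin (k + l) => V) ℝ where
  toFun v := α (fun i => v (Fin.castAdd l i)) * β (fun j => v (Fin.natAdd k j))
  map_update_add' := by
    intro inst v i x y
    have h3 : ∀ (i : Fin k) (j : Fin l), Fin.natAdd k j ≠ Fin.castAdd l i := by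
      intro i j; simp [Fin.ext_iff]; omega
    refine Fin.addCases (fun i => ?_) (fun i => ?_) i
    · simp only [comp_update_of_injective _ (Fin.castAdd_injective k l),
        comp_update_of_ne _ _ _ (h3 i), ContinuousAlternatingMap.map_update_add]
      ring
    · simp only [comp_update_of_injective _ (Fin.natAdd_injective l k),
        comp_update_of_ne _ _ _ (fun j => (h3 j i).symm), ContinuousAlternatingMap.map_update_add]
      ring
  map_update_smul' := by
    intro inst v i c x
    have h3 : ∀ (i : Fin k) (j : Fin l), Fin.natAdd k j ≠ Fin.castAdd l i := by
      intro i j; simp [Fin.ext_iff]; omega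
    refine Fin.addCases (fun i => ?_) (fun i => ?_) i
    · simp only [comp_update_of_injective _ (Fin.castAdd_injective k l),
        comp_update_of_ne _ _ _ (h3 i), ContinuousAlternatingMap.map_update_smul, smul_eq_mul]
      ring
    · simp only [comp_update_of_injective _ (Fin.natAdd_injective l k),
        comp_update_of_ne _ _ _ (fun j => (h3 j i).symm),
        ContinuousAlternatingMap.map_update_smul, smul_eq_mul]
      ring
  cont := by
    fun_prop

/-- The wedge product, normalised so that `(α ∧ β)(u, v) = α u * β v - α v * β u` for
one-forms: `α ∧ β = 1 / (k! l!) ∑ σ, sign σ • (α ⊗ β) ∘ σ`. -/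
def wedge {k l : ℕ} (α : V [⋀^Fin k]→L[ℝ] ℝ) (β : V [⋀^Fin l]→L[ℝ] ℝ) :
    V [⋀^Fin (k + l)]→L[ℝ] ℝ :=
  ((k.factorial * l.factorial : ℝ)⁻¹) •
    ContinuousMultilinearMap.alternatization (tensor α β)

/-- The exterior power `α ^ k = α ∧ ⋯ ∧ α` of a two-form. -/
def wedgePow (α : V [⋀^Fin 2]→L[ℝ] ℝ) : (k : ℕ) → V [⋀^Fin (2 * k)]→L[ℝ] ℝ
  | 0 => ContinuousAlternatingMap.constOfIsEmpty ℝ V (Fin 0) 1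
  | k + 1 => wedge (wedgePow α k) α

end Algebra

/-! ### Differential forms on manifolds without boundary -/

section Forms

variable {E : Type*} [NormedAddCommGroup E] [NormedSpace ℝ E] {H : Type*} [TopologicalSpace H]
  (I : ModelWithCorners ℝ E H) {N : Type*} [TopologicalSpace N] [ChartedSpace H N]
  {G : Type*} [NormedAddCommGroup G] [NormedSpace ℝ G]

variable (N) in
/-- Differential `k`-forms on `N` with values in `G` (here `G` is `ℝ` or `ℂ`). -/
abbrev DForm (G : Type*) [NormedAddCommGroup G] [NormedSpace ℝ G] (k : ℕ) :=
  ∀ x : N, TangentSpace I x [⋀^Fin k]→L[ℝ] G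

/-- The form `α` read in the preferred chart at `x`, i.e. its pullback by the inverse chart. -/
def chartRep {k : ℕ} (α : DForm I N G k) (x : N) : E → E [⋀^Fin k]→L[ℝ] G := fun z =>
  ((α ((extChartAt I x).symm z)).compContinuousLinearMap
    (mfderivWithin 𝓘(ℝ, E) I (extChartAt I x).symm (range I) z) :
      TangentSpace 𝓘(ℝ, E) z [⋀^Fin k]→L[ℝ] G)

/-- The exterior derivative: at `x` it is computed in the preferred chart at `x` and pulled back
by that chart. -/
def d {k : ℕ} (α : DForm I N G k) : DForm I N G (k + 1) := fun x =>
  ContinuousAlternatingMap.compContinuousLinearMap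
    (M' := TangentSpace 𝓘(ℝ, E) (extChartAt I x x))
    (extDerivWithin (chartRep I α x) (range I) (extChartAt I x x))
    (mfderiv I 𝓘(ℝ, E) (extChartAt I x) x)

variable (N) in
/-- A complex structure on every tangent space. Smoothness and integrability are expressed
separately, in `IsComplex`. -/
structure TangentComplexStructure where
  toFun : ∀ x : N, TangentSpace I x →L[ℝ] TangentSpace I x
  sq : ∀ (x : N) (v : TangentSpace I x), toFun x (toFun x v) = -v

variable {I}

instance : CoeFun (TangentComplexStructure I N)
    (fun _ => ∀ x : N, TangentSpace I x →L[ℝ] TangentSpace I x) :=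
  ⟨TangentComplexStructure.toFun⟩

/-- `C α = α (J ·, …, J ·)`; it multiplies forms of type `(p, q)` by `i ^ (p - q)`. -/
def cOp (J : TangentComplexStructure I N) {k : ℕ} (α : DForm I N G k) : DForm I N G k :=
  fun x => (α x).compContinuousLinearMap (J x)

/-- The inverse of `cOp J`, namely `α ↦ α (-J ·, …, -J ·)`. -/
def cOpInv (J : TangentComplexStructure I N) {k : ℕ} (α : DForm I N G k) : DForm I N G k :=
  fun x => (α x).compContinuousLinearMap (-(J x))

/-- `d^c = C⁻¹ d C`, which on a complex manifold is `i (∂̄ - ∂)`. -/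
def dc (J : TangentComplexStructure I N) {k : ℕ} (α : DForm I N G k) : DForm I N G (k + 1) :=
  cOpInv J (d I (cOp J α))

/-- The operator `∂ = (d + i d^c) / 2` on complex-valued forms. -/
def del (J : TangentComplexStructure I N) {k : ℕ} (α : DForm I N ℂ k) : DForm I N ℂ (k + 1) :=
  fun x => (1 / 2 : ℂ) • (d I α x + Complex.I • dc J α x)

/-- The operator `∂̄ = (d - i d^c) / 2` on complex-valued forms. -/
def delbar (J : TangentComplexStructure I N) {k : ℕ} (α : DForm I N ℂ k) :
    DForm I N ℂ (k + 1) :=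
  fun x => (1 / 2 : ℂ) • (d I α x - Complex.I • dc J α x)

/-- A real form regarded as a complex-valued form. -/
def toComplex {k : ℕ} (α : DForm I N ℝ k) : DForm I N ℂ k :=
  fun x => Complex.ofRealCLM.compContinuousAlternatingMap (α x)

/-- `i ∂ ∂̄ α` for a real form `α`. -/
def iDelDelbar (J : TangentComplexStructure I N) {k : ℕ} (α : DForm I N ℝ k) :
    DForm I N ℂ (k + 2) :=
  fun x => Complex.I • del J (delbar J (toComplex α)) x

variable [IsManifold I ∞ N]

/-- `J` is an integrable complex structure: `J` is smooth and its Nijenhuis tensor vanishes. -/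
def IsComplex (J : TangentComplexStructure I N) : Prop :=
  ContMDiff I (I.prod 𝓘(ℝ, E →L[ℝ] E)) ∞
    (fun x => TotalSpace.mk' (E →L[ℝ] E)
      (E := fun x : N => TangentSpace I x →L[ℝ] TangentSpace I x) x (J x)) ∧
  ∀ U V : ∀ x : N, TangentSpace I x,
    ContMDiff I I.tangent ∞ (fun x => (⟨x, U x⟩ : TangentBundle I N)) →
    ContMDiff I I.tangent ∞ (fun x => (⟨x, V x⟩ : TangentBundle I N)) →
    ∀ x, VectorField.mlieBracket I (fun y => J y (U y)) (fun y => J y (V y)) x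
        - J x (VectorField.mlieBracket I (fun y => J y (U y)) V x)
        - J x (VectorField.mlieBracket I U (fun y => J y (V y)) x)
        - VectorField.mlieBracket I U V x = 0

variable (I N) in
/-- Smooth Riemannian metrics on `N`. -/
abbrev Metric := ContMDiffRiemannianMetric I ∞ E (fun x : N => TangentSpace I x)

/-- `g` is Hermitian with respect to `J`. -/
def IsHermitian (g : Metric I N) (J : TangentComplexStructure I N) : Prop :=
  ∀ (x : N) (u v : TangentSpace I x), g.inner x (J x u) (J x v) = g.inner x u v

/-- The fundamental form `g (J ·, ·)` of a Hermitian metric. -/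
def fundamentalForm (g : Metric I N) (J : TangentComplexStructure I N) (h : IsHermitian g J) :
    DForm I N ℝ 2 := fun x =>
  { toFun := fun v => g.inner x (J x (v 0)) (v 1)
    map_update_add' := by
      intro inst v i a b
      have e : inst = instDecidableEqFin 2 := Subsingleton.elim _ _
      subst e
      fin_cases i <;> simp
    map_update_smul' := by
      intro inst v i a b
      have e : inst = instDecidableEqFin 2 := Subsingleton.elim _ _
      subst e
      fin_cases i <;> simp
    cont := by
      have h0 : Continuous fun v : Fin 2 → TangentSpace I x => v 0 := continuous_apply 0
      have h1 : Continuous fun v : Fin 2 → TangentSpace I x => v 1 := continuous_apply 1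
      have hg : ∀ B : E →L[ℝ] E →L[ℝ] ℝ, Continuous fun p : E × E => B p.1 p.2 := by
        intro B; fun_prop
      exact (hg (g.inner x)).comp (((J x).continuous.comp h0).prodMk h1)
    map_eq_zero_of_eq' := by
      have key : ∀ u : TangentSpace I x, g.inner x (J x u) u = 0 := by
        intro u
        have h1 := h x (J x u) u
        rw [J.sq, g.symm x (J x u) u] at h1
        have h2 := g.symm x (J x u) u
        simp only [map_neg, neg_apply] at h1
        linarith
      intro v i j hv hne
      have h01 : v 0 = v 1 := by
        fin_cases i <;> fin_cases j <;> simp_all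
      simp [h01, key] }

/-- A Kähler metric (on a manifold whose complex structure is `J`): the fundamental form is
closed. -/
def IsKahler (g : Metric I N) (J : TangentComplexStructure I N) : Prop :=
  ∃ h : IsHermitian g J, d I (fundamentalForm g J h) = 0

/-- The complex dimension of a manifold with model vector space `E` that carries a complex
structure. -/
def complexDim {E : Type*} [NormedAddCommGroup E] [NormedSpace ℝ E] {H : Type*}
    [TopologicalSpace H] (_ : ModelWithCorners ℝ E H) : ℕ := Module.finrank ℝ E / 2

/-- A balanced metric: a Hermitian metric whose fundamental form `η` satisfies
`d (η ^ (n - 1)) = 0`, where `n` is the complex dimension. -/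
def IsBalanced (g : Metric I N) (J : TangentComplexStructure I N) : Prop :=
  ∃ h : IsHermitian g J,
    d I (fun x => wedgePow (fundamentalForm g J h x) (complexDim I - 1)) = 0

/-- An astheno-Kähler metric: a Hermitian metric whose fundamental form `η` satisfies
`i ∂ ∂̄ (η ^ (n - 2)) = 0`, where `n` is the complex dimension. -/
def IsAsthenoKahler (g : Metric I N) (J : TangentComplexStructure I N) : Prop :=
  ∃ h : IsHermitian g J,
    iDelDelbar J (fun x => wedgePow (fundamentalForm g J h x) (complexDim I - 2)) = 0

/-- A plurisubharmonic metric: a Hermitian metric whose fundamental form `η` satisfies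
`i ∂ ∂̄ η ≥ 0` as a `(2, 2)`-form, i.e. it is non-negative on every complex two-plane with its
complex orientation. (The form `i ∂ ∂̄ η` is real, so its real part is the form itself.) -/
def IsPlurisubharmonic (g : Metric I N) (J : TangentComplexStructure I N) : Prop :=
  ∃ h : IsHermitian g J, ∀ (x : N) (u v : TangentSpace I x),
    0 ≤ (iDelDelbar J (fundamentalForm g J h) x ![u, J x u, v, J x v]).re

end Forms

/-! ### Hyperkähler manifolds -/

section Hyperkahler

variable {E : Type*} [NormedAddCommGroup E] [NormedSpace ℝ E] {H : Type*} [TopologicalSpace H]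
  (I₀ : ModelWithCorners ℝ E H) (M : Type*) [TopologicalSpace M] [ChartedSpace H M]
  [IsManifold I₀ ∞ M]

/-- A hyperkähler structure: a Riemannian metric `g` and integrable complex structures
`I`, `J`, `K` with `I J K = -1`, each of which is Kähler together with `g`. -/
structure Hyperkahler where
  g : Metric I₀ M
  I : TangentComplexStructure I₀ M
  J : TangentComplexStructure I₀ M
  K : TangentComplexStructure I₀ M
  isComplex_I : IsComplex I
  isComplex_J : IsComplex J
  isComplex_K : IsComplex K
  quaternion : ∀ (x : M) (v : TangentSpace I₀ x), I x (J x (K x v)) = -v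
  isKahler_I : IsKahler g I
  isKahler_J : IsKahler g J
  isKahler_K : IsKahler g K

variable {I₀ M}

theorem Hyperkahler.unit_sq (h : Hyperkahler I₀ M) (x : M) {a b c : ℝ}
    (hs : a ^ 2 + b ^ 2 + c ^ 2 = 1) (v : TangentSpace I₀ x) :
    (a • h.I x + b • h.J x + c • h.K x) ((a • h.I x + b • h.J x + c • h.K x) v) = -v := by
  have hIJ : ∀ w, h.I x (h.J x w) = h.K x w := fun w => by
    have := h.quaternion x (h.K x w)
    rw [h.K.sq, map_neg, map_neg] at this
    exact neg_injective this
  have hIK : ∀ w, h.I x (h.K x w) = -h.J x w := fun w => by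
    rw [← hIJ, h.I.sq]
  have hJK : ∀ w, h.J x (h.K x w) = h.I x w := fun w => by
    have := congrArg (h.I x) (h.quaternion x w)
    rw [h.I.sq, map_neg] at this
    exact neg_injective this
  have hJI : ∀ w, h.J x (h.I x w) = -h.K x w := fun w => by
    rw [← hJK, h.J.sq]
  have hKJ : ∀ w, h.K x (h.J x w) = -h.I x w := fun w => by
    rw [← hIJ, h.J.sq, map_neg]
  have hKI : ∀ w, h.K x (h.I x w) = h.J x w := fun w => by
    rw [← hIJ, hJI, map_neg, hIK, neg_neg]
  simp only [add_apply, smul_apply, map_add, map_smul, h.I.sq, h.J.sq, h.K.sq, hIJ, hIK, hJK,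
    hJI, hKJ, hKI]
  have : v = (a ^ 2 + b ^ 2 + c ^ 2) • v := by rw [hs, one_smul]
  conv_rhs => rw [this]
  module

end Hyperkahler

/-! ### Complex manifolds as real manifolds -/

section Complex

variable {F : Type*} [NormedAddCommGroup F] [NormedSpace ℂ F]
  {Y : Type*} [TopologicalSpace Y] [ChartedSpace F Y]

/-- A complex manifold is a smooth real manifold with the same atlas. -/
instance isManifold_real [h : IsManifold 𝓘(ℂ, F) ω Y] : IsManifold 𝓘(ℝ, F) ∞ Y := by
  refine isManifold_of_contDiffOn _ _ _ fun e e' he he' => ?_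
  have h1 := (contDiffGroupoid ω 𝓘(ℂ, F)).compatible he he'
  rw [contDiffGroupoid, mem_groupoid_of_pregroupoid] at h1
  have h2 : ContDiffOn ℂ ω (𝓘(ℂ, F) ∘ (e.symm ≫ₕ e') ∘ 𝓘(ℂ, F).symm)
      (𝓘(ℂ, F).symm ⁻¹' (e.symm ≫ₕ e').source ∩ range 𝓘(ℂ, F)) := h1.1
  exact (h2.restrict_scalars ℝ).of_le le_top

variable (F Y) in
/-- The complex structure of a complex manifold: multiplication by `i` on the tangent spaces. -/
def complexStructure : TangentComplexStructure 𝓘(ℝ, F) Y where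
  toFun _ := ((Complex.I • ContinuousLinearMap.id ℂ F).restrictScalars ℝ : F →L[ℝ] F)
  sq _ v := by
    have key : ∀ w : F, Complex.I • Complex.I • w = -w := fun w => by
      rw [smul_smul, Complex.I_mul_I, neg_one_smul]
    exact key v

/-- The two-sphere `{(a, b, c) : a ^ 2 + b ^ 2 + c ^ 2 = 1}`. -/
abbrev Sphere2 := Metric.sphere (0 : EuclideanSpace ℝ (Fin 3)) 1

/-- The complex structure `j` of `S² = ℂℙ¹`: on the tangent plane at `u` it is `w ↦ u × w`.
It is the complex structure for which `(b + i c) / (1 + a)` is a holomorphic coordinate. -/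
def sphereJ (u : Sphere2) (w : EuclideanSpace ℝ (Fin 3)) : EuclideanSpace ℝ (Fin 3) :=
  WithLp.toLp 2 (crossProduct (u : EuclideanSpace ℝ (Fin 3)).ofLp w.ofLp)

/-- A holomorphic map `Y → S² = ℂℙ¹`: it is smooth, and its differential intertwines the complex
structure of `Y` with `j`. -/
def IsHolomorphicToSphere (φ : Y → Sphere2) : Prop :=
  ContMDiff 𝓘(ℝ, F) 𝓘(ℝ, EuclideanSpace ℝ (Fin 3)) ∞
    (fun y => (φ y : EuclideanSpace ℝ (Fin 3))) ∧
  ∀ (y : Y) (v : TangentSpace 𝓘(ℝ, F) y),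
    mfderiv 𝓘(ℝ, F) 𝓘(ℝ, EuclideanSpace ℝ (Fin 3))
        (fun y => (φ y : EuclideanSpace ℝ (Fin 3))) y (complexStructure F Y y v) =
      sphereJ (φ y) (mfderiv 𝓘(ℝ, F) 𝓘(ℝ, EuclideanSpace ℝ (Fin 3))
        (fun y => (φ y : EuclideanSpace ℝ (Fin 3))) y v)

end Complex

/-! ### Greatly generalized Calabi–Gray manifolds -/

section Twisted

variable {E : Type*} [NormedAddCommGroup E] [NormedSpace ℝ E]
  {M : Type*} [TopologicalSpace M] [ChartedSpace E M] [IsManifold 𝓘(ℝ, E) ∞ M]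
  {F : Type*} [NormedAddCommGroup F] [NormedSpace ℂ F]
  {Y : Type*} [TopologicalSpace Y] [ChartedSpace F Y]

/-- The twisted complex structure `(a I + b J + c K) ⊕ J_Y` on `X = M × Y`, where
`(a, b, c) = φ y` at the point `(m, y)`. With it, `X` is the pullback `φ^* Z` of the twistor
fibration `Z → ℂℙ¹` of `M`. -/
def twistedStructure (h : Hyperkahler 𝓘(ℝ, E) M) (φ : Y → Sphere2) :
    TangentComplexStructure (𝓘(ℝ, E).prod 𝓘(ℝ, F)) (M × Y) where
  toFun p := ContinuousLinearMap.prodMap (M₁ := TangentSpace 𝓘(ℝ, E) p.1)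
    (M₃ := TangentSpace 𝓘(ℝ, F) p.2)
    ((φ p.2).1 0 • h.I p.1 + (φ p.2).1 1 • h.J p.1 + (φ p.2).1 2 • h.K p.1)
    (complexStructure F Y p.2)
  sq p v := by
    have hs : (φ p.2).1 0 ^ 2 + (φ p.2).1 1 ^ 2 + (φ p.2).1 2 ^ 2 = 1 := by
      have h1 : ‖(φ p.2).1‖ = 1 := by simp
      have h2 := EuclideanSpace.real_norm_sq_eq (φ p.2).1
      rw [h1, Fin.sum_univ_three] at h2
      linarith
    obtain ⟨v₁, v₂⟩ := v
    exact Prod.ext (h.unit_sq p.1 hs v₁) ((complexStructure F Y).sq p.2 v₂)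

end Twisted

end CalabiGray

end

/-! Let `w i` be the Kähler forms of `M` pulled back to `X = M × Y`, `a = (a 0, a 1, a 2)` the
components of `φ`, and `J` the structure of `X`. Everything rests on the twistor form `ω = ∑ a i w
i` and on two identities: `J* w i = 2 a i ω - w i`, which is quaternion algebra, and `da ∘ J = a ×
da`, which is the holomorphy of `φ`. The form `ω` is `J`-invariant, and `ω(v, J v)` is the square of
the length of the `M`-component of `v`.

Part (b). The identities give `J* dω = -P` with `P = ∑ (a × da) i ∧ w i`, and `dP = 2 σ ∧ ω`, where
`σ` is the pullback of the area form of the sphere. So `P = dᶜω` and `i ∂ ∂̄ ω = σ ∧ ω`, a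
non-negative form. Let `η` be the fundamental form of a Hermitian metric, `n` the complex dimension
and `β = η ^ (n - 2)`. If `i ∂ ∂̄ β = 0`, integrating by parts twice moves the derivatives from `ω`
to `β`: in `IsTwistor.exists_primitive` the form `γ = J* dβ ∧ ω + β ∧ P` satisfies `dγ = 2 β ∧ ω ∧
σ`. In a unitary frame adapted to `dφ` the right-hand side is a non-negative multiple of `η ^ n`,
nonzero wherever `dφ ≠ 0` because `M` has positive dimension (`exists_nonneg_wedge_wedge`). By
Stokes' theorem (`exact_nonneg_eq_zero`) an exact non-negative top form on a compact manifold
vanishes, so `dφ = 0` everywhere and `φ` is constant, a contradiction. Thus `X` has no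
astheno-Kähler metric. For a Kähler metric `β` is closed and the same argument applies.

Part (a). The product of the hyperkähler metric and a balanced metric of `Y` has fundamental form `ω
+ q`, and `d (ω + q) ^ (n - 1)` is a multiple of `(ω + q) ^ (n - 2) ∧ (∑ da i ∧ w i + dq)`. By
degree, only `ω ^ (2 m) ∧ q ^ (l - 2) ∧ dq` and the terms `ω ^ (2 m - 1) ∧ q ^ (l - 1) ∧ da i ∧ w i`
can survive, with `l` the complex dimension of `Y`. The former vanishes because `Y` is balanced. In
the latter, `∑ a i da i = 0` allows `w i` to be replaced by `w i - a i ω`, which is anti-invariant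
under the complex structure of `M`; its product with `ω ^ (2 m - 1)` is an anti-invariant top form
on `M`, hence zero.

Wedge identities are proved in the exterior algebra of the dual space, where products are
associative without changes of index type; `toForm` and `Rep` carry them over to alternating maps.
-/

noncomputable section

set_option linter.unusedSectionVars false

namespace CalabiGray

/-! ### Forms as elements of the exterior algebra of the dual space -/

section ExteriorAlgebra

open ExteriorAlgebra

variable {V : Type*} [TopologicalSpace V] [AddCommGroup V] [Module ℝ V]
  {W : Type*} [TopologicalSpace W] [AddCommGroup W] [Module ℝ W]

/-- The exterior algebra of the dual space. -/
abbrev Ext (V : Type*) [TopologicalSpace V] [AddCommGroup V] [Module ℝ V] :=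
  ExteriorAlgebra ℝ (V →L[ℝ] ℝ)

/-- The form `l₁ ∧ ⋯ ∧ lₖ`, as an alternating function of the covectors `lᵢ`. -/
def detForm (k : ℕ) : (V →L[ℝ] ℝ) [⋀^Fin k]→ₗ[ℝ] (V [⋀^Fin k]→L[ℝ] ℝ) where
  toFun l :=
    { (Matrix.detRowAlternating (n := Fin k) (R := ℝ)).compLinearMap
        (LinearMap.pi fun j => (l j : V →ₗ[ℝ] ℝ)) with
      cont := by
        change Continuous fun v : Fin k → V => Matrix.det (Matrix.of fun i j => l j (v i))
        refine Continuous.matrix_det ?_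
        fun_prop }
  map_update_add' := by
    intro inst l i x y
    have e : inst = instDecidableEqFin k := Subsingleton.elim _ _
    subst e
    ext v
    have h : ∀ z : V →L[ℝ] ℝ, Matrix.of (fun a b => Function.update l i z b (v a)) =
        Matrix.updateCol (Matrix.of fun a b => l b (v a)) i (fun a => z (v a)) := by
      intro z; ext a b
      by_cases hb : b = i
      · subst hb; simp
      · simp [hb]
    change Matrix.det (Matrix.of fun a b => Function.update l i (x + y) b (v a)) =
      Matrix.det (Matrix.of fun a b => Function.update l i x b (v a)) +
      Matrix.det (Matrix.of fun a b => Function.update l i y b (v a))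
    rw [h, h, h, ← Matrix.det_updateCol_add]
    rfl
  map_update_smul' := by
    intro inst l i c x
    have e : inst = instDecidableEqFin k := Subsingleton.elim _ _
    subst e
    ext v
    have h : ∀ z : V →L[ℝ] ℝ, Matrix.of (fun a b => Function.update l i z b (v a)) =
        Matrix.updateCol (Matrix.of fun a b => l b (v a)) i (fun a => z (v a)) := by
      intro z; ext a b
      by_cases hb : b = i
      · subst hb; simp
      · simp [hb]
    change Matrix.det (Matrix.of fun a b => Function.update l i (c • x) b (v a)) =
      c • Matrix.det (Matrix.of fun a b => Function.update l i x b (v a))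
    rw [h, h, smul_eq_mul, ← Matrix.det_updateCol_smul]
    rfl
  map_eq_zero_of_eq' := by
    intro l i j hl hij
    ext v
    exact Matrix.det_zero_of_column_eq hij (fun a => by simp [hl])

theorem detForm_apply {k : ℕ} (l : Fin k → V →L[ℝ] ℝ) (v : Fin k → V) :
    detForm k l v = Matrix.det (Matrix.of fun i j => l j (v i)) := rfl

theorem detForm_eq_sum {k : ℕ} (l : Fin k → V →L[ℝ] ℝ) (v : Fin k → V) :
    detForm k l v = ∑ σ : Equiv.Perm (Fin k), (Equiv.Perm.sign σ : ℝ) * ∏ i, l i (v (σ i)) := by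
  rw [detForm_apply, Matrix.det_apply']
  rfl

theorem wedge_apply {k l : ℕ} (α : V [⋀^Fin k]→L[ℝ] ℝ) (β : V [⋀^Fin l]→L[ℝ] ℝ)
    (v : Fin (k + l) → V) :
    wedge α β v = (k.factorial * l.factorial : ℝ)⁻¹ * ∑ σ : Equiv.Perm (Fin (k + l)),
      (Equiv.Perm.sign σ : ℝ) * (α (fun i => v (σ (Fin.castAdd l i))) *
        β (fun j => v (σ (Fin.natAdd k j)))) := by
  rw [wedge, ContinuousAlternatingMap.smul_apply, ContinuousMultilinearMap.alternatization_apply_apply, smul_eq_mul]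
  congr 1
  refine Finset.sum_congr rfl fun σ _ => ?_
  rw [Units.smul_def, zsmul_eq_mul]
  rfl

/-- Composing `σ` on the right with the block permutation `P τ ρ` absorbs the signs of `τ` and `ρ`,
so each of the `k! l!` pairs `(τ, ρ)` contributes the whole determinant. This cancels the
normalisation of `wedge`. -/
theorem wedge_detForm {k l : ℕ} (a : Fin k → V →L[ℝ] ℝ) (b : Fin l → V →L[ℝ] ℝ) :
    wedge (detForm k a) (detForm l b) = detForm (k + l) (Fin.append a b) := by
  ext v
  let P : Equiv.Perm (Fin k) → Equiv.Perm (Fin l) → Equiv.Perm (Fin (k + l)) := fun τ ρ =>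
    finSumFinEquiv.permCongr (Equiv.Perm.sumCongr τ ρ)
  have hP1 : ∀ τ ρ i, P τ ρ (Fin.castAdd l i) = Fin.castAdd l (τ i) := by
    intro τ ρ i; simp [P, Equiv.permCongr_apply]
  have hP2 : ∀ τ ρ i, P τ ρ (Fin.natAdd k i) = Fin.natAdd k (ρ i) := by
    intro τ ρ i; simp [P, Equiv.permCongr_apply]
  have hPs : ∀ τ ρ, Equiv.Perm.sign (P τ ρ) = Equiv.Perm.sign τ * Equiv.Perm.sign ρ := by
    intro τ ρ; simp [P]
  have key : ∀ τ ρ, ∑ σ : Equiv.Perm (Fin (k + l)), (Equiv.Perm.sign σ : ℝ) *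
      (((Equiv.Perm.sign τ : ℝ) * ∏ i, a i (v (σ (Fin.castAdd l (τ i))))) *
        ((Equiv.Perm.sign ρ : ℝ) * ∏ i, b i (v (σ (Fin.natAdd k (ρ i)))))) =
      detForm (k + l) (Fin.append a b) v := by
    intro τ ρ
    rw [detForm_eq_sum]
    symm
    rw [← Equiv.sum_comp (Equiv.mulRight (P τ ρ))]
    refine Finset.sum_congr rfl fun σ _ => ?_
    simp only [Equiv.coe_mulRight, Equiv.Perm.sign_mul, hPs, Fin.prod_univ_add, Fin.append_left,
      Fin.append_right, Equiv.Perm.mul_apply, hP1, hP2]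
    push_cast
    ring
  rw [wedge_apply]
  simp only [detForm_eq_sum a, detForm_eq_sum b]
  simp only [Finset.sum_mul_sum]
  simp only [Finset.mul_sum _ _ (Equiv.Perm.sign _ : ℝ)]
  have h2 : ∑ σ : Equiv.Perm (Fin (k + l)), ∑ τ : Equiv.Perm (Fin k), ∑ ρ : Equiv.Perm (Fin l),
      (Equiv.Perm.sign σ : ℝ) *
      (((Equiv.Perm.sign τ : ℝ) * ∏ i, a i (v (σ (Fin.castAdd l (τ i))))) *
        ((Equiv.Perm.sign ρ : ℝ) * ∏ i, b i (v (σ (Fin.natAdd k (ρ i)))))) =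
      (k.factorial * l.factorial : ℝ) * detForm (k + l) (Fin.append a b) v := by
    rw [Finset.sum_comm]
    have : ∀ τ ∈ (Finset.univ : Finset (Equiv.Perm (Fin k))),
        ∑ σ : Equiv.Perm (Fin (k + l)), ∑ ρ : Equiv.Perm (Fin l),
      (Equiv.Perm.sign σ : ℝ) *
      (((Equiv.Perm.sign τ : ℝ) * ∏ i, a i (v (σ (Fin.castAdd l (τ i))))) *
        ((Equiv.Perm.sign ρ : ℝ) * ∏ i, b i (v (σ (Fin.natAdd k (ρ i)))))) =
        (l.factorial : ℝ) * detForm (k + l) (Fin.append a b) v := by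
      intro τ _
      rw [Finset.sum_comm, Finset.sum_congr rfl (fun ρ _ => key τ ρ)]
      simp [Finset.card_univ, Fintype.card_perm]
    rw [Finset.sum_congr rfl this]
    simp [Finset.card_univ, Fintype.card_perm, mul_assoc]
  have h3 : (k.factorial * l.factorial : ℝ) ≠ 0 := by positivity
  rw [h2, inv_mul_cancel_left₀ h3]

theorem wedge_add_left {k l : ℕ} (α α' : V [⋀^Fin k]→L[ℝ] ℝ) (β : V [⋀^Fin l]→L[ℝ] ℝ) :
    wedge (α + α') β = wedge α β + wedge α' β := by
  ext v
  simp only [wedge_apply, ContinuousAlternatingMap.add_apply, add_mul, mul_add,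
    Finset.sum_add_distrib]

theorem wedge_add_right {k l : ℕ} (α : V [⋀^Fin k]→L[ℝ] ℝ) (β β' : V [⋀^Fin l]→L[ℝ] ℝ) :
    wedge α (β + β') = wedge α β + wedge α β' := by
  ext v
  simp only [wedge_apply, ContinuousAlternatingMap.add_apply, mul_add, Finset.sum_add_distrib]

theorem wedge_smul_left {k l : ℕ} (c : ℝ) (α : V [⋀^Fin k]→L[ℝ] ℝ) (β : V [⋀^Fin l]→L[ℝ] ℝ) :
    wedge (c • α) β = c • wedge α β := by
  ext v
  simp only [wedge_apply, ContinuousAlternatingMap.smul_apply, smul_eq_mul, Finset.mul_sum]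
  exact Finset.sum_congr rfl fun σ _ => by ring

theorem wedge_smul_right {k l : ℕ} (c : ℝ) (α : V [⋀^Fin k]→L[ℝ] ℝ) (β : V [⋀^Fin l]→L[ℝ] ℝ) :
    wedge α (c • β) = c • wedge α β := by
  ext v
  simp only [wedge_apply, ContinuousAlternatingMap.smul_apply, smul_eq_mul, Finset.mul_sum]
  exact Finset.sum_congr rfl fun σ _ => by ring

/-- The wedge product as a bilinear map. -/
def wedgeLin (k l : ℕ) : (V [⋀^Fin k]→L[ℝ] ℝ) →ₗ[ℝ] (V [⋀^Fin l]→L[ℝ] ℝ) →ₗ[ℝ]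
    (V [⋀^Fin (k + l)]→L[ℝ] ℝ) :=
  LinearMap.mk₂ ℝ wedge wedge_add_left wedge_smul_left wedge_add_right wedge_smul_right

theorem wedge_zero_left {k l : ℕ} (β : V [⋀^Fin l]→L[ℝ] ℝ) :
    wedge (0 : V [⋀^Fin k]→L[ℝ] ℝ) β = 0 :=
  LinearMap.congr_fun (map_zero (wedgeLin k l)) β

theorem wedge_zero_right {k l : ℕ} (α : V [⋀^Fin k]→L[ℝ] ℝ) :
    wedge α (0 : V [⋀^Fin l]→L[ℝ] ℝ) = 0 := map_zero (wedgeLin k l α)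

theorem wedge_compContinuousLinearMap {k l : ℕ} (α : V [⋀^Fin k]→L[ℝ] ℝ)
    (β : V [⋀^Fin l]→L[ℝ] ℝ) (A : W →L[ℝ] V) :
    (wedge α β).compContinuousLinearMap A =
      wedge (α.compContinuousLinearMap A) (β.compContinuousLinearMap A) := by
  ext v
  simp only [ContinuousAlternatingMap.compContinuousLinearMap_apply, wedge_apply]
  rfl

theorem wedgePow_compContinuousLinearMap (α : V [⋀^Fin 2]→L[ℝ] ℝ) (A : W →L[ℝ] V) (k : ℕ) :
    (wedgePow α k).compContinuousLinearMap A = wedgePow (α.compContinuousLinearMap A) k := by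
  induction k with
  | zero => ext v; rfl
  | succ k ih => rw [wedgePow, wedge_compContinuousLinearMap, ih, wedgePow]

/-- The `k`-form defined by an element of the exterior algebra of the dual space. -/
def toForm (k : ℕ) : Ext V →ₗ[ℝ] (V [⋀^Fin k]→L[ℝ] ℝ) :=
  ExteriorAlgebra.liftAlternating (fun i => if h : k = i then by subst h; exact detForm k else 0)

theorem toForm_ιMulti (k : ℕ) (l : Fin k → V →L[ℝ] ℝ) :
    toForm k (ιMulti ℝ k l) = detForm k l := by
  simp [toForm]

/-- An induction principle for statements linear in `x`: it reduces them to products of covectors,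
on which `toForm` is a determinant. -/
theorem ext_span {k : ℕ} {p : ∀ x ∈ ⋀[ℝ]^k (V →L[ℝ] ℝ), Prop}
    (h1 : ∀ l, p (ιMulti ℝ k l) (ιMulti_range ℝ k ⟨l, rfl⟩))
    (h2 : ∀ x hx y hy, p x hx → p y hy → p (x + y) (add_mem hx hy))
    (h3 : ∀ (c : ℝ) x hx, p x hx → p (c • x) (Submodule.smul_mem _ c hx))
    (x : Ext V) (hx : x ∈ ⋀[ℝ]^k (V →L[ℝ] ℝ)) : p x hx := by
  have hx' := hx
  rw [← ιMulti_span_fixedDegree] at hx'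
  induction hx' using Submodule.span_induction with
  | mem x h => obtain ⟨l, rfl⟩ := h; exact h1 l
  | zero =>
    have := h3 0 _ _ (h1 0)
    simpa using this
  | add x y hx₁ hy₁ ihx ihy =>
    rw [ιMulti_span_fixedDegree] at hx₁ hy₁
    exact h2 x hx₁ y hy₁ (ihx hx₁) (ihy hy₁)
  | smul c x hx₁ ih =>
    rw [ιMulti_span_fixedDegree] at hx₁
    exact h3 c x hx₁ (ih hx₁)

/-- The bridge between the two models of forms. Both sides are bilinear, so it suffices to compare
products of covectors, which is `wedge_detForm`. -/
theorem toForm_mul {k l : ℕ} {x y : Ext V} (hx : x ∈ ⋀[ℝ]^k (V →L[ℝ] ℝ))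
    (hy : y ∈ ⋀[ℝ]^l (V →L[ℝ] ℝ)) :
    toForm (k + l) (x * y) = wedge (toForm k x) (toForm l y) := by
  refine ext_span (p := fun x _ => toForm (k + l) (x * y) = wedge (toForm k x) (toForm l y))
    (fun a => ?_) ?_ ?_ x hx
  · refine ext_span (p := fun y _ => toForm (k + l) (ιMulti ℝ k a * y) =
      wedge (toForm k (ιMulti ℝ k a)) (toForm l y)) (fun b => ?_) ?_ ?_ y hy
    · rw [ιMulti_mul_ιMulti, toForm_ιMulti, toForm_ιMulti, toForm_ιMulti, wedge_detForm]
    · intro x hx y hy h1 h2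
      rw [mul_add, map_add, map_add, h1, h2, wedge_add_right]
    · intro c x hx h
      rw [mul_smul_comm, map_smul, map_smul, h, wedge_smul_right]
  · intro x hx y hy h1 h2
    rw [add_mul, map_add, map_add, h1, h2, wedge_add_left]
  · intro c x hx h
    rw [smul_mul_assoc, map_smul, map_smul, h, wedge_smul_left]

theorem toForm_one : toForm 0 (1 : Ext V) = ContinuousAlternatingMap.constOfIsEmpty ℝ V (Fin 0) 1 := by
  rw [← ιMulti_zero_apply (R := ℝ) (M := V →L[ℝ] ℝ) 0, toForm_ιMulti]
  ext v
  rw [detForm_apply, Matrix.det_isEmpty]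
  rfl

theorem toForm_ι_mul_ι (a b : V →L[ℝ] ℝ) (v : Fin 2 → V) :
    toForm 2 (ι ℝ a * ι ℝ b) v = a (v 0) * b (v 1) - a (v 1) * b (v 0) := by
  have : ι ℝ a * ι ℝ b = ιMulti ℝ 2 ![a, b] := by simp [ιMulti_apply]
  rw [this, toForm_ιMulti, detForm_apply, Matrix.det_fin_two]
  simp; ring

theorem ι_mem (l : V →L[ℝ] ℝ) : ι ℝ l ∈ ⋀[ℝ]^1 (V →L[ℝ] ℝ) := by
  rw [exteriorPower, pow_one]; exact ⟨l, rfl⟩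

theorem mul_mem_ext {k l : ℕ} {x y : Ext V} (hx : x ∈ ⋀[ℝ]^k (V →L[ℝ] ℝ))
    (hy : y ∈ ⋀[ℝ]^l (V →L[ℝ] ℝ)) : x * y ∈ ⋀[ℝ]^(k + l) (V →L[ℝ] ℝ) := by
  rw [exteriorPower, pow_add]; exact Submodule.mul_mem_mul hx hy

theorem pow_mem_ext {x : Ext V} (hx : x ∈ ⋀[ℝ]^2 (V →L[ℝ] ℝ)) (k : ℕ) :
    x ^ k ∈ ⋀[ℝ]^(2 * k) (V →L[ℝ] ℝ) := by
  rw [exteriorPower, pow_mul]; exact Submodule.pow_mem_pow _ hx k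

theorem toForm_pow {x : Ext V} (hx : x ∈ ⋀[ℝ]^2 (V →L[ℝ] ℝ)) (k : ℕ) :
    toForm (2 * k) (x ^ k) = wedgePow (toForm 2 x) k := by
  induction k with
  | zero => rw [pow_zero, wedgePow]; exact toForm_one
  | succ k ih => rw [pow_succ, wedgePow, ← ih]; exact toForm_mul (pow_mem_ext hx k) hx

/-- Pullback of elements of the exterior algebras by a linear map. -/
def extMap (A : W →L[ℝ] V) : Ext V →ₐ[ℝ] Ext W :=
  ExteriorAlgebra.map (LinearMap.mk ⟨fun l : V →L[ℝ] ℝ => l.comp A, fun _ _ => rfl⟩ fun _ _ => rfl)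

theorem extMap_ι (A : W →L[ℝ] V) (l : V →L[ℝ] ℝ) : extMap A (ι ℝ l) = ι ℝ (l.comp A) :=
  map_apply_ι _ _

theorem extMap_ιMulti (A : W →L[ℝ] V) {k : ℕ} (l : Fin k → V →L[ℝ] ℝ) :
    extMap A (ιMulti ℝ k l) = ιMulti ℝ k (fun i => (l i).comp A) := map_apply_ιMulti _ _

theorem extMap_mem (A : W →L[ℝ] V) {k : ℕ} {x : Ext V} (hx : x ∈ ⋀[ℝ]^k (V →L[ℝ] ℝ)) :
    extMap A x ∈ ⋀[ℝ]^k (W →L[ℝ] ℝ) := by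
  refine ext_span (p := fun x _ => extMap A x ∈ ⋀[ℝ]^k (W →L[ℝ] ℝ)) (fun l => ?_) ?_ ?_ x hx
  · rw [extMap_ιMulti]; exact ιMulti_range ℝ k ⟨_, rfl⟩
  · intro x hx y hy h1 h2; rw [map_add]; exact add_mem h1 h2
  · intro c x hx h; rw [map_smul]; exact Submodule.smul_mem _ c h

theorem toForm_extMap (A : W →L[ℝ] V) {k : ℕ} {x : Ext V} (hx : x ∈ ⋀[ℝ]^k (V →L[ℝ] ℝ)) :
    toForm k (extMap A x) = (toForm k x).compContinuousLinearMap A := by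
  refine ext_span (p := fun x _ => toForm k (extMap A x) =
    (toForm k x).compContinuousLinearMap A) (fun l => ?_) ?_ ?_ x hx
  · rw [extMap_ιMulti, toForm_ιMulti, toForm_ιMulti]; rfl
  · intro x hx y hy h1 h2; rw [map_add, map_add, map_add, h1, h2]; rfl
  · intro c x hx h; rw [map_smul, map_smul, map_smul, h]; rfl

/-- Moving a covector past a product of two covectors costs two signs. The general case follows
because `x` is built from elements of degree two and `y` from covectors. -/
theorem ext_comm_of_even {k l : ℕ} {x y : Ext V} (hx : x ∈ ⋀[ℝ]^(2 * k) (V →L[ℝ] ℝ))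
    (hy : y ∈ ⋀[ℝ]^l (V →L[ℝ] ℝ)) : Commute x y := by
  have h0 : ∀ a b : V →L[ℝ] ℝ, ι ℝ a * ι ℝ b = -(ι ℝ b * ι ℝ a) := fun a b =>
    eq_neg_of_add_eq_zero_left (ι_add_mul_swap a b)
  have h1 : ∀ a b c : V →L[ℝ] ℝ, Commute (ι ℝ a * ι ℝ b) (ι ℝ c) := by
    intro a b c
    rw [Commute, SemiconjBy, mul_assoc, h0 b c, mul_neg, ← mul_assoc, h0 a c, neg_mul, neg_neg,
      mul_assoc]
  have h2 : ∀ (x : Ext V), x ∈ ⋀[ℝ]^2 (V →L[ℝ] ℝ) → ∀ c, Commute x (ι ℝ c) := by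
    intro x hx c
    refine ext_span (p := fun x _ => Commute x (ι ℝ c)) (fun l => ?_) ?_ ?_ x hx
    · have : ιMulti ℝ 2 l = ι ℝ (l 0) * ι ℝ (l 1) := by simp [ιMulti_apply]; rfl
      rw [this]; exact h1 _ _ _
    · intro x hx y hy h1 h2; exact h1.add_left h2
    · intro c x hx h; exact h.smul_left c
  have h3 : ∀ c, Commute x (ι ℝ c) := by
    intro c
    rw [exteriorPower, pow_mul] at hx
    induction hx using Submodule.pow_induction_on_left' with
    | algebraMap r => exact Algebra.commute_algebraMap_left _ _
    | add x y i hx hy h1 h2 => exact h1.add_left h2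
    | mem_mul m hm i x hx ih => exact (h2 m hm c).mul_left ih
  rw [exteriorPower] at hy
  induction hy using Submodule.pow_induction_on_left' with
  | algebraMap r => exact Algebra.commute_algebraMap_right _ _
  | add x y i hx hy h1 h2 => exact h1.add_right h2
  | mem_mul m hm i x hx ih =>
    obtain ⟨c, rfl⟩ := hm
    exact (h3 c).mul_right ih

/-- In a degree `j = k + l`, a product vanishes as a form as soon as its left factor does. -/
theorem toForm_mul_eq_zero_of_left {k l j : ℕ} (h : j = k + l) {x y : Ext V}
    (hx : x ∈ ⋀[ℝ]^k (V →L[ℝ] ℝ)) (hy : y ∈ ⋀[ℝ]^l (V →L[ℝ] ℝ)) (h0 : toForm k x = 0) :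
    toForm j (x * y) = 0 := by
  subst h; rw [toForm_mul hx hy, h0, wedge_zero_left]

theorem toForm_mul_eq_zero_of_right {k l j : ℕ} (h : j = k + l) {x y : Ext V}
    (hx : x ∈ ⋀[ℝ]^k (V →L[ℝ] ℝ)) (hy : y ∈ ⋀[ℝ]^l (V →L[ℝ] ℝ)) (h0 : toForm l y = 0) :
    toForm j (x * y) = 0 := by
  subst h; rw [toForm_mul hx hy, h0, wedge_zero_right]

end ExteriorAlgebra

end CalabiGray

namespace CalabiGray

/-! ### Every form on a finite-dimensional space comes from the exterior algebra. -/

section Surjectivity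

open ExteriorAlgebra

variable {V : Type*} [TopologicalSpace V] [AddCommGroup V] [Module ℝ V]

theorem toForm_mul_congr_left {k l j : ℕ} (h : j = k + l) {x x' y : Ext V}
    (hx : x ∈ ⋀[ℝ]^k (V →L[ℝ] ℝ)) (hx' : x' ∈ ⋀[ℝ]^k (V →L[ℝ] ℝ))
    (hy : y ∈ ⋀[ℝ]^l (V →L[ℝ] ℝ)) (h0 : toForm k x = toForm k x') :
    toForm j (x * y) = toForm j (x' * y) := by
  subst h; rw [toForm_mul hx hy, toForm_mul hx' hy, h0]

theorem toForm_mul_congr_right {k l j : ℕ} (h : j = k + l) {x y y' : Ext V}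
    (hx : x ∈ ⋀[ℝ]^k (V →L[ℝ] ℝ)) (hy : y ∈ ⋀[ℝ]^l (V →L[ℝ] ℝ))
    (hy' : y' ∈ ⋀[ℝ]^l (V →L[ℝ] ℝ)) (h0 : toForm l y = toForm l y') :
    toForm j (x * y) = toForm j (x * y') := by
  subst h; rw [toForm_mul hx hy, toForm_mul hx hy', h0]

theorem ι_mul_eq {k : ℕ} (a : V →L[ℝ] ℝ) {x : Ext V} (hx : x ∈ ⋀[ℝ]^k (V →L[ℝ] ℝ)) :
    ι ℝ a * x = (-1 : ℝ) ^ k • (x * ι ℝ a) := by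
  rw [exteriorPower] at hx
  induction hx using Submodule.pow_induction_on_left' with
  | algebraMap r => rw [pow_zero, one_smul]; exact (Algebra.commutes r _).symm
  | add x y i hx hy h1 h2 => rw [mul_add, h1, h2, add_mul, smul_add]
  | mem_mul m hm i x hx ih =>
    obtain ⟨c, rfl⟩ := hm
    rw [← mul_assoc, eq_neg_of_add_eq_zero_left (ι_add_mul_swap a c), neg_mul, mul_assoc, ih,
      mul_smul_comm, pow_succ, ← mul_assoc, mul_neg_one, neg_smul]

variable [IsTopologicalAddGroup V] [ContinuousSMul ℝ V] [T2Space V] [FiniteDimensional ℝ V]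

/-- The covectors of the dual basis. -/
def coord {n : Type*} (b : Module.Basis n ℝ V) (i : n) : V →L[ℝ] ℝ :=
  LinearMap.toContinuousLinearMap (b.coord i)

/-- The sum antisymmetrises the multilinear expansion of `α` in the basis. As `α` is already
alternating, each of the `k!` permutations returns `α`, whence the factor. -/
theorem eq_toForm_basis {n : Type*} [Fintype n] (b : Module.Basis n ℝ V) {k : ℕ}
    (α : V [⋀^Fin k]→L[ℝ] ℝ) :
    α = toForm k ((k.factorial : ℝ)⁻¹ • ∑ f : Fin k → n,
      α (fun i => b (f i)) • ιMulti ℝ k (fun i => coord b (f i))) := by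
  classical
  have h1 : ∀ v : Fin k → V, ∑ f : Fin k → n, α (fun i => b (f i)) * ∏ i, coord b (f i) (v i)
      = α v := by
    intro v
    conv_rhs => rw [show v = fun i => ∑ j, b.repr (v i) j • b j from
      funext fun i => (b.sum_repr (v i)).symm]
    have := α.toMultilinearMap.map_sum (fun i j => b.repr (v i) j • b j)
    refine Eq.trans ?_ this.symm
    refine Finset.sum_congr rfl fun f _ => ?_
    rw [MultilinearMap.map_smul_univ, smul_eq_mul, mul_comm]
    rfl
  ext v
  rw [map_smul, map_sum, ContinuousAlternatingMap.smul_apply, ContinuousAlternatingMap.sum_apply]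
  simp only [map_smul, toForm_ιMulti, ContinuousAlternatingMap.smul_apply, detForm_eq_sum,
    smul_eq_mul]
  have h2 : ∑ f : Fin k → n, α (fun i => b (f i)) * ∑ σ : Equiv.Perm (Fin k),
      (Equiv.Perm.sign σ : ℝ) * ∏ i, coord b (f i) (v (σ i)) = k.factorial * α v := by
    simp only [Finset.mul_sum]
    rw [Finset.sum_comm]
    have : ∀ σ ∈ (Finset.univ : Finset (Equiv.Perm (Fin k))), ∑ f : Fin k → n,
        α (fun i => b (f i)) * ((Equiv.Perm.sign σ : ℝ) * ∏ i, coord b (f i) (v (σ i))) = α v := by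
      intro σ _
      have h3 := h1 (v ∘ σ)
      have h4 := α.toAlternatingMap.map_perm v σ
      have h5 : α (v ∘ σ) = (Equiv.Perm.sign σ : ℝ) * α v := by
        refine Eq.trans h4 ?_
        rw [Units.smul_def, zsmul_eq_mul]; rfl
      have h6 : (Equiv.Perm.sign σ : ℝ) * (Equiv.Perm.sign σ : ℝ) = 1 := by
        rcases Int.units_eq_one_or (Equiv.Perm.sign σ) with h | h <;> simp [h]
      calc _ = (Equiv.Perm.sign σ : ℝ) * ∑ f : Fin k → n, α (fun i => b (f i)) *
              ∏ i, coord b (f i) ((v ∘ σ) i) := by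
            rw [Finset.mul_sum]
            exact Finset.sum_congr rfl fun f _ => by simp only [Function.comp_apply]; ring
        _ = _ := by rw [h3, h5, ← mul_assoc, h6, one_mul]
    rw [Finset.sum_congr rfl this]
    simp [Finset.card_univ, Fintype.card_perm]
  rw [h2, inv_mul_cancel_left₀ (by positivity)]

theorem exists_toForm {k : ℕ} (α : V [⋀^Fin k]→L[ℝ] ℝ) :
    ∃ x ∈ ⋀[ℝ]^k (V →L[ℝ] ℝ), toForm k x = α :=
  ⟨_, Submodule.smul_mem _ _ (Submodule.sum_mem _ fun _ _ => Submodule.smul_mem _ _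
    (ιMulti_range ℝ k ⟨_, rfl⟩)), (eq_toForm_basis (Module.finBasis ℝ V) α).symm⟩

/-- An element of the exterior algebra that represents the form `α`. -/
def lift {k : ℕ} (α : V [⋀^Fin k]→L[ℝ] ℝ) : Ext V := (exists_toForm α).choose

theorem lift_mem {k : ℕ} (α : V [⋀^Fin k]→L[ℝ] ℝ) : lift α ∈ ⋀[ℝ]^k (V →L[ℝ] ℝ) :=
  (exists_toForm α).choose_spec.1

theorem toForm_lift {k : ℕ} (α : V [⋀^Fin k]→L[ℝ] ℝ) : toForm k (lift α) = α :=
  (exists_toForm α).choose_spec.2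

end Surjectivity

/-! ### The algebraic half of the Leibniz rule. -/

section Normed

open ExteriorAlgebra ContinuousAlternatingMap

variable {V : Type*} [NormedAddCommGroup V] [NormedSpace ℝ V]

/-- This is the Laplace expansion of a determinant along its first column. It turns the
antisymmetrised derivative `extDeriv` into the operator `∑ dxᵢ ∧ ∂ᵢ`, which acts by left
multiplication in the exterior algebra. -/
theorem alternatizeUncurryFin_smulRight {k : ℕ} (a : V →L[ℝ] ℝ) {x : Ext V}
    (hx : x ∈ ⋀[ℝ]^k (V →L[ℝ] ℝ)) :
    alternatizeUncurryFin (a.smulRight (toForm k x)) = toForm (k + 1) (ι ℝ a * x) := by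
  refine ext_span (p := fun x _ => alternatizeUncurryFin (a.smulRight (toForm k x)) =
    toForm (k + 1) (ι ℝ a * x)) (fun l => ?_) ?_ ?_ x hx
  · have : ι ℝ a * ιMulti ℝ k l = ιMulti ℝ (k + 1) (Fin.cons a l) := by
      rw [ιMulti_succ_apply]; rfl
    rw [this, toForm_ιMulti, toForm_ιMulti]
    ext v
    rw [alternatizeUncurryFin_apply, detForm_apply, Matrix.det_succ_column_zero]
    refine Finset.sum_congr rfl fun i _ => ?_
    rw [ContinuousLinearMap.smulRight_apply, ContinuousAlternatingMap.smul_apply, detForm_apply,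
      zsmul_eq_mul, smul_eq_mul, mul_assoc]
    push_cast
    rfl
  · intro x hx y hy h1 h2
    rw [map_add, mul_add, map_add, ← h1, ← h2, ← alternatizeUncurryFin_add]
    congr 1
    ext; simp
  · intro c x hx h
    rw [map_smul, mul_smul_comm, map_smul, ← h, ← alternatizeUncurryFin_smul]
    congr 1
    ext; simp; ring

variable [FiniteDimensional ℝ V]

instance finiteDimensional_form (k : ℕ) : FiniteDimensional ℝ (V [⋀^Fin k]→L[ℝ] ℝ) :=
  Module.Finite.of_surjective ((toForm k).comp (⋀[ℝ]^k (V →L[ℝ] ℝ)).subtype) fun α => by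
    obtain ⟨x, hx, h⟩ := exists_toForm α
    exact ⟨⟨x, hx⟩, h⟩

/-- The wedge product as a continuous bilinear map. -/
def wedgeCLM (k l : ℕ) : (V [⋀^Fin k]→L[ℝ] ℝ) →L[ℝ] (V [⋀^Fin l]→L[ℝ] ℝ) →L[ℝ]
    (V [⋀^Fin (k + l)]→L[ℝ] ℝ) :=
  LinearMap.toContinuousLinearMap
    { toFun := fun α => LinearMap.toContinuousLinearMap (wedgeLin k l α)
      map_add' := fun α α' => by rw [map_add, map_add]
      map_smul' := fun c α => by rw [map_smul, map_smul]; rfl }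

theorem eq_sum_smulRight {k : ℕ} (A : V →L[ℝ] V [⋀^Fin k]→L[ℝ] ℝ) :
    A = ∑ i, (coord (Module.finBasis ℝ V) i).smulRight (A (Module.finBasis ℝ V i)) := by
  refine ContinuousLinearMap.ext fun v => ?_
  conv_lhs => rw [← (Module.finBasis ℝ V).sum_repr v]
  rw [_root_.map_sum, _root_.sum_apply]
  exact Finset.sum_congr rfl fun i _ => by rw [map_smul]; rfl

theorem alternatizeUncurryFin_sum {k : ℕ} {n : Type*} (s : Finset n)
    (A : n → V →L[ℝ] V [⋀^Fin k]→L[ℝ] ℝ) :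
    alternatizeUncurryFin (∑ i ∈ s, A i) = ∑ i ∈ s, alternatizeUncurryFin (A i) :=
  _root_.map_sum (alternatizeUncurryFinCLM ℝ V ℝ) A s

theorem alternatizeUncurryFin_eq_sum {k : ℕ} (A : V →L[ℝ] V [⋀^Fin k]→L[ℝ] ℝ) :
    alternatizeUncurryFin A = toForm (k + 1) (∑ i, ι ℝ (coord (Module.finBasis ℝ V) i) *
      lift (A (Module.finBasis ℝ V i))) := by
  conv_lhs => rw [eq_sum_smulRight A, alternatizeUncurryFin_sum]
  rw [_root_.map_sum]
  refine Finset.sum_congr rfl fun i _ => ?_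
  rw [← alternatizeUncurryFin_smulRight _ (lift_mem _), toForm_lift]

theorem ι_mul_mem {k : ℕ} (a : V →L[ℝ] ℝ) {x : Ext V} (hx : x ∈ ⋀[ℝ]^k (V →L[ℝ] ℝ)) :
    ι ℝ a * x ∈ ⋀[ℝ]^(k + 1) (V →L[ℝ] ℝ) := by
  rw [add_comm]; exact mul_mem_ext (ι_mem a) hx

theorem alternatizeUncurryFin_wedge_left {k l : ℕ} (A : V →L[ℝ] V [⋀^Fin k]→L[ℝ] ℝ) {x y : Ext V}
    (hx : x ∈ ⋀[ℝ]^(k + 1) (V →L[ℝ] ℝ)) (hy : y ∈ ⋀[ℝ]^l (V →L[ℝ] ℝ))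
    (h : toForm (k + 1) x = alternatizeUncurryFin A) :
    alternatizeUncurryFin (((wedgeCLM k l).flip (toForm l y)).comp A) =
      toForm (k + l + 1) (x * y) := by
  set b := Module.finBasis ℝ V
  have h1 : ((wedgeCLM k l).flip (toForm l y)).comp A =
      ∑ i, (coord b i).smulRight (toForm (k + l) (lift (A (b i)) * y)) := by
    refine (eq_sum_smulRight _).trans (Finset.sum_congr rfl fun i _ => ?_)
    rw [toForm_mul (lift_mem _) hy, toForm_lift]
    rfl
  rw [alternatizeUncurryFin_eq_sum] at h
  rw [h1, alternatizeUncurryFin_sum, toForm_mul_congr_left (by omega) hx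
    (Submodule.sum_mem _ fun i _ => ι_mul_mem _ (lift_mem _)) hy h, Finset.sum_mul, _root_.map_sum]
  refine Finset.sum_congr rfl fun i _ => ?_
  rw [alternatizeUncurryFin_smulRight _ (mul_mem_ext (lift_mem _) hy), mul_assoc]

/-- The sign arises from moving the covector of differentiation past `x`, of degree `k`. Together
with `alternatizeUncurryFin_wedge_left` this accounts for the two terms of the Leibniz rule. -/
theorem alternatizeUncurryFin_wedge_right {k l : ℕ} (B : V →L[ℝ] V [⋀^Fin l]→L[ℝ] ℝ) {x y : Ext V}
    (hx : x ∈ ⋀[ℝ]^k (V →L[ℝ] ℝ)) (hy : y ∈ ⋀[ℝ]^(l + 1) (V →L[ℝ] ℝ))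
    (h : toForm (l + 1) y = alternatizeUncurryFin B) :
    alternatizeUncurryFin ((wedgeCLM k l (toForm k x)).comp B) =
      (-1 : ℝ) ^ k • toForm (k + l + 1) (x * y) := by
  set b := Module.finBasis ℝ V
  have h1 : (wedgeCLM k l (toForm k x)).comp B =
      ∑ i, (coord b i).smulRight (toForm (k + l) (x * lift (B (b i)))) := by
    refine (eq_sum_smulRight _).trans (Finset.sum_congr rfl fun i _ => ?_)
    rw [toForm_mul hx (lift_mem _), toForm_lift]
    rfl
  rw [alternatizeUncurryFin_eq_sum] at h
  rw [h1, alternatizeUncurryFin_sum, toForm_mul_congr_right (by omega) hx hy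
    (Submodule.sum_mem _ fun i _ => ι_mul_mem _ (lift_mem _)) h, Finset.mul_sum, _root_.map_sum,
    Finset.smul_sum]
  refine Finset.sum_congr rfl fun i _ => ?_
  rw [alternatizeUncurryFin_smulRight _ (mul_mem_ext hx (lift_mem _)), ← mul_assoc, ι_mul_eq _ hx,
    smul_mul_assoc, mul_assoc, map_smul]

end Normed

end CalabiGray

namespace CalabiGray

/-! ### Differential forms in charts -/

section Charts

variable {E : Type*} [NormedAddCommGroup E] [NormedSpace ℝ E] {H : Type*} [TopologicalSpace H]
  (I : ModelWithCorners ℝ E H) {N : Type*} [TopologicalSpace N] [ChartedSpace H N]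
  {G : Type*} [NormedAddCommGroup G] [NormedSpace ℝ G]

/-- The coordinate change from the preferred chart at `x` to the one at `x'`. -/
def trans (x x' : N) : E → E := extChartAt I x' ∘ (extChartAt I x).symm

/-- The domain of `trans I x x'`. -/
def transDomain (x x' : N) : Set E :=
  (extChartAt I x).target ∩ (extChartAt I x).symm ⁻¹' (extChartAt I x').source

/-- The differential of the inverse of the preferred chart at `x`. -/
def chartJac (x : N) (z : E) : E →L[ℝ] E := fderiv ℝ (trans I x ((extChartAt I x).symm z)) z

variable [I.Boundaryless]

theorem isOpen_transDomain (x x' : N) : IsOpen (transDomain I x x') :=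
  (continuousOn_extChartAt_symm x).isOpen_inter_preimage (isOpen_extChartAt_target x)
    (isOpen_extChartAt_source x')

theorem mem_transDomain_self {x : N} {z : E} (hz : z ∈ (extChartAt I x).target) :
    z ∈ transDomain I x ((extChartAt I x).symm z) := ⟨hz, mem_extChartAt_source _⟩

variable [IsManifold I ∞ N]

theorem contDiffOn_trans (x x' : N) : ContDiffOn ℝ ∞ (trans I x x') (transDomain I x x') := by
  have := contDiffOn_ext_coord_change (I := I) (n := ∞) x' x
  exact this.mono fun z hz => by simpa [transDomain] using hz

theorem contDiffAt_trans {x x' : N} {z : E} (hz : z ∈ transDomain I x x') :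
    ContDiffAt ℝ ∞ (trans I x x') z :=
  (contDiffOn_trans I x x').contDiffAt ((isOpen_transDomain I x x').mem_nhds hz)

theorem differentiableAt_trans {x x' : N} {z : E} (hz : z ∈ transDomain I x x') :
    DifferentiableAt ℝ (trans I x x') z :=
  (contDiffAt_trans I hz).differentiableAt (by simp)

omit [I.Boundaryless] [IsManifold I ∞ N] in
theorem trans_mem_target {x x' : N} {z : E} (hz : z ∈ transDomain I x x') :
    trans I x x' z ∈ (extChartAt I x').target := (extChartAt I x').map_source hz.2

omit [I.Boundaryless] [IsManifold I ∞ N] in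
theorem symm_trans {x x' : N} {z : E} (hz : z ∈ transDomain I x x') :
    (extChartAt I x').symm (trans I x x' z) = (extChartAt I x).symm z :=
  (extChartAt I x').left_inv hz.2

omit [I.Boundaryless] [IsManifold I ∞ N] in
theorem trans_trans_apply {x x' x'' : N} {z : E} (hz : z ∈ transDomain I x x') :
    trans I x' x'' (trans I x x' z) = trans I x x'' z := by
  rw [trans, Function.comp_apply, symm_trans I hz]; rfl

theorem fderiv_trans_comp {x x' x'' : N} {z : E} (hz : z ∈ transDomain I x x')
    (hz' : z ∈ transDomain I x x'') :
    fderiv ℝ (trans I x x'') z =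
      (fderiv ℝ (trans I x' x'') (trans I x x' z)).comp (fderiv ℝ (trans I x x') z) := by
  have h1 : trans I x x'' =ᶠ[nhds z] trans I x' x'' ∘ trans I x x' := by
    filter_upwards [(isOpen_transDomain I x x').mem_nhds hz] with w hw
    exact (trans_trans_apply I hw).symm
  rw [h1.fderiv_eq, fderiv_comp z (differentiableAt_trans I ?_) (differentiableAt_trans I hz)]
  refine ⟨trans_mem_target I hz, ?_⟩
  rw [mem_preimage, symm_trans I hz]
  exact hz'.2

omit [IsManifold I ∞ N] in
theorem fderiv_trans_self {x : N} {z : E} (hz : z ∈ (extChartAt I x).target) :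
    fderiv ℝ (trans I x x) z = ContinuousLinearMap.id ℝ E := by
  have h1 : trans I x x =ᶠ[nhds z] id := by
    filter_upwards [(isOpen_extChartAt_target x).mem_nhds hz] with w hw
    exact (extChartAt I x).right_inv hw
  rw [h1.fderiv_eq, fderiv_id]

theorem chartJac_trans {x x' : N} {z : E} (hz : z ∈ transDomain I x x') :
    chartJac I x z = (chartJac I x' (trans I x x' z)).comp (fderiv ℝ (trans I x x') z) := by
  rw [chartJac, chartJac, symm_trans I hz]
  exact fderiv_trans_comp I hz (mem_transDomain_self I hz.1)

theorem fderiv_trans_comp_symm {x x' : N} {z : E} (hz : z ∈ transDomain I x x') :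
    (fderiv ℝ (trans I x' x) (trans I x x' z)).comp (fderiv ℝ (trans I x x') z) =
      ContinuousLinearMap.id ℝ E := by
  have hzx : z ∈ transDomain I x x := ⟨hz.1, (extChartAt I x).map_target hz.1⟩
  rw [← fderiv_trans_comp I hz hzx, fderiv_trans_self I hz.1]

omit [I.Boundaryless] [IsManifold I ∞ N] in
theorem trans_mem_transDomain {x x' : N} {z : E} (hz : z ∈ transDomain I x x') :
    trans I x x' z ∈ transDomain I x' x :=
  ⟨trans_mem_target I hz, by rw [mem_preimage, symm_trans I hz]; exact (extChartAt I x).map_target hz.1⟩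

omit [I.Boundaryless] [IsManifold I ∞ N] in
theorem trans_trans_self {x x' : N} {z : E} (hz : z ∈ transDomain I x x') :
    trans I x' x (trans I x x' z) = z := by
  rw [trans_trans_apply I hz]; exact (extChartAt I x).right_inv hz.1

theorem fderiv_trans_comp_symm' {x x' : N} {z : E} (hz : z ∈ transDomain I x x') :
    (fderiv ℝ (trans I x x') z).comp (fderiv ℝ (trans I x' x) (trans I x x' z)) =
      ContinuousLinearMap.id ℝ E := by
  have := fderiv_trans_comp_symm I (trans_mem_transDomain I hz)
  rwa [trans_trans_self I hz] at this

/-- The inverse of `chartJac`. -/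
def chartJacInv (x : N) (z : E) : E →L[ℝ] E :=
  fderiv ℝ (trans I ((extChartAt I x).symm z) x) (trans I x ((extChartAt I x).symm z) z)

theorem chartJacInv_comp {x : N} {z : E} (hz : z ∈ (extChartAt I x).target) :
    (chartJacInv I x z).comp (chartJac I x z) = ContinuousLinearMap.id ℝ E :=
  fderiv_trans_comp_symm I (mem_transDomain_self I hz)

theorem chartJac_comp {x : N} {z : E} (hz : z ∈ (extChartAt I x).target) :
    (chartJac I x z).comp (chartJacInv I x z) = ContinuousLinearMap.id ℝ E :=
  fderiv_trans_comp_symm' I (mem_transDomain_self I hz)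

/-- A tangent vector at `y` is written in the preferred chart at `y`. The derivative of the inverse
chart at `x` is therefore that of a coordinate change whose target chart moves with `z`, which
explains the form of `chartJac`. -/
theorem mfderivWithin_symm_eq {x : N} {z : E} (hz : z ∈ (extChartAt I x).target) :
    mfderivWithin 𝓘(ℝ, E) I (extChartAt I x).symm (range I) z = chartJac I x z := by
  have : IsManifold I 1 N := IsManifold.of_le (n := ∞) (by simp)
  have h := mdifferentiableWithinAt_extChartAt_symm (I := I) hz
  refine h.mfderivWithin.trans ?_
  have h2 : (extChartAt 𝓘(ℝ, E) z).symm ⁻¹' range I ∩ range 𝓘(ℝ, E) = univ := by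
    simp [I.range_eq_univ]
  rw [h2, fderivWithin_univ]
  rfl

omit [I.Boundaryless] [IsManifold I ∞ N] in
/-- The value of a form at a point, as a form on the model space. -/
def modelForm {k : ℕ} (α : DForm I N G k) (x : N) : E [⋀^Fin k]→L[ℝ] G := α x

theorem chartRep_eq {k : ℕ} (α : DForm I N G k) {x : N} {z : E}
    (hz : z ∈ (extChartAt I x).target) :
    chartRep I α x z = (modelForm I α ((extChartAt I x).symm z)).compContinuousLinearMap
      (chartJac I x z) := by
  rw [chartRep, mfderivWithin_symm_eq I hz]; rfl

theorem chartJac_center (x : N) : chartJac I x (extChartAt I x x) = ContinuousLinearMap.id ℝ E := by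
  rw [chartJac, extChartAt_to_inv, fderiv_trans_self I (mem_extChartAt_target x)]

theorem chartRep_center {k : ℕ} (α : DForm I N G k) (x : N) :
    chartRep I α x (extChartAt I x x) = α x := by
  rw [chartRep_eq I α (mem_extChartAt_target x), chartJac_center]
  have : ∀ (β : N → E [⋀^Fin k]→L[ℝ] G) (y : N), y = x →
      (β y).compContinuousLinearMap (ContinuousLinearMap.id ℝ E) = β x := by
    rintro β y rfl; rfl
  exact this (modelForm I α) _ (extChartAt_to_inv x)

theorem d_eq {k : ℕ} (α : DForm I N G k) (x : N) :
    d I α x = extDeriv (chartRep I α x) (extChartAt I x x) := by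
  have : IsManifold I 1 N := IsManifold.of_le (n := ∞) (by simp)
  rw [d, mfderiv_extChartAt_self, I.range_eq_univ, extDerivWithin_univ]
  rfl

theorem chartRep_trans {k : ℕ} (α : DForm I N G k) {x x' : N} {z : E}
    (hz : z ∈ transDomain I x x') :
    chartRep I α x z = (chartRep I α x' (trans I x x' z)).compContinuousLinearMap
      (fderiv ℝ (trans I x x') z) := by
  rw [chartRep_eq I α hz.1, chartRep_eq I α (trans_mem_target I hz), chartJac_trans I hz,
    symm_trans I hz]
  rfl

theorem d_congr_chartRep {k : ℕ} {α β : DForm I N G k} {x : N}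
    (h : chartRep I α x =ᶠ[nhds (extChartAt I x x)] chartRep I β x) : d I α x = d I β x := by
  rw [d_eq, d_eq, h.extDeriv_eq]

/-- Smooth differential forms. -/
def IsSmoothForm {k : ℕ} (α : DForm I N G k) : Prop :=
  ∀ x, ContDiffOn ℝ ∞ (chartRep I α x) (extChartAt I x).target

variable {I}

theorem IsSmoothForm.contDiffAt {k : ℕ} {α : DForm I N G k} (hα : IsSmoothForm I α) {x : N} {z : E}
    (hz : z ∈ (extChartAt I x).target) : ContDiffAt ℝ ∞ (chartRep I α x) z :=
  (hα x).contDiffAt ((isOpen_extChartAt_target x).mem_nhds hz)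

theorem IsSmoothForm.differentiableAt {k : ℕ} {α : DForm I N G k} (hα : IsSmoothForm I α) {x : N}
    {z : E} (hz : z ∈ (extChartAt I x).target) : DifferentiableAt ℝ (chartRep I α x) z :=
  (hα.contDiffAt hz).differentiableAt (by simp)

/-- Chart independence of `d`: at the point `y` with coordinate `z` the derivative is computed in
the chart at `y`, and naturality of `extDeriv` under the coordinate change brings it back to the
chart at `x`. -/
theorem IsSmoothForm.chartRep_d {k : ℕ} {α : DForm I N G k} (hα : IsSmoothForm I α) {x : N} {z : E}
    (hz : z ∈ (extChartAt I x).target) :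
    chartRep I (d I α) x z = extDeriv (chartRep I α x) z := by
  set y := (extChartAt I x).symm z with hy
  have hzy : z ∈ transDomain I x y := mem_transDomain_self I hz
  have h1 : chartRep I α x =ᶠ[nhds z] fun w => (chartRep I α y (trans I x y w)).compContinuousLinearMap
      (fderiv ℝ (trans I x y) w) := by
    filter_upwards [(isOpen_transDomain I x y).mem_nhds hzy] with w hw
    exact chartRep_trans I α hw
  rw [h1.extDeriv_eq, extDeriv_pullback (r := ∞)
    (hα.differentiableAt (trans_mem_target I hzy)) (contDiffAt_trans I hzy) (by simpa using WithTop.coe_le_coe.2 (le_top : (2 : ℕ∞) ≤ ⊤)),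
    chartRep_eq I _ hz]
  have h2 : d I α y = extDeriv (chartRep I α y) (trans I x y z) := d_eq I α y
  rw [← h2]
  rfl

set_option synthInstance.maxHeartbeats 200000 in
theorem IsSmoothForm.d {k : ℕ} {α : DForm I N G k} (hα : IsSmoothForm I α) :
    IsSmoothForm I (d I α) := by
  intro x
  have h : ContDiffOn ℝ ∞ (extDeriv (chartRep I α x)) (extChartAt I x).target := by
    have h1 := (hα x).fderiv_of_isOpen (m := ∞) (isOpen_extChartAt_target x) (by simp)
    exact (ContinuousAlternatingMap.alternatizeUncurryFinCLM ℝ E G (n := k)).contDiff.comp_contDiffOn h1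
  exact h.congr fun z hz => hα.chartRep_d hz

theorem IsSmoothForm.d_d {k : ℕ} {α : DForm I N G k} (hα : IsSmoothForm I α) :
    CalabiGray.d I (CalabiGray.d I α) = 0 := by
  funext x
  have h1 : chartRep I (CalabiGray.d I α) x =ᶠ[nhds (extChartAt I x x)] extDeriv (chartRep I α x) := by
    filter_upwards [(isOpen_extChartAt_target x).mem_nhds (mem_extChartAt_target x)] with w hw
    exact hα.chartRep_d hw
  rw [d_eq, h1.extDeriv_eq, extDeriv_extDeriv_apply (hα.contDiffAt (mem_extChartAt_target x))
    (by simpa using WithTop.coe_le_coe.2 (le_top : (2 : ℕ∞) ≤ ⊤))]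
  rfl

theorem chartRep_add {k : ℕ} (α β : DForm I N G k) {x : N} {z : E}
    (hz : z ∈ (extChartAt I x).target) :
    chartRep I (fun y => α y + β y) x z = chartRep I α x z + chartRep I β x z := by
  rw [chartRep_eq I _ hz, chartRep_eq I _ hz, chartRep_eq I _ hz]; rfl

theorem chartRep_smul {k : ℕ} (f : N → ℝ) (α : DForm I N G k) {x : N} {z : E}
    (hz : z ∈ (extChartAt I x).target) :
    chartRep I (fun y => f y • α y) x z = f ((extChartAt I x).symm z) • chartRep I α x z := by
  rw [chartRep_eq I _ hz, chartRep_eq I _ hz]; rfl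

theorem chartRep_wedge {k l : ℕ} (α : DForm I N ℝ k) (β : DForm I N ℝ l) {x : N} {z : E}
    (hz : z ∈ (extChartAt I x).target) :
    chartRep I (fun y => wedge (α y) (β y)) x z = wedge (chartRep I α x z) (chartRep I β x z) := by
  rw [chartRep_eq I _ hz, chartRep_eq I _ hz, chartRep_eq I _ hz]
  exact wedge_compContinuousLinearMap (V := E) (W := E) _ _ _

end Charts

end CalabiGray

namespace CalabiGray

/-! ### Operations on smooth forms and the Leibniz rule -/

section Leibniz

open ExteriorAlgebra ContinuousAlternatingMap

variable {E : Type*} [NormedAddCommGroup E] [NormedSpace ℝ E] {H : Type*} [TopologicalSpace H]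
  {I : ModelWithCorners ℝ E H} {N : Type*} [TopologicalSpace N] [ChartedSpace H N]
  {G : Type*} [NormedAddCommGroup G] [NormedSpace ℝ G] [I.Boundaryless] [IsManifold I ∞ N]

theorem contDiffOn_comp_symm {f : N → G} (hf : ContMDiff I 𝓘(ℝ, G) ∞ f) (x : N) :
    ContDiffOn ℝ ∞ (fun z => f ((extChartAt I x).symm z)) (extChartAt I x).target := by
  rw [← contMDiffOn_iff_contDiffOn]
  exact hf.comp_contMDiffOn (contMDiffOn_extChartAt_symm x)

theorem IsSmoothForm.add {k : ℕ} {α β : DForm I N G k} (hα : IsSmoothForm I α)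
    (hβ : IsSmoothForm I β) : IsSmoothForm I (fun y => α y + β y) := fun x =>
  ((hα x).add (hβ x)).congr fun _ hz => chartRep_add α β hz

theorem IsSmoothForm.smul {k : ℕ} {α : DForm I N G k} (hα : IsSmoothForm I α) {f : N → ℝ}
    (hf : ContMDiff I 𝓘(ℝ, ℝ) ∞ f) : IsSmoothForm I (fun y => f y • α y) := fun x =>
  ((contDiffOn_comp_symm hf x).smul (hα x)).congr fun _ hz => chartRep_smul f α hz

theorem isSmoothForm_zero {k : ℕ} : IsSmoothForm I (0 : DForm I N G k) := by
  intro x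
  refine (contDiffOn_const (c := (0 : E [⋀^Fin k]→L[ℝ] G))).congr fun z hz => ?_
  rw [chartRep_eq I _ hz]; rfl

theorem IsSmoothForm.sum {k : ℕ} {n : Type*} (s : Finset n) {α : n → DForm I N G k}
    (hα : ∀ i, IsSmoothForm I (α i)) : IsSmoothForm I (fun y => ∑ i ∈ s, α i y) := by
  classical
  induction s using Finset.induction_on with
  | empty => simp only [Finset.sum_empty]; exact isSmoothForm_zero
  | insert i s hi ih => simp only [Finset.sum_insert hi]; exact (hα i).add ih

theorem d_zero {k : ℕ} : d I (0 : DForm I N G k) = 0 := by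
  funext x
  have h : chartRep I (0 : DForm I N G k) x =ᶠ[nhds (extChartAt I x x)] fun _ => 0 := by
    filter_upwards [(isOpen_extChartAt_target x).mem_nhds (mem_extChartAt_target x)] with w hw
    rw [chartRep_eq I _ hw]; rfl
  rw [d_eq, h.extDeriv_eq, extDeriv, fderiv_const_apply]
  change alternatizeUncurryFin 0 = (0 : E [⋀^Fin (k + 1)]→L[ℝ] G)
  ext v
  rw [alternatizeUncurryFin_apply]
  simp

theorem d_add {k : ℕ} {α β : DForm I N G k} (hα : IsSmoothForm I α) (hβ : IsSmoothForm I β)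
    (x : N) : d I (fun y => α y + β y) x = d I α x + d I β x := by
  have h : chartRep I (fun y => α y + β y) x =ᶠ[nhds (extChartAt I x x)]
      fun z => chartRep I α x z + chartRep I β x z := by
    filter_upwards [(isOpen_extChartAt_target x).mem_nhds (mem_extChartAt_target x)] with w hw
    exact chartRep_add α β hw
  rw [d_eq, h.extDeriv_eq, d_eq, d_eq]
  exact extDeriv_fun_add (hα.differentiableAt (mem_extChartAt_target x))
    (hβ.differentiableAt (mem_extChartAt_target x))

theorem d_sum {k : ℕ} {n : Type*} (s : Finset n) {α : n → DForm I N G k}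
    (hα : ∀ i, IsSmoothForm I (α i)) (x : N) :
    d I (fun y => ∑ i ∈ s, α i y) x = ∑ i ∈ s, d I (α i) x := by
  classical
  induction s using Finset.induction_on with
  | empty => simp only [Finset.sum_empty]; exact congrFun (d_zero (I := I) (N := N)) x
  | insert i s hi ih =>
    simp only [Finset.sum_insert hi]
    rw [d_add (hα i) (IsSmoothForm.sum s hα), ih]

theorem mfderiv_fun_eq {f : N → G} (hf : ContMDiff I 𝓘(ℝ, G) ∞ f) (x : N) :
    mfderiv I 𝓘(ℝ, G) f x =
      fderiv ℝ (fun z => f ((extChartAt I x).symm z)) (extChartAt I x x) := by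
  have h := (hf.mdifferentiable (by simp)) x
  refine h.mfderiv.trans ?_
  rw [I.range_eq_univ, fderivWithin_univ]
  rfl

variable (I) in
omit [I.Boundaryless] [IsManifold I ∞ N] in
/-- The differential of a function, as a covector on the model space. -/
def dFun (f : N → ℝ) (x : N) : E →L[ℝ] ℝ := mfderiv I 𝓘(ℝ, ℝ) f x

variable [FiniteDimensional ℝ E]

set_option synthInstance.maxHeartbeats 200000 in
theorem IsSmoothForm.wedge {k l : ℕ} {α : DForm I N ℝ k} {β : DForm I N ℝ l}
    (hα : IsSmoothForm I α) (hβ : IsSmoothForm I β) :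
    IsSmoothForm I (fun y => wedge (α y) (β y)) := by
  intro x
  have hw : ContDiff ℝ ∞ (wedgeCLM (V := E) k l) := ContinuousLinearMap.contDiff _
  have h0 : ContDiffOn ℝ ∞ (fun z => wedgeCLM (V := E) k l (chartRep I α x z))
      (extChartAt I x).target := hw.comp_contDiffOn (hα x)
  have h : ContDiffOn ℝ ∞ (fun z => wedgeCLM k l (chartRep I α x z) (chartRep I β x z))
      (extChartAt I x).target := h0.clm_apply (hβ x)
  exact h.congr fun z hz => chartRep_wedge α β hz

theorem isSmoothForm_wedgePow {α : DForm I N ℝ 2} (hα : IsSmoothForm I α) (k : ℕ) :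
    IsSmoothForm I (fun y => wedgePow (α y) k) := by
  induction k with
  | zero =>
    intro x
    refine (contDiffOn_const (c := constOfIsEmpty ℝ E (Fin 0) (1 : ℝ))).congr fun z hz => ?_
    rw [chartRep_eq I _ hz]; rfl
  | succ k ih => exact ih.wedge hα

/-- The Leibniz rule. -/
theorem d_wedge {k l : ℕ} {α : DForm I N ℝ k} {β : DForm I N ℝ l} (hα : IsSmoothForm I α)
    (hβ : IsSmoothForm I β) (x : N) {a a' b b' : Ext E} (ha : a ∈ ⋀[ℝ]^k (E →L[ℝ] ℝ))
    (ha' : a' ∈ ⋀[ℝ]^(k + 1) (E →L[ℝ] ℝ)) (hb : b ∈ ⋀[ℝ]^l (E →L[ℝ] ℝ))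
    (hb' : b' ∈ ⋀[ℝ]^(l + 1) (E →L[ℝ] ℝ)) (ea : toForm k a = modelForm I α x)
    (ea' : toForm (k + 1) a' = modelForm I (d I α) x) (eb : toForm l b = modelForm I β x)
    (eb' : toForm (l + 1) b' = modelForm I (d I β) x) :
    modelForm I (d I (fun y => wedge (α y) (β y))) x =
      toForm (k + l + 1) (a' * b + (-1 : ℝ) ^ k • (a * b')) := by
  have hx := mem_extChartAt_target (I := I) x
  have h : chartRep I (fun y => CalabiGray.wedge (α y) (β y)) x =ᶠ[nhds (extChartAt I x x)]
      fun z => wedgeCLM k l (chartRep I α x z) (chartRep I β x z) := by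
    filter_upwards [(isOpen_extChartAt_target x).mem_nhds hx] with w hw
    exact chartRep_wedge α β hw
  have h2 := (wedgeCLM (V := E) k l).hasFDerivAt_of_bilinear
    (hα.differentiableAt hx).hasFDerivAt (hβ.differentiableAt hx).hasFDerivAt
  have e1 : modelForm I α x = chartRep I α x (extChartAt I x x) := (chartRep_center I α x).symm
  have e2 : modelForm I β x = chartRep I β x (extChartAt I x x) := (chartRep_center I β x).symm
  have e3 : modelForm I (d I α) x = extDeriv (chartRep I α x) (extChartAt I x x) := d_eq I α x
  have e4 : modelForm I (d I β) x = extDeriv (chartRep I β x) (extChartAt I x x) := d_eq I β x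
  have e5 : modelForm I (d I (fun y => CalabiGray.wedge (α y) (β y))) x =
    extDeriv (chartRep I (fun y => CalabiGray.wedge (α y) (β y)) x) (extChartAt I x x) := d_eq I _ x
  rw [e1] at ea
  rw [e2] at eb
  rw [e3] at ea'
  rw [e4] at eb'
  rw [e5, h.extDeriv_eq, extDeriv, h2.fderiv, map_add, map_smul,
    ← alternatizeUncurryFin_wedge_left _ ha' hb ea',
    ← alternatizeUncurryFin_wedge_right _ ha hb' eb', ← alternatizeUncurryFin_add, ea, eb]
  exact congrArg alternatizeUncurryFin (add_comm _ _)

theorem d_fun_smul {k : ℕ} {α : DForm I N ℝ k} (hα : IsSmoothForm I α) {f : N → ℝ}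
    (hf : ContMDiff I 𝓘(ℝ, ℝ) ∞ f) (x : N) {a : Ext E} (ha : a ∈ ⋀[ℝ]^k (E →L[ℝ] ℝ))
    (ea : toForm k a = modelForm I α x) :
    modelForm I (d I (fun y => f y • α y)) x =
      toForm (k + 1) (ι ℝ (dFun I f x) * a) +
        f x • modelForm I (d I α) x := by
  have hx := mem_extChartAt_target (I := I) x
  have h : chartRep I (fun y => f y • α y) x =ᶠ[nhds (extChartAt I x x)]
      fun z => f ((extChartAt I x).symm z) • chartRep I α x z := by
    filter_upwards [(isOpen_extChartAt_target x).mem_nhds hx] with w hw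
    exact chartRep_smul f α hw
  have hf' : DifferentiableAt ℝ (fun z => f ((extChartAt I x).symm z)) (extChartAt I x x) :=
    ((contDiffOn_comp_symm hf x).contDiffAt ((isOpen_extChartAt_target x).mem_nhds hx)
      ).differentiableAt (by simp)
  have h2 := hf'.hasFDerivAt.smul (hα.differentiableAt hx).hasFDerivAt
  have e1 : modelForm I α x = chartRep I α x (extChartAt I x x) := (chartRep_center I α x).symm
  have e3 : modelForm I (d I α) x = extDeriv (chartRep I α x) (extChartAt I x x) := d_eq I α x
  have e5 : modelForm I (d I (fun y => f y • α y)) x =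
    extDeriv (chartRep I (fun y => f y • α y) x) (extChartAt I x x) := d_eq I _ x
  rw [e5, h.extDeriv_eq, extDeriv]
  refine (congrArg alternatizeUncurryFin h2.fderiv).trans ?_
  rw [← alternatizeUncurryFin_smulRight _ ha, ea, e1, e3, dFun, mfderiv_fun_eq hf,
    alternatizeUncurryFin_add, alternatizeUncurryFin_smul, extChartAt_to_inv]
  exact add_comm _ _

end Leibniz

end CalabiGray

namespace CalabiGray

/-! ### Stokes' theorem on a compact oriented manifold -/

section Stokes

open MeasureTheory ContinuousAlternatingMap

variable {E : Type*} [NormedAddCommGroup E] [NormedSpace ℝ E]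

theorem apply_basis_comp {n : ℕ} (b : Module.Basis (Fin n) ℝ E) (α : E [⋀^Fin n]→L[ℝ] ℝ)
    (A : E →L[ℝ] E) : α.compContinuousLinearMap A b = A.det * α b := by
  have h := congrArg (fun β : E [⋀^Fin n]→ₗ[ℝ] ℝ => β (A ∘ b))
    (AlternatingMap.eq_smul_basis_det b α.toAlternatingMap)
  simp only [AlternatingMap.smul_apply, smul_eq_mul] at h
  have h2 := b.det_comp (A : E →ₗ[ℝ] E) b
  rw [b.det_self, mul_one] at h2
  refine Eq.trans h ?_
  rw [mul_comm]
  exact congrArg (· * α b) h2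

theorem apply_basis_eq_zero_iff {n : ℕ} (b : Module.Basis (Fin n) ℝ E) (α : E [⋀^Fin n]→L[ℝ] ℝ) :
    α b = 0 ↔ α = 0 := by
  refine (AlternatingMap.map_basis_eq_zero_iff b α.toAlternatingMap).trans ⟨fun h => ?_, ?_⟩
  · ext v; exact congrArg (fun β : E [⋀^Fin n]→ₗ[ℝ] ℝ => β v) h
  · rintro rfl; rfl

variable [FiniteDimensional ℝ E]

/-- Integration by parts against the constant function `1`. -/
theorem integral_fderiv_eq_zero [MeasurableSpace E] [BorelSpace E] (μ : Measure E)
    [μ.IsAddHaarMeasure] {f : E → ℝ} (hf : ContDiff ℝ ∞ f) (hc : HasCompactSupport f) (v : E) :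
    ∫ z, fderiv ℝ f z v ∂μ = 0 := by
  have h1 : Continuous fun z => fderiv ℝ f z v :=
    (hf.continuous_fderiv (by simp)).clm_apply continuous_const
  have h2 : HasCompactSupport fun z => fderiv ℝ f z v := hc.fderiv_apply (𝕜 := ℝ) v
  have := integral_mul_fderiv_eq_neg_fderiv_mul_of_integrable (μ := μ) (f := fun _ : E => (1 : ℝ))
    (g := f) (v := v) (by simp) (by simpa using h1.integrable_of_hasCompactSupport h2)
    (by simpa using hf.continuous.integrable_of_hasCompactSupport hc)
    (fun _ _ => differentiableAt_const _) (fun z _ => hf.differentiable (by simp) z)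
  simpa using this

theorem integral_extDeriv_eq_zero [MeasurableSpace E] [BorelSpace E] (μ : Measure E)
    [μ.IsAddHaarMeasure] {n : ℕ} {η : E → E [⋀^Fin n]→L[ℝ] ℝ} (hη : ContDiff ℝ ∞ η)
    (hc : HasCompactSupport η) (v : Fin (n + 1) → E) : ∫ z, extDeriv η z v ∂μ = 0 := by
  have h0 : ∀ w : Fin n → E, ContDiff ℝ ∞ fun z => η z w := fun w =>
    (ContinuousAlternatingMap.apply ℝ E ℝ w).contDiff.comp hη
  have hc0 : ∀ w : Fin n → E, HasCompactSupport fun z => η z w := fun w =>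
    hc.comp_left (g := fun α : E [⋀^Fin n]→L[ℝ] ℝ => α w) rfl
  have h1 : ∀ z, extDeriv η z v =
      ∑ i, (-1 : ℝ) ^ i.val * fderiv ℝ (fun z => η z (i.removeNth v)) z (v i) := fun z => by
    rw [extDeriv_apply (hη.differentiable (by simp) z) v]
    simp [zsmul_eq_mul]
  simp only [h1]
  rw [integral_finsetSum]
  · refine Finset.sum_eq_zero fun i _ => ?_
    rw [integral_const_mul, integral_fderiv_eq_zero μ (h0 _) (hc0 _), mul_zero]
  · intro i _
    refine Integrable.const_mul ?_ _
    exact (((h0 _).continuous_fderiv (by simp)).clm_apply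
      continuous_const).integrable_of_hasCompactSupport ((hc0 _).fderiv_apply (𝕜 := ℝ) _)

variable {H : Type*} [TopologicalSpace H] {I : ModelWithCorners ℝ E H} {N : Type*}
  [TopologicalSpace N] [ChartedSpace H N]

/-- The form `α` in the chart at `x`, with the sign of the orientation given by the top form `V`,
extended by zero. -/
def signedRep {n k : ℕ} (V : DForm I N ℝ n) (b : Fin n → E) (α : DForm I N ℝ k) (x : N) :
    E → E [⋀^Fin k]→L[ℝ] ℝ :=
  (extChartAt I x).target.indicator
    fun z => (SignType.sign (chartRep I V x z b) : ℝ) • chartRep I α x z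

variable [I.Boundaryless] [IsManifold I ∞ N]

theorem chartRep_basis_ne_zero {n : ℕ} {V : DForm I N ℝ n} (hV : ∀ x, modelForm I V x ≠ 0)
    (b : Module.Basis (Fin n) ℝ E) {x : N} {z : E} (hz : z ∈ (extChartAt I x).target) :
    chartRep I V x z b ≠ 0 := by
  rw [chartRep_eq I V hz, apply_basis_comp]
  refine mul_ne_zero ?_ ((apply_basis_eq_zero_iff b _).not.2 (hV _))
  intro h
  have h2 := congrArg ContinuousLinearMap.det (chartJacInv_comp I hz)
  have h3 : (chartJacInv I x z).det * (chartJac I x z).det = 1 := by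
    refine Eq.trans (LinearMap.det_comp _ _).symm (h2.trans ?_)
    exact LinearMap.det_id
  rw [h, mul_zero] at h3
  exact zero_ne_one h3

/-- Since `V` has no zeros, its sign in a chart is locally constant. Near a point of the chart the
signed form is thus a constant multiple of the chart form, so the sign affects neither smoothness
nor differentiation. -/
theorem signedRep_eventuallyEq {n k : ℕ} {V : DForm I N ℝ n} (hVs : IsSmoothForm I V)
    (hV : ∀ x, modelForm I V x ≠ 0) (b : Module.Basis (Fin n) ℝ E) (α : DForm I N ℝ k) {x : N}
    {z₀ : E} (hz : z₀ ∈ (extChartAt I x).target) :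
    signedRep V b α x =ᶠ[nhds z₀]
      fun z => (SignType.sign (chartRep I V x z₀ b) : ℝ) • chartRep I α x z := by
  have hc : ContinuousAt (fun z => chartRep I V x z b) z₀ :=
    ((ContinuousAlternatingMap.apply ℝ E ℝ (b : Fin n → E)).continuous.continuousAt).comp
      (hVs.contDiffAt hz).continuousAt
  have h1 : ∀ᶠ z in nhds z₀, SignType.sign (chartRep I V x z b) =
      SignType.sign (chartRep I V x z₀ b) := by
    rcases lt_or_gt_of_ne (chartRep_basis_ne_zero hV b hz) with h | h
    · filter_upwards [hc.eventually_lt_const h] with z hz'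
      rw [sign_neg hz', sign_neg h]
    · filter_upwards [hc.eventually_const_lt h] with z hz'
      rw [sign_pos hz', sign_pos h]
  filter_upwards [h1, (isOpen_extChartAt_target x).mem_nhds hz] with z h2 h3
  rw [signedRep, indicator_of_mem h3, h2]

theorem chartRep_eq_zero {k : ℕ} {α : DForm I N ℝ k} {x : N} {z : E}
    (hz : z ∈ (extChartAt I x).target) (h : modelForm I α ((extChartAt I x).symm z) = 0) :
    chartRep I α x z = 0 := by
  rw [chartRep_eq I α hz, h]; rfl

variable [CompactSpace N]

omit [FiniteDimensional ℝ E] [I.Boundaryless] [IsManifold I ∞ N] in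
theorem isCompact_image_chart {K : Set N} (hK : IsClosed K) {x : N}
    (hx : K ⊆ (extChartAt I x).source) : IsCompact (extChartAt I x '' K) :=
  hK.isCompact.image_of_continuousOn ((continuousOn_extChartAt x).mono hx)

theorem signedRep_eq_zero {n k : ℕ} {V : DForm I N ℝ n} (b : Fin n → E)
    {α : DForm I N ℝ k} {K : Set N} {x : N} (h0 : ∀ y ∉ K, modelForm I α y = 0) {z : E}
    (hz : z ∉ extChartAt I x '' K) : signedRep V b α x z = 0 := by
  by_cases ht : z ∈ (extChartAt I x).target
  · rw [signedRep, indicator_of_mem ht, chartRep_eq_zero (α := α) ht, smul_zero]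
    refine h0 _ fun hy => hz ⟨_, hy, (extChartAt I x).right_inv ht⟩
  · rw [signedRep, indicator_of_notMem ht]

theorem contDiff_signedRep [T2Space N] {n k : ℕ} {V : DForm I N ℝ n} (hVs : IsSmoothForm I V)
    (hV : ∀ x, modelForm I V x ≠ 0) (b : Module.Basis (Fin n) ℝ E) {α : DForm I N ℝ k}
    (hα : IsSmoothForm I α) {K : Set N} (hK : IsClosed K) {x : N}
    (hx : K ⊆ (extChartAt I x).source) (h0 : ∀ y ∉ K, modelForm I α y = 0) :
    ContDiff ℝ ∞ (signedRep V b α x) ∧ HasCompactSupport (signedRep V b α x) := by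
  have hKc := isCompact_image_chart hK hx
  refine ⟨contDiff_iff_contDiffAt.2 fun z => ?_, ?_⟩
  · by_cases hz : z ∈ extChartAt I x '' K
    · have ht : z ∈ (extChartAt I x).target := by
        obtain ⟨y, hy, rfl⟩ := hz
        exact (extChartAt I x).map_source (hx hy)
      exact ((hα.contDiffAt ht).const_smul _).congr_of_eventuallyEq
        (signedRep_eventuallyEq hVs hV b α ht)
    · refine contDiffAt_const (c := (0 : E [⋀^Fin k]→L[ℝ] ℝ)) |>.congr_of_eventuallyEq ?_
      filter_upwards [hKc.isClosed.isOpen_compl.mem_nhds hz] with w hw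
      exact signedRep_eq_zero b h0 hw
  · exact HasCompactSupport.intro hKc fun z hz => signedRep_eq_zero b h0 hz

/-- The integral of a top form in the chart at `x`, for the orientation given by `V`. -/
def chartIntegral [MeasurableSpace E] (μ : Measure E) {n : ℕ} (V : DForm I N ℝ n)
    (b : Fin n → E) (α : DForm I N ℝ n) (x : N) : ℝ := ∫ z, signedRep V b α x z b ∂μ

theorem chartIntegral_eq [MeasurableSpace E] [BorelSpace E] (μ : Measure E)
    [μ.IsAddHaarMeasure] {n : ℕ} (V : DForm I N ℝ n) (b : Module.Basis (Fin n) ℝ E)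
    {α : DForm I N ℝ n} {x x' : N}
    (h0 : ∀ y, y ∉ (extChartAt I x).source ∩ (extChartAt I x').source → modelForm I α y = 0) :
    chartIntegral μ V b α x = ∫ z in transDomain I x x',
      (SignType.sign (chartRep I V x z b) : ℝ) * chartRep I α x z b ∂μ := by
  rw [chartIntegral, ← integral_indicator (isOpen_transDomain I x x').measurableSet]
  congr 1
  ext z
  by_cases hz : z ∈ transDomain I x x'
  · rw [indicator_of_mem hz, signedRep, indicator_of_mem hz.1]; rfl
  · rw [indicator_of_notMem hz]
    by_cases ht : z ∈ (extChartAt I x).target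
    · rw [signedRep, indicator_of_mem ht, chartRep_eq_zero (α := α) ht, smul_zero]
      · rfl
      · exact h0 _ fun h => hz ⟨ht, h.2⟩
    · rw [signedRep, indicator_of_notMem ht]; rfl

/-- The integral of a top form does not depend on the chart. -/
theorem chartIntegral_eq_chartIntegral [MeasurableSpace E] [BorelSpace E] (μ : Measure E)
    [μ.IsAddHaarMeasure] {n : ℕ} (V : DForm I N ℝ n) (b : Module.Basis (Fin n) ℝ E)
    {α : DForm I N ℝ n} {x x' : N}
    (h0 : ∀ y, y ∉ (extChartAt I x).source ∩ (extChartAt I x').source → modelForm I α y = 0) :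
    chartIntegral μ V b α x = chartIntegral μ V b α x' := by
  rw [chartIntegral_eq μ V b h0, chartIntegral_eq μ V b (x := x') (x' := x)
    fun y hy => h0 y fun h => hy ⟨h.2, h.1⟩]
  have himg : trans I x x' '' transDomain I x x' = transDomain I x' x := by
    ext z
    constructor
    · rintro ⟨w, hw, rfl⟩; exact trans_mem_transDomain I hw
    · intro hz; exact ⟨_, trans_mem_transDomain I hz, trans_trans_self I hz⟩
  have hinj : InjOn (trans I x x') (transDomain I x x') := fun z hz w hw h => by
    rw [← trans_trans_self I hz, h, trans_trans_self I hw]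
  -- The pullback multiplies `α` by `det` and the orientation sign by `sign det`; their product is
  -- the `|det|` of the change of variables.
  rw [← himg, integral_image_eq_integral_abs_det_fderiv_smul μ
    (isOpen_transDomain I x x').measurableSet
    (fun z hz => (differentiableAt_trans I hz).hasFDerivAt.hasFDerivWithinAt) hinj]
  refine setIntegral_congr_fun (isOpen_transDomain I x x').measurableSet fun z hz => ?_
  rw [chartRep_trans I V hz, chartRep_trans I α hz, apply_basis_comp, apply_basis_comp, sign_mul,
    SignType.coe_mul, smul_eq_mul, ← sign_mul_self (fderiv ℝ (trans I x x') z).det]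
  ring

/-- In the chart the integrand is the exterior derivative of a smooth compactly supported form on a
vector space. -/
theorem chartIntegral_d [T2Space N] [MeasurableSpace E] [BorelSpace E] (μ : Measure E)
    [μ.IsAddHaarMeasure] {n : ℕ} {V : DForm I N ℝ (n + 1)} (hVs : IsSmoothForm I V)
    (hV : ∀ x, modelForm I V x ≠ 0) (b : Module.Basis (Fin (n + 1)) ℝ E) {γ : DForm I N ℝ n}
    (hγ : IsSmoothForm I γ) {K : Set N} (hK : IsClosed K) {x : N}
    (hx : K ⊆ (extChartAt I x).source) (h0 : ∀ y ∉ K, modelForm I γ y = 0) :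
    chartIntegral μ V b (d I γ) x = 0 := by
  obtain ⟨h1, h2⟩ := contDiff_signedRep hVs hV b hγ hK hx h0
  rw [chartIntegral, ← integral_extDeriv_eq_zero μ h1 h2 b]
  congr 1
  ext z
  congr 1
  by_cases hz : z ∈ (extChartAt I x).target
  · rw [(signedRep_eventuallyEq hVs hV b γ hz).extDeriv_eq, signedRep, indicator_of_mem hz,
      hγ.chartRep_d hz]
    exact (extDeriv_fun_smul _ _).symm
  · have h3 : signedRep V b γ x =ᶠ[nhds z] fun _ => 0 := by
      have hzK : z ∉ extChartAt I x '' K := by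
        rintro ⟨y, hy, rfl⟩; exact hz ((extChartAt I x).map_source (hx hy))
      filter_upwards [(isCompact_image_chart hK hx).isClosed.isOpen_compl.mem_nhds hzK] with w hw
      exact signedRep_eq_zero b h0 hw
    rw [h3.extDeriv_eq, signedRep, indicator_of_notMem hz, extDeriv, fderiv_const_apply]
    ext v
    rw [alternatizeUncurryFin_apply]
    simp

theorem signedRep_sum {n k : ℕ} (V : DForm I N ℝ n) (b : Fin n → E) {ι : Type*} (s : Finset ι)
    (α : ι → DForm I N ℝ k) (x : N) (z : E) :
    signedRep V b (fun y => ∑ i ∈ s, α i y) x z = ∑ i ∈ s, signedRep V b (α i) x z := by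
  by_cases hz : z ∈ (extChartAt I x).target
  · simp only [signedRep, indicator_of_mem hz, ← Finset.smul_sum]
    congr 1
    simp only [chartRep_eq I _ hz]
    ext v
    rw [ContinuousAlternatingMap.sum_apply]
    simp only [compContinuousLinearMap_apply]
    change (∑ i ∈ s, modelForm I (α i) _) _ = _
    rw [ContinuousAlternatingMap.sum_apply]
  · simp only [signedRep, indicator_of_notMem hz, Finset.sum_const_zero]

theorem chartIntegral_sum [T2Space N] [MeasurableSpace E] [BorelSpace E] (μ : Measure E)
    [μ.IsAddHaarMeasure] {n : ℕ} {V : DForm I N ℝ n} (hVs : IsSmoothForm I V)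
    (hV : ∀ x, modelForm I V x ≠ 0) (b : Module.Basis (Fin n) ℝ E) {ι : Type*} (s : Finset ι)
    {α : ι → DForm I N ℝ n} (hα : ∀ i, IsSmoothForm I (α i)) {K : Set N} (hK : IsClosed K) {x : N}
    (hx : K ⊆ (extChartAt I x).source) (h0 : ∀ i, ∀ y ∉ K, modelForm I (α i) y = 0) :
    chartIntegral μ V b (fun y => ∑ i ∈ s, α i y) x = ∑ i ∈ s, chartIntegral μ V b (α i) x := by
  simp only [chartIntegral]
  rw [← integral_finsetSum]
  · congr 1
    ext z
    rw [signedRep_sum, ContinuousAlternatingMap.sum_apply]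
  · intro i _
    obtain ⟨h1, h2⟩ := contDiff_signedRep hVs hV b (hα i) hK hx (h0 i)
    exact ((ContinuousAlternatingMap.apply ℝ E ℝ (b : Fin n → E)).continuous.comp
      h1.continuous).integrable_of_hasCompactSupport
      (h2.comp_left (g := fun α : E [⋀^Fin n]→L[ℝ] ℝ => α b) rfl)

/-- On a compact manifold oriented by `V`, a non-negative exact top form vanishes. -/
theorem exact_nonneg_eq_zero [T2Space N] {n : ℕ} (hn : Module.finrank ℝ E = n + 1)
    {V : DForm I N ℝ (n + 1)} (hVs : IsSmoothForm I V) (hV : ∀ x, modelForm I V x ≠ 0)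
    {γ : DForm I N ℝ n} (hγ : IsSmoothForm I γ) {f : N → ℝ} (hf : ∀ x, 0 ≤ f x)
    (h : ∀ x, modelForm I (d I γ) x = f x • modelForm I V x) (x : N) : f x = 0 := by
  borelize E
  let μ : Measure E := Measure.addHaar
  let b : Module.Basis (Fin (n + 1)) ℝ E := Module.finBasisOfFinrankEq ℝ E hn
  obtain ⟨t, ht⟩ := isCompact_univ.elim_finite_subcover (fun y : N => (extChartAt I y).source)
    (fun y => isOpen_extChartAt_source y) fun y _ => mem_iUnion.2 ⟨y, mem_extChartAt_source y⟩
  obtain ⟨ρ, hρ⟩ := SmoothPartitionOfUnity.exists_isSubordinate (ι := t) I (isClosed_univ (X := N))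
    (fun c => (extChartAt I (c : N)).source) (fun c => isOpen_extChartAt_source _) (by
      intro y hy
      obtain ⟨c, hc, hy'⟩ := mem_iUnion₂.1 (ht hy)
      exact mem_iUnion.2 ⟨⟨c, hc⟩, hy'⟩)
  have hρ1 : ∀ y, ∑ c, ρ c y = 1 := fun y => by
    rw [← finsum_eq_sum_of_fintype]; exact ρ.sum_eq_one (mem_univ y)
  have hρs : ∀ c, ContMDiff I 𝓘(ℝ, ℝ) ∞ (ρ c) := fun c => (ρ c).contMDiff
  have hout : ∀ c, ∀ y ∉ tsupport (ρ c), ρ c y = 0 := fun c y => image_eq_zero_of_notMem_tsupport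
  let γ' : t → DForm I N ℝ n := fun c y => ρ c y • γ y
  have hγ' : ∀ c, IsSmoothForm I (γ' c) := fun c => hγ.smul (hρs c)
  have hsum : (fun y => ∑ c, γ' c y) = γ := by
    funext y
    change ∑ c, ρ c y • modelForm I γ y = modelForm I γ y
    rw [← Finset.sum_smul, hρ1, one_smul]
  have hdsum : ∀ y, d I γ y = ∑ c, d I (γ' c) y := fun y => by
    conv_lhs => rw [← hsum]
    exact d_sum _ hγ' y
  have hd0 : ∀ c, ∀ y ∉ tsupport (ρ c), modelForm I (d I (γ' c)) y = 0 := by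
    intro c y hy
    have h1 : chartRep I (γ' c) y =ᶠ[nhds (extChartAt I y y)] chartRep I (0 : DForm I N ℝ n) y := by
      have hU : IsOpen ((extChartAt I y).target ∩ (extChartAt I y).symm ⁻¹' (tsupport (ρ c))ᶜ) :=
        (continuousOn_extChartAt_symm y).isOpen_inter_preimage (isOpen_extChartAt_target y)
          (isClosed_tsupport _).isOpen_compl
      filter_upwards [hU.mem_nhds ⟨mem_extChartAt_target y, by
        rw [mem_preimage, extChartAt_to_inv]; exact hy⟩] with w hw
      rw [chartRep_eq_zero hw.1, chartRep_eq_zero hw.1]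
      · rfl
      · change ρ c _ • modelForm I γ _ = 0
        rw [hout c _ hw.2, zero_smul]
    have h2 := d_congr_chartRep I h1
    rw [d_zero] at h2
    exact h2
  -- The piece `ρ c • d (ρ c' • γ)` is supported in both charts, so its integral may be moved from
  -- chart `c` to chart `c'`. The sum over `c'` is `ρ c • dγ`; the sum over `c` is `d (ρ c' • γ)`,
  -- whose integral vanishes.
  let τ : t → t → DForm I N ℝ (n + 1) := fun c c' y => ρ c y • d I (γ' c') y
  have hτ : ∀ c c', IsSmoothForm I (τ c c') := fun c c' => (hγ' c').d.smul (hρs c)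
  have hτ1 : ∀ c c', ∀ y ∉ tsupport (ρ c), modelForm I (τ c c') y = 0 := fun c c' y hy => by
    change ρ c y • modelForm I (d I (γ' c')) y = 0
    rw [hout c y hy, zero_smul]
  have hτ2 : ∀ c c', ∀ y ∉ tsupport (ρ c'), modelForm I (τ c c') y = 0 := fun c c' y hy => by
    change ρ c y • modelForm I (d I (γ' c')) y = 0
    rw [hd0 c' y hy, smul_zero]
  let σ : t → DForm I N ℝ (n + 1) := fun c y => ρ c y • d I γ y
  have hσ : ∀ c, IsSmoothForm I (σ c) := fun c => hγ.d.smul (hρs c)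
  have hσ1 : ∀ c, ∀ y ∉ tsupport (ρ c), modelForm I (σ c) y = 0 := fun c y hy => by
    change ρ c y • modelForm I (d I γ) y = 0
    rw [hout c y hy, zero_smul]
  have hστ : ∀ c, σ c = fun y => ∑ c', τ c c' y := fun c => by
    funext y
    change ρ c y • d I γ y = ∑ c', ρ c y • d I (γ' c') y
    rw [hdsum, Finset.smul_sum]
  have htot : ∑ c, chartIntegral μ V b (σ c) c = 0 := by
    calc ∑ c, chartIntegral μ V b (σ c) c = ∑ c, ∑ c', chartIntegral μ V b (τ c c') c := by
          refine Finset.sum_congr rfl fun c _ => ?_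
          rw [hστ]
          exact chartIntegral_sum μ hVs hV b _ (hτ c) (isClosed_tsupport _) (hρ c) (hτ1 c)
      _ = ∑ c', ∑ c, chartIntegral μ V b (τ c c') c' := by
          rw [Finset.sum_comm]
          refine Finset.sum_congr rfl fun c' _ => Finset.sum_congr rfl fun c _ => ?_
          refine chartIntegral_eq_chartIntegral μ V b fun y hy => ?_
          by_cases h1 : y ∈ tsupport (ρ c)
          · exact hτ2 c c' y fun h2 => hy ⟨hρ c h1, hρ c' h2⟩
          · exact hτ1 c c' y h1
      _ = ∑ c' : t, chartIntegral μ V b (d I (γ' c')) c' := by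
          refine Finset.sum_congr rfl fun c' _ => ?_
          rw [← chartIntegral_sum μ hVs hV b _ (fun c => hτ c c') (isClosed_tsupport _) (hρ c')
            (fun c => hτ2 c c')]
          congr 1
          funext y
          change ∑ c, ρ c y • modelForm I (d I (γ' c')) y = modelForm I (d I (γ' c')) y
          rw [← Finset.sum_smul, hρ1, one_smul]
      _ = 0 := by
          refine Finset.sum_eq_zero fun c' _ => ?_
          refine chartIntegral_d μ hVs hV b (hγ' c') (isClosed_tsupport (ρ c')) (hρ c') ?_
          intro y hy
          change ρ c' y • modelForm I γ y = 0
          rw [hout c' y hy, zero_smul]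
  -- The orientation sign turns `V` into its absolute value, so the total that vanishes is a sum of
  -- integrals of non-negative functions.
  have hval : ∀ (c : t) z, z ∈ (extChartAt I (c : N)).target → signedRep V b (σ c) c z b =
      ρ c ((extChartAt I (c : N)).symm z) * f ((extChartAt I (c : N)).symm z) *
        |chartRep I V c z b| := by
    intro c z hz
    have h1 : chartRep I (σ c) c z = (ρ c ((extChartAt I (c : N)).symm z) *
        f ((extChartAt I (c : N)).symm z)) • chartRep I V c z := by
      rw [chartRep_eq I (σ c) hz, chartRep_eq I V hz]
      have h2 : modelForm I (σ c) ((extChartAt I (c : N)).symm z) =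
        (ρ c ((extChartAt I (c : N)).symm z) * f ((extChartAt I (c : N)).symm z)) •
          modelForm I V ((extChartAt I (c : N)).symm z) := by
        rw [mul_smul, ← h]; rfl
      rw [h2]; rfl
    rw [signedRep, indicator_of_mem hz, h1, ContinuousAlternatingMap.smul_apply,
      ContinuousAlternatingMap.smul_apply, smul_eq_mul, smul_eq_mul, mul_left_comm, sign_mul_self]
  have hnn : ∀ (c : t) z, 0 ≤ signedRep V b (σ c) c z b := by
    intro c z
    by_cases hz : z ∈ (extChartAt I (c : N)).target
    · rw [hval c z hz]
      exact mul_nonneg (mul_nonneg (ρ.nonneg c _) (hf _)) (abs_nonneg _)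
    · rw [signedRep, indicator_of_notMem hz]; exact le_rfl
  have hzero : ∀ c, chartIntegral μ V b (σ c) c = 0 := fun c =>
    (Finset.sum_eq_zero_iff_of_nonneg (fun c _ => integral_nonneg (hnn c))).1 htot c
      (Finset.mem_univ c)
  obtain ⟨c, hc⟩ : ∃ c, ρ c x ≠ 0 := by
    by_contra! hcon
    have := hρ1 x
    simp [hcon] at this
  have hxc : x ∈ (extChartAt I (c : N)).source := hρ c (subset_tsupport _ hc)
  have hz := (extChartAt I (c : N)).map_source hxc
  obtain ⟨h1, h2⟩ := contDiff_signedRep hVs hV b (hσ c) (isClosed_tsupport _) (hρ c) (hσ1 c)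
  by_contra hfx
  have h3 := Continuous.integral_pos_of_hasCompactSupport_nonneg_nonzero (μ := μ)
    ((ContinuousAlternatingMap.apply ℝ E ℝ (b : Fin (n + 1) → E)).continuous.comp h1.continuous)
    (h2.comp_left (g := fun α : E [⋀^Fin (n + 1)]→L[ℝ] ℝ => α b) rfl) (hnn c)
    (x := extChartAt I (c : N) x) (by
      refine ne_of_eq_of_ne (hval c _ hz) ?_
      rw [(extChartAt I (c : N)).left_inv hxc]
      exact mul_ne_zero (mul_ne_zero hc hfx) (abs_ne_zero.2 (chartRep_basis_ne_zero hV b hz)))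
  exact h3.ne' (hzero c)

end Stokes

end CalabiGray

namespace CalabiGray

/-! ### Linear algebra of Hermitian forms -/

section Commutative

/-- Powers of a sum of commuting elements of square zero. -/
theorem sum_pow_of_sq_zero {S n : Type*} [CommRing S] [DecidableEq n] {x : n → S}
    (hx : ∀ i, x i * x i = 0) (T : Finset n) (k : ℕ) :
    (∑ i ∈ T, x i) ^ k = k.factorial • ∑ U ∈ T.powersetCard k, ∏ i ∈ U, x i := by
  induction T using Finset.induction_on generalizing k with
  | empty =>
    cases k with
    | zero => simp
    | succ k => rw [Finset.powersetCard_eq_empty.2 (by simp)]; simp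
  | insert a T ha ih =>
    cases k with
    | zero => simp
    | succ k =>
      rw [Finset.sum_insert ha, Finset.powersetCard_succ_insert ha, Finset.sum_union, smul_add,
        ← ih (k + 1), Finset.sum_image]
      · have h1 : ∑ U ∈ T.powersetCard k, ∏ i ∈ insert a U, x i =
            x a * ∑ U ∈ T.powersetCard k, ∏ i ∈ U, x i := by
          rw [Finset.mul_sum]
          refine Finset.sum_congr rfl fun U hU => ?_
          rw [Finset.prod_insert fun h => ha ((Finset.mem_powersetCard.1 hU).1 h)]
        -- The binomial expansion stops after the term linear in `x a`, whose square is zero.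
        have h2 : ∀ s : S, ∀ j : ℕ, (x a + s) ^ (j + 1) = s ^ (j + 1) + (j + 1 : ℕ) • (x a * s ^ j) := by
          intro s j
          induction j with
          | zero => simp [add_comm]
          | succ j ihj =>
            rw [pow_succ, ihj]
            simp only [nsmul_eq_mul]
            push_cast
            linear_combination ((j : S) + 1) * s ^ j * hx a
        rw [h1, h2, Nat.factorial_succ, mul_smul, ← mul_smul_comm k.factorial, ← ih k]
      · intro U hU U' hU' h
        have h3 : a ∉ U := fun h => ha ((Finset.mem_powersetCard.1 hU).1 h)
        have h4 : a ∉ U' := fun h => ha ((Finset.mem_powersetCard.1 hU').1 h)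
        rw [← Finset.erase_insert h3, h, Finset.erase_insert h4]
      · refine Finset.disjoint_left.2 fun U hU hU' => ?_
        obtain ⟨U', _, rfl⟩ := Finset.mem_image.1 hU'
        exact ha ((Finset.mem_powersetCard.1 hU).1 (Finset.mem_insert_self _ _))

theorem sum_pow_card_of_sq_zero {S n : Type*} [CommRing S] [DecidableEq n] {x : n → S}
    (hx : ∀ i, x i * x i = 0) (T : Finset n) :
    (∑ i ∈ T, x i) ^ T.card = T.card.factorial • ∏ i ∈ T, x i := by
  rw [sum_pow_of_sq_zero hx, Finset.powersetCard_self, Finset.sum_singleton]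

theorem sum_pow_pred_of_sq_zero {S n : Type*} [CommRing S] [DecidableEq n] {x : n → S}
    (hx : ∀ i, x i * x i = 0) {T : Finset n} {k : ℕ} (hT : T.card = k + 1) :
    (∑ i ∈ T, x i) ^ k = k.factorial • ∑ j ∈ T, ∏ i ∈ T.erase j, x i := by
  rw [sum_pow_of_sq_zero hx]
  congr 1
  symm
  refine Finset.sum_bij (fun j _ => T.erase j) ?_ ?_ ?_ ?_
  · intro j hj
    rw [Finset.mem_powersetCard, Finset.card_erase_of_mem hj, hT]
    exact ⟨Finset.erase_subset _ _, rfl⟩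
  · intro i hi j hj h
    by_contra hne
    have : i ∈ T.erase j := Finset.mem_erase.2 ⟨hne, hi⟩
    rw [← h] at this
    exact Finset.notMem_erase _ _ this
  · intro U hU
    obtain ⟨hUT, hc⟩ := Finset.mem_powersetCard.1 hU
    have h1 : (T \ U).card = 1 := by rw [Finset.card_sdiff_of_subset hUT]; omega
    obtain ⟨j, hj⟩ := Finset.card_eq_one.1 h1
    have hjT : j ∈ T ∧ j ∉ U := Finset.mem_sdiff.1 (hj ▸ Finset.mem_singleton_self j)
    refine ⟨j, hjT.1, ?_⟩
    ext i
    have := Finset.ext_iff.1 hj i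
    simp only [Finset.mem_sdiff, Finset.mem_singleton] at this
    simp only [Finset.mem_erase]
    constructor
    · rintro ⟨h2, h3⟩; by_contra h4; exact h2 (this.1 ⟨h3, h4⟩)
    · intro h2; exact ⟨fun h3 => hjT.2 (h3 ▸ h2), hUT h2⟩
  · intros; rfl

end Commutative

section Determinant

variable {V : Type*} [AddCommGroup V] [Module ℝ V] [FiniteDimensional ℝ V]

/-- `(1 + J)² = 2 J` shows that `det J` is a positive multiple of a square, and `J² = -1` gives
`(det J)² = ±1`. Consequently complex structures fix forms of top degree. -/
theorem det_eq_one_of_sq_eq_neg_one (J : V →ₗ[ℝ] V) (hJ : ∀ v, J (J v) = -v) :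
    LinearMap.det J = 1 := by
  have h1 : (LinearMap.id + J) ∘ₗ (LinearMap.id + J) = (2 : ℝ) • J := by
    ext v; simp [hJ, two_smul]; abel
  have h2 : J ∘ₗ J = (-1 : ℝ) • LinearMap.id := by ext v; simp [hJ]
  have h3 := congrArg LinearMap.det h1
  have h4 := congrArg LinearMap.det h2
  rw [LinearMap.det_comp, LinearMap.det_smul] at h3 h4
  rw [LinearMap.det_id, mul_one] at h4
  have h5 : (LinearMap.det J) ^ 2 = 1 ∨ (LinearMap.det J) ^ 2 = -1 := by
    rcases neg_one_pow_eq_or ℝ (Module.finrank ℝ V) with h | h <;> rw [h] at h4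
    · left; linarith
    · right; linarith
  have h6 : (LinearMap.det J) ^ 2 = 1 := by
    rcases h5 with h | h
    · exact h
    · nlinarith [sq_nonneg (LinearMap.det J)]
  have h7 : 0 ≤ LinearMap.det J := by
    have h8 : (0 : ℝ) < 2 ^ Module.finrank ℝ V := by positivity
    have h9 : 0 ≤ 2 ^ Module.finrank ℝ V * LinearMap.det J := by rw [← h3]; exact mul_self_nonneg _
    exact nonneg_of_mul_nonneg_right h9 h8
  nlinarith

end Determinant

/-! ### Even elements as a commutative ring. -/

section Center

open ExteriorAlgebra

variable {V : Type*} [TopologicalSpace V] [AddCommGroup V] [Module ℝ V]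

/-- This places two-forms in a commutative ring, where `sum_pow_of_sq_zero` can expand their powers.
-/
theorem mem_center_of_even {k : ℕ} {x : Ext V} (hx : x ∈ ⋀[ℝ]^(2 * k) (V →L[ℝ] ℝ)) :
    x ∈ Subalgebra.center ℝ (Ext V) := by
  rw [Subalgebra.mem_center_iff]
  intro y
  have : Commute x y := by
    induction y using ExteriorAlgebra.induction with
    | algebraMap r => exact Algebra.commute_algebraMap_right _ _
    | ι c => exact ext_comm_of_even hx (ι_mem c)
    | mul a b ha hb => exact ha.mul_right hb
    | add a b ha hb => exact ha.add_right hb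
  exact this.symm

theorem ι_mul_ι_mem (a b : V →L[ℝ] ℝ) : ι ℝ a * ι ℝ b ∈ ⋀[ℝ]^2 (V →L[ℝ] ℝ) :=
  mul_mem_ext (ι_mem a) (ι_mem b)

/-- The central element `a ∧ b`. -/
def cen (a b : V →L[ℝ] ℝ) : Subalgebra.center ℝ (Ext V) :=
  ⟨ι ℝ a * ι ℝ b, mem_center_of_even (k := 1) (ι_mul_ι_mem a b)⟩

theorem ι_swap (a b : V →L[ℝ] ℝ) : ι ℝ a * ι ℝ b = -(ι ℝ b * ι ℝ a) :=
  eq_neg_of_add_eq_zero_left (ι_add_mul_swap a b)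

theorem cen_swap (a b : V →L[ℝ] ℝ) : cen b a = (-1 : ℝ) • cen a b :=
  Subtype.ext ((ι_swap b a).trans (neg_one_smul ℝ _).symm)

theorem cen_self (a : V →L[ℝ] ℝ) : cen a a = 0 := Subtype.ext (ι_sq_zero a)

theorem cen_mul_cen_left (a b c : V →L[ℝ] ℝ) : cen a b * cen a c = 0 := by
  refine Subtype.ext ?_
  change ι ℝ a * ι ℝ b * (ι ℝ a * ι ℝ c) = 0
  rw [ι_swap a b, neg_mul, mul_assoc, ← mul_assoc (ι ℝ a), ι_sq_zero, zero_mul, mul_zero, neg_zero]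

theorem cen_mul_cen_right (a b c : V →L[ℝ] ℝ) : cen a b * cen b c = 0 := by
  refine Subtype.ext ?_
  change ι ℝ a * ι ℝ b * (ι ℝ b * ι ℝ c) = 0
  rw [mul_assoc, ← mul_assoc (ι ℝ b), ι_sq_zero, zero_mul, mul_zero]

/-- Writes the top monomial as one product of covectors, to be evaluated as a determinant. The order
chosen by `r` is irrelevant there; only its injectivity is needed. -/
theorem exists_prod_cen_eq_ιMulti {n : ℕ} (c : Fin n × Bool → V →L[ℝ] ℝ) :
    ∃ r : Fin (2 * n) → Fin n × Bool, Function.Injective r ∧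
      ((∏ i, cen (c (i, false)) (c (i, true)) : Subalgebra.center ℝ (Ext V)) : Ext V) =
        ιMulti ℝ (2 * n) (fun k => c (r k)) := by
  induction n with
  | zero =>
    refine ⟨fun k => k.elim0, fun k => k.elim0, ?_⟩
    rw [Finset.univ_eq_empty, Finset.prod_empty]
    exact (ιMulti_zero_apply _).symm
  | succ n ih =>
    obtain ⟨r, hr, h⟩ := ih (fun p => c (p.1.castSucc, p.2))
    let r₁ : Fin (2 * n) → Fin (n + 1) × Bool := fun k => ((r k).1.castSucc, (r k).2)
    let r₂ : Fin 2 → Fin (n + 1) × Bool := ![(Fin.last n, false), (Fin.last n, true)]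
    refine ⟨Fin.append r₁ r₂, ?_, ?_⟩
    · rw [Fin.append_injective_iff]
      refine ⟨fun k l hkl => hr ?_, ?_, ?_⟩
      · simp only [r₁, Prod.mk.injEq, Fin.castSucc_inj] at hkl
        exact Prod.ext hkl.1 hkl.2
      · intro k l hkl
        fin_cases k <;> fin_cases l <;> simp_all [r₂]
      · intro k l hkl
        have h1 : (r₁ k).1 ≠ Fin.last n := Fin.castSucc_ne_last _
        have h2 : (r₂ l).1 = Fin.last n := by fin_cases l <;> rfl
        exact h1 (hkl ▸ h2)
    · rw [Fin.prod_univ_castSucc]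
      have h3 : (((∏ i : Fin n, cen (c (i.castSucc, false)) (c (i.castSucc, true))) *
          cen (c (Fin.last n, false)) (c (Fin.last n, true)) : Subalgebra.center ℝ (Ext V)) : Ext V) =
          ιMulti ℝ (2 * n) (fun k => c (r₁ k)) * ιMulti ℝ 2 (fun k => c (r₂ k)) := by
        rw [show ιMulti ℝ 2 (fun k => c (r₂ k)) =
          ι ℝ (c (Fin.last n, false)) * ι ℝ (c (Fin.last n, true)) by simp [ιMulti_apply, r₂]; rfl]
        rw [← h]
        rfl
      rw [h3, ιMulti_mul_ιMulti]
      congr 1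
      ext k : 1
      refine Fin.addCases (fun i => ?_) (fun i => ?_) k <;> simp

end Center

end CalabiGray

namespace CalabiGray

/-! ### Unitary bases -/

section Unitary

variable {V : Type*} [TopologicalSpace V] [AddCommGroup V] [Module ℝ V]

/-- `B` is a Hermitian inner product on `V` with complex structure `J`. -/
structure IsHermitianInner (B : V →L[ℝ] V →L[ℝ] ℝ) (J : V →L[ℝ] V) : Prop where
  symm : ∀ u v, B u v = B v u
  pos : ∀ v, v ≠ 0 → 0 < B v v
  sq : ∀ v, J (J v) = -v
  map : ∀ u v, B (J u) (J v) = B u v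

/-- The vectors `e i` form a unitary system. -/
structure IsUnitary (B : V →L[ℝ] V →L[ℝ] ℝ) (J : V →L[ℝ] V) {n : ℕ} (e : Fin n → V) : Prop where
  inner : ∀ i j, B (e i) (e j) = if i = j then 1 else 0
  inner_J : ∀ i j, B (e i) (J (e j)) = 0

/-- The vectors `e i` together with the vectors `J (e i)`. -/
def realFrame (J : V →L[ℝ] V) {n : ℕ} (e : Fin n → V) : Fin n × Bool → V :=
  fun p => if p.2 then J (e p.1) else e p.1

variable {B : V →L[ℝ] V →L[ℝ] ℝ} {J : V →L[ℝ] V}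

theorem IsHermitianInner.inner_J (h : IsHermitianInner B J) (u v : V) : B u (J v) = -B (J u) v := by
  rw [← h.map u, h.sq, map_neg]

theorem IsHermitianInner.inner_J_self (h : IsHermitianInner B J) (v : V) : B v (J v) = 0 := by
  have h1 := h.inner_J v v
  rw [h.symm (J v)] at h1
  linarith

theorem IsUnitary.inner_realFrame (h : IsHermitianInner B J) {n : ℕ} {e : Fin n → V}
    (he : IsUnitary B J e) (r s : Fin n × Bool) :
    B (realFrame J e r) (realFrame J e s) = if r = s then 1 else 0 := by
  obtain ⟨i, a⟩ := r
  obtain ⟨j, b⟩ := s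
  cases a <;> cases b <;> simp [realFrame, he.inner, he.inner_J, h.map, h.symm (J _) (e _)]

/-- Complex Gram–Schmidt: orthogonality to all `e i` and `J (e i)` imposes fewer real conditions
than the dimension, so a further vector exists. The first vector is prescribed so that the frame can
be adapted to `dφ`. -/
theorem exists_unitary_extension [FiniteDimensional ℝ V] (h : IsHermitianInner B J) {e₀ : V}
    (he₀ : B e₀ e₀ = 1) (k : ℕ) (hk : 2 * k < Module.finrank ℝ V) :
    ∃ e : Fin (k + 1) → V, IsUnitary B J e ∧ e 0 = e₀ := by
  induction k with
  | zero =>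
    refine ⟨fun _ => e₀, ⟨fun i j => ?_, fun i j => h.inner_J_self _⟩, rfl⟩
    rw [if_pos (Fin.ext (by omega)), he₀]
  | succ k ih =>
    obtain ⟨e, he, he0⟩ := ih (by omega)
    let L : V →ₗ[ℝ] (Fin (k + 1) × Bool → ℝ) :=
      LinearMap.pi fun r => (B (realFrame J e r)).toLinearMap
    have hL : LinearMap.ker L ≠ ⊥ := by
      refine LinearMap.ker_ne_bot_of_finrank_lt ?_
      simp only [Module.finrank_fintype_fun_eq_card, Fintype.card_prod, Fintype.card_fin,
        Fintype.card_bool]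
      omega
    obtain ⟨v, hv, hv0⟩ := Submodule.exists_mem_ne_zero_of_ne_bot hL
    have hv1 : ∀ r, B (realFrame J e r) v = 0 := fun r => congrFun (LinearMap.mem_ker.1 hv) r
    have hp := h.pos v hv0
    set t : ℝ := (Real.sqrt (B v v))⁻¹ with ht
    have hw1 : ∀ i, B (e i) (t • v) = 0 := fun i => by
      rw [map_smul, show B (e i) v = 0 from hv1 (i, false), smul_zero]
    have hw2 : ∀ i, B (J (e i)) (t • v) = 0 := fun i => by
      rw [map_smul, show B (J (e i)) v = 0 from hv1 (i, true), smul_zero]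
    have hw3 : B (t • v) (t • v) = 1 := by
      have h1 : Real.sqrt (B v v) * Real.sqrt (B v v) = B v v := Real.mul_self_sqrt hp.le
      have h2 : Real.sqrt (B v v) ≠ 0 := (Real.sqrt_pos.2 hp).ne'
      simp only [map_smul, smul_apply, smul_eq_mul]
      rw [ht]; field_simp; rw [pow_two, h1]
    refine ⟨Fin.snoc e (t • v), ⟨fun i j => ?_, fun i j => ?_⟩, ?_⟩
    · refine Fin.lastCases ?_ (fun i => ?_) i <;> refine Fin.lastCases ?_ (fun j => ?_) j
      · simp only [Fin.snoc_last, if_true, hw3]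
      · rw [Fin.snoc_last, Fin.snoc_castSucc, h.symm, hw1, if_neg (Fin.castSucc_ne_last j).symm]
      · rw [Fin.snoc_last, Fin.snoc_castSucc, hw1, if_neg (Fin.castSucc_ne_last i)]
      · simp only [Fin.snoc_castSucc, he.inner, Fin.castSucc_inj]
    · refine Fin.lastCases ?_ (fun i => ?_) i <;> refine Fin.lastCases ?_ (fun j => ?_) j
      · exact h.inner_J_self _
      · rw [Fin.snoc_last, Fin.snoc_castSucc, h.symm, hw2]
      · rw [Fin.snoc_last, Fin.snoc_castSucc, h.inner_J, hw2, neg_zero]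
      · simp only [Fin.snoc_castSucc, he.inner_J]
    · rw [show (0 : Fin (k + 1 + 1)) = Fin.castSucc 0 from rfl, Fin.snoc_castSucc, he0]

theorem IsUnitary.expand [FiniteDimensional ℝ V] (h : IsHermitianInner B J) {n : ℕ} {e : Fin n → V}
    (he : IsUnitary B J e) (hn : Module.finrank ℝ V = 2 * n) (v : V) :
    v = ∑ r, B (realFrame J e r) v • realFrame J e r := by
  have hli : LinearIndependent ℝ (realFrame J e) := by
    rw [Fintype.linearIndependent_iff]
    intro c hc r
    have h1 := congrArg (B (realFrame J e r)) hc
    simpa [map_sum, he.inner_realFrame h] using h1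
  have hsp : v ∈ Submodule.span ℝ (Set.range (realFrame J e)) := by
    rw [hli.span_eq_top_of_card_eq_finrank' (by simp [hn, mul_comm])]
    trivial
  obtain ⟨c, rfl⟩ := (Submodule.mem_span_range_iff_exists_fun ℝ).1 hsp
  refine Finset.sum_congr rfl fun r _ => ?_
  congr 1
  simp [map_sum, he.inner_realFrame h]

open ExteriorAlgebra

/-- The expansion of a two-form in the frame given by a unitary system. -/
def expandTwo (B : V →L[ℝ] V →L[ℝ] ℝ) (J : V →L[ℝ] V) {n : ℕ} (e : Fin n → V)
    (α : V [⋀^Fin 2]→L[ℝ] ℝ) : Subalgebra.center ℝ (Ext V) :=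
  (1 / 2 : ℝ) • ∑ r, ∑ s, α ![realFrame J e r, realFrame J e s] •
    cen (B (realFrame J e r)) (B (realFrame J e s))

theorem coe_expandTwo {n : ℕ} (e : Fin n → V) (α : V [⋀^Fin 2]→L[ℝ] ℝ) :
    (expandTwo B J e α : Ext V) =
      (1 / 2 : ℝ) • ∑ r, ∑ s, α ![realFrame J e r, realFrame J e s] •
        (ι ℝ (B (realFrame J e r)) * ι ℝ (B (realFrame J e s))) := by
  simp only [expandTwo, Subalgebra.coe_smul, AddSubmonoidClass.coe_finsetSum]
  rfl

theorem expandTwo_mem {n : ℕ} (e : Fin n → V) (α : V [⋀^Fin 2]→L[ℝ] ℝ) :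
    (expandTwo B J e α : Ext V) ∈ ⋀[ℝ]^2 (V →L[ℝ] ℝ) := by
  rw [coe_expandTwo]
  exact Submodule.smul_mem _ _ (Submodule.sum_mem _ fun r _ => Submodule.sum_mem _ fun s _ =>
    Submodule.smul_mem _ _ (ι_mul_ι_mem _ _))

theorem form_two_swap (α : V [⋀^Fin 2]→L[ℝ] ℝ) (u v : V) : α ![v, u] = -α ![u, v] := by
  have := α.toAlternatingMap.map_swap ![u, v] (i := 0) (j := 1) (by decide)
  rw [← show ![u, v] ∘ Equiv.swap (0 : Fin 2) 1 = ![v, u] by ext i; fin_cases i <;> simp]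
  exact this

theorem form_two_sum_left (α : V [⋀^Fin 2]→L[ℝ] ℝ) {n : Type*} (s : Finset n) (c : n → ℝ)
    (u : n → V) (v : V) : α ![∑ i ∈ s, c i • u i, v] = ∑ i ∈ s, c i * α ![u i, v] := by
  classical
  have h1 : ∀ x : V, ![x, v] = Function.update ![0, v] 0 x := fun x => by
    ext i; fin_cases i <;> simp
  induction s using Finset.induction_on with
  | empty => rw [Finset.sum_empty, Finset.sum_empty]; exact α.map_coord_zero 0 rfl
  | insert a s ha ih =>
    rw [Finset.sum_insert ha, Finset.sum_insert ha, h1, α.map_update_add, ← h1, ← h1, ih, h1,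
      α.map_update_smul, ← h1, smul_eq_mul]

theorem form_two_ext {α β : V [⋀^Fin 2]→L[ℝ] ℝ} (h : ∀ u v, α ![u, v] = β ![u, v]) : α = β := by
  ext v
  have : v = ![v 0, v 1] := by ext i; fin_cases i <;> rfl
  rw [this]
  exact h _ _

/-- The double sum meets each pair of frame vectors in both orders, which the factor `1 / 2` in
`expandTwo` corrects. -/
theorem toForm_expandTwo [FiniteDimensional ℝ V] (h : IsHermitianInner B J) {n : ℕ} {e : Fin n → V}
    (he : IsUnitary B J e) (hn : Module.finrank ℝ V = 2 * n) (α : V [⋀^Fin 2]→L[ℝ] ℝ) :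
    toForm 2 (expandTwo B J e α : Ext V) = α := by
  refine form_two_ext fun u v => ?_
  rw [coe_expandTwo]
  simp only [map_smul, _root_.map_sum, smul_eq_mul,
    ContinuousAlternatingMap.smul_apply, ContinuousAlternatingMap.sum_apply, toForm_ι_mul_ι]
  simp only [Matrix.cons_val_zero, Matrix.cons_val_one]
  have h1 : α ![u, v] = ∑ r, ∑ s, B (realFrame J e r) u * B (realFrame J e s) v *
      α ![realFrame J e r, realFrame J e s] := by
    conv_lhs => rw [he.expand h hn u]
    rw [form_two_sum_left]
    refine Finset.sum_congr rfl fun r _ => ?_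
    rw [form_two_swap]
    conv_lhs => rw [he.expand h hn v]
    rw [form_two_sum_left, ← Finset.sum_neg_distrib, Finset.mul_sum]
    refine Finset.sum_congr rfl fun s _ => ?_
    rw [form_two_swap]
    ring
  have h2 : α ![u, v] = -∑ r, ∑ s, B (realFrame J e s) u * B (realFrame J e r) v *
      α ![realFrame J e r, realFrame J e s] := by
    rw [h1, Finset.sum_comm, ← Finset.sum_neg_distrib]
    refine Finset.sum_congr rfl fun r _ => ?_
    rw [← Finset.sum_neg_distrib]
    refine Finset.sum_congr rfl fun s _ => ?_
    rw [form_two_swap]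
    ring
  have h3 : ∀ r s, α ![realFrame J e r, realFrame J e s] *
      (B (realFrame J e r) u * B (realFrame J e s) v -
        B (realFrame J e r) v * B (realFrame J e s) u) =
      B (realFrame J e r) u * B (realFrame J e s) v * α ![realFrame J e r, realFrame J e s] -
      B (realFrame J e s) u * B (realFrame J e r) v * α ![realFrame J e r, realFrame J e s] :=
    fun r s => by ring
  simp_rw [h3, Finset.sum_sub_distrib]
  linarith

/-- The form `η = ∑ i, p i ∧ q i` in a unitary frame. -/
theorem toForm_sum_cen [FiniteDimensional ℝ V] (h : IsHermitianInner B J) {n : ℕ} {e : Fin n → V}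
    (he : IsUnitary B J e) (hn : Module.finrank ℝ V = 2 * n) {η : V [⋀^Fin 2]→L[ℝ] ℝ}
    (hη : ∀ u v, η ![u, v] = B (J u) v) :
    toForm 2 ((∑ i, cen (B (e i)) (B (J (e i))) : Subalgebra.center ℝ (Ext V)) : Ext V) = η := by
  refine form_two_ext fun u v => ?_
  have h1 : ((∑ i, cen (B (e i)) (B (J (e i))) : Subalgebra.center ℝ (Ext V)) : Ext V) =
      ∑ i, ι ℝ (B (e i)) * ι ℝ (B (J (e i))) := by
    simp only [AddSubmonoidClass.coe_finsetSum]; rfl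
  rw [h1, hη]
  conv_rhs => rw [he.expand h hn v]
  simp only [_root_.map_sum, ContinuousAlternatingMap.sum_apply, toForm_ι_mul_ι,
    Fintype.sum_prod_type, Fintype.sum_bool, realFrame, Matrix.cons_val_zero,
    Matrix.cons_val_one, if_true]
  refine Finset.sum_congr rfl fun i _ => ?_
  rw [map_add, map_smul, map_smul, h.map, h.symm u]
  simp only [Bool.false_eq_true, if_false, smul_eq_mul]
  rw [h.symm (J u) (e i), h.inner_J]
  ring

theorem toForm_coe_pow {x : Subalgebra.center ℝ (Ext V)} (hx : (x : Ext V) ∈ ⋀[ℝ]^2 (V →L[ℝ] ℝ))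
    (k : ℕ) : toForm (2 * k) ((x ^ k : Subalgebra.center ℝ (Ext V)) : Ext V) =
      wedgePow (toForm 2 (x : Ext V)) k := by
  rw [← toForm_pow hx]; rfl

theorem sum_cen_mem {n : ℕ} (p q : Fin n → V →L[ℝ] ℝ) :
    ((∑ i, cen (p i) (q i) : Subalgebra.center ℝ (Ext V)) : Ext V) ∈ ⋀[ℝ]^2 (V →L[ℝ] ℝ) := by
  rw [AddSubmonoidClass.coe_finsetSum]
  exact Submodule.sum_mem _ fun i _ => ι_mul_ι_mem _ _

/-- The top power of the fundamental form does not vanish. -/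
theorem wedgePow_ne_zero [FiniteDimensional ℝ V] (h : IsHermitianInner B J) {n : ℕ}
    (hn : Module.finrank ℝ V = 2 * n) {η : V [⋀^Fin 2]→L[ℝ] ℝ}
    (hη : ∀ u v, η ![u, v] = B (J u) v) : wedgePow η n ≠ 0 := by
  classical
  rcases Nat.eq_zero_or_pos n with rfl | hpos
  · intro h0
    have : wedgePow η 0 (fun i => i.elim0) = 1 := rfl
    rw [h0] at this
    exact zero_ne_one this
  obtain ⟨n, rfl⟩ : ∃ k, n = k + 1 := ⟨n - 1, by omega⟩
  have : Nontrivial V := Module.nontrivial_of_finrank_pos (R := ℝ) (by omega)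
  obtain ⟨v, hv⟩ := exists_ne (0 : V)
  have h2 : Real.sqrt (B v v) * Real.sqrt (B v v) = B v v := Real.mul_self_sqrt (h.pos v hv).le
  have h3 : Real.sqrt (B v v) ≠ 0 := (Real.sqrt_pos.2 (h.pos v hv)).ne'
  have h4 : B ((Real.sqrt (B v v))⁻¹ • v) ((Real.sqrt (B v v))⁻¹ • v) = 1 := by
    simp only [map_smul, smul_apply, smul_eq_mul]
    field_simp; rw [pow_two, h2]
  obtain ⟨e, he, -⟩ := exists_unitary_extension h h4 n (by omega)
  obtain ⟨r, hr, hP⟩ := exists_prod_cen_eq_ιMulti (fun p => B (realFrame J e p))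
  have h5 := sum_pow_card_of_sq_zero (x := fun i => cen (B (e i)) (B (J (e i))))
    (fun i => cen_mul_cen_left _ _ _) Finset.univ
  rw [Finset.card_univ, Fintype.card_fin] at h5
  rw [← toForm_sum_cen h he hn hη, ← toForm_coe_pow (sum_cen_mem _ _), h5]
  have h6 : ∏ i, cen (B (realFrame J e (i, false))) (B (realFrame J e (i, true))) =
    ∏ i, cen (B (e i)) (B (J (e i))) := rfl
  rw [h6] at hP
  intro h0
  have h7 : (((n + 1).factorial • ∏ i, cen (B (e i)) (B (J (e i))) :
      Subalgebra.center ℝ (Ext V)) : Ext V) =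
      (n + 1).factorial • ιMulti ℝ (2 * (n + 1)) (fun k => B (realFrame J e (r k))) := by
    rw [← hP]; rfl
  rw [h7, _root_.map_nsmul, toForm_ιMulti] at h0
  -- On the frame dual to these covectors the determinant becomes that of the identity matrix.
  have h8 := congrArg (fun α => α (fun k => realFrame J e (r k))) h0
  simp only [ContinuousAlternatingMap.smul_apply, detForm_apply, he.inner_realFrame h] at h8
  rw [show (Matrix.of fun i j => if r j = r i then (1 : ℝ) else 0) = 1 from by
    ext i j; simp [Matrix.one_apply, hr.eq_iff, eq_comm], Matrix.det_one] at h8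
  have h9 : ((n + 1).factorial • (1 : ℝ)) = 0 := h8
  simp [Nat.factorial_ne_zero] at h9

/-- In a unitary frame in which `σ` only involves the first vector,
`η ^ N ∧ α ∧ σ` is a multiple of `η ^ (N + 2)`. -/
theorem wedge_wedge_unitary [FiniteDimensional ℝ V] (h : IsHermitianInner B J) {N : ℕ}
    {e : Fin (N + 2) → V} (he : IsUnitary B J e) (hn : Module.finrank ℝ V = 2 * (N + 2))
    {η α σ : V [⋀^Fin 2]→L[ℝ] ℝ} (hη : ∀ u v, η ![u, v] = B (J u) v)
    (hσ : ∀ i ≠ 0, ∀ v, σ ![e i, v] = 0 ∧ σ ![J (e i), v] = 0) :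
    wedge (wedge (wedgePow η N) α) σ =
      (σ ![e 0, J (e 0)] * (N.factorial / (N + 2).factorial) *
        ∑ j ∈ Finset.univ.erase 0, α ![e j, J (e j)]) • wedgePow η (N + 2) := by
  classical
  set x : Fin (N + 2) → Subalgebra.center ℝ (Ext V) := fun i => cen (B (e i)) (B (J (e i))) with hx
  have hx0 : ∀ i, x i * x i = 0 := fun i => cen_mul_cen_left _ _ _
  set P := ∏ i, x i with hP
  have hη' : toForm 2 ((∑ i, x i : Subalgebra.center ℝ (Ext V)) : Ext V) = η :=
    toForm_sum_cen h he hn hη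
  have hmem := sum_cen_mem (fun i => B (e i)) (fun i => B (J (e i)))
  have hself : ∀ (τ : V [⋀^Fin 2]→L[ℝ] ℝ) (u : V), τ ![u, u] = 0 := fun τ u => by
    have := form_two_swap τ u u; linarith
  -- If `y` kills all frame terms that involve an index other than `i`, only the plane of `e i` and
  -- `J (e i)` contributes. Its two orderings give equal terms, which the factor `1 / 2` in
  -- `expandTwo` makes into one.
  have hdiag : ∀ (τ : V [⋀^Fin 2]→L[ℝ] ℝ) (i : Fin (N + 2)) (y : Subalgebra.center ℝ (Ext V)),
      (∀ r s : Fin (N + 2) × Bool, (r.1 ≠ i ∨ s.1 ≠ i) →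
        y * (τ ![realFrame J e r, realFrame J e s] •
          cen (B (realFrame J e r)) (B (realFrame J e s))) = 0) →
      y * expandTwo B J e τ = τ ![e i, J (e i)] • (y * x i) := by
    intro τ i y hy
    rw [expandTwo, mul_smul_comm, Finset.mul_sum, Fintype.sum_prod_type,
      Finset.sum_eq_single i]
    · have h1 : ∀ b : Bool, y * ∑ s, τ ![realFrame J e (i, b), realFrame J e s] •
          cen (B (realFrame J e (i, b))) (B (realFrame J e s)) =
          τ ![e i, J (e i)] • (y * x i) := by
        intro b
        rw [Finset.mul_sum, Fintype.sum_prod_type, Finset.sum_eq_single i]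
        · cases b
          · simp [realFrame, hself, cen_self, hx]
          · simp only [Fintype.sum_bool, realFrame, if_true, hself, cen_self, smul_zero,
              mul_zero, zero_add, Bool.false_eq_true, if_false]
            rw [form_two_swap, cen_swap, smul_smul, mul_neg_one, neg_neg, mul_smul_comm]
        · intro j _ hj
          exact Finset.sum_eq_zero fun c _ => hy _ _ (Or.inr hj)
        · simp
      rw [Fintype.sum_bool, h1, h1, ← add_smul, smul_smul]
      congr 1; ring
    · intro j _ hj
      refine Finset.sum_eq_zero fun c _ => ?_
      rw [Finset.mul_sum]
      exact Finset.sum_eq_zero fun s _ => hy _ _ (Or.inl hj)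
    · simp
  have hs : expandTwo B J e σ = σ ![e 0, J (e 0)] • x 0 := by
    have h1 := hdiag σ 0 1 ?_
    · rwa [one_mul, one_mul] at h1
    · intro r s hrs
      have h2 : ∀ r : Fin (N + 2) × Bool, r.1 ≠ 0 → ∀ v, σ ![realFrame J e r, v] = 0 := by
        rintro ⟨i, b⟩ hi v
        cases b
        · exact (hσ i hi v).1
        · exact (hσ i hi v).2
      rcases hrs with h3 | h3
      · rw [h2 r h3, zero_smul, mul_zero]
      · rw [form_two_swap, h2 s h3, neg_zero, zero_smul, mul_zero]
  -- The product of the `x i` with `i ≠ j` contains every frame covector of index other than `j`, so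
  -- only the diagonal coefficient of `α` at `j` survives.
  have hw : ∀ j, (∏ i ∈ Finset.univ.erase j, x i) * expandTwo B J e α =
      α ![e j, J (e j)] • P := by
    intro j
    rw [hdiag α j, mul_comm, hP, Finset.mul_prod_erase _ _ (Finset.mem_univ j)]
    intro r s hrs
    have h1 : ∀ i c, i ≠ j → x i * c = 0 → (∏ i ∈ Finset.univ.erase j, x i) * c = 0 := by
      intro i c hi hc
      rw [← Finset.prod_erase_mul _ _ (Finset.mem_erase.2 ⟨hi, Finset.mem_univ i⟩), mul_assoc, hc,
        mul_zero]
    have h2 : ∀ (r : Fin (N + 2) × Bool) c, x r.1 * cen (B (realFrame J e r)) c = 0 := by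
      rintro ⟨i, b⟩ c
      cases b
      · exact cen_mul_cen_left _ _ _
      · exact cen_mul_cen_right _ _ _
    rw [mul_smul_comm]
    rcases hrs with h3 | h3
    · rw [h1 _ _ h3 (h2 r _), smul_zero]
    · rw [h1 _ _ h3 (by rw [cen_swap, mul_smul_comm, h2 s, smul_zero]), smul_zero]
  -- `σ` is a multiple of `x 0`, so `x 0` may be dropped from the sum in the power. There remain `N
  -- + 1` indices for `N` factors, and each product omits exactly one `j ≠ 0`.
  have hpow : x 0 * (∑ i, x i) ^ N =
      N.factorial • ∑ j ∈ Finset.univ.erase 0, ∏ i ∈ Finset.univ.erase j, x i := by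
    have h1 : ∀ k : ℕ, x 0 * (∑ i, x i) ^ k = x 0 * (∑ i ∈ Finset.univ.erase 0, x i) ^ k := by
      intro k
      induction k with
      | zero => rw [pow_zero, pow_zero]
      | succ k ih =>
        rw [pow_succ, ← mul_assoc, ih, ← Finset.add_sum_erase _ _ (Finset.mem_univ (0 : Fin (N + 2))),
          mul_add, mul_right_comm, hx0, zero_mul, zero_add, mul_assoc, ← pow_succ]
    rw [h1, sum_pow_pred_of_sq_zero hx0 (k := N) (by simp [Finset.card_erase_of_mem]),
      mul_smul_comm, Finset.mul_sum]
    congr 1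
    refine Finset.sum_congr rfl fun j hj => ?_
    rw [Finset.erase_right_comm, Finset.mul_prod_erase]
    exact Finset.mem_erase.2 ⟨(Finset.ne_of_mem_erase hj).symm, Finset.mem_univ _⟩
  have htop : (∑ i, x i) ^ (N + 2) = (N + 2).factorial • P := by
    have := sum_pow_card_of_sq_zero hx0 (Finset.univ : Finset (Fin (N + 2)))
    rwa [Finset.card_univ, Fintype.card_fin] at this
  have hkey : (∑ i, x i) ^ N * expandTwo B J e α * expandTwo B J e σ =
      (σ ![e 0, J (e 0)] * (N.factorial / (N + 2).factorial) *
        ∑ j ∈ Finset.univ.erase 0, α ![e j, J (e j)]) • (∑ i, x i) ^ (N + 2) := by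
    rw [hs, mul_smul_comm, mul_comm _ (x 0), ← mul_assoc, hpow, htop, smul_mul_assoc,
      Finset.sum_mul]
    simp_rw [hw]
    rw [← Finset.sum_smul, ← Nat.cast_smul_eq_nsmul ℝ, ← Nat.cast_smul_eq_nsmul ℝ, smul_smul,
      smul_smul, smul_smul]
    congr 1
    have : ((N + 2).factorial : ℝ) ≠ 0 := by exact_mod_cast Nat.factorial_ne_zero _
    field_simp
  have hα' := toForm_expandTwo h he hn α
  have hσ' := toForm_expandTwo h he hn σ
  have e1 := toForm_mul (mul_mem_ext (pow_mem_ext hmem N) (expandTwo_mem (B := B) (J := J) e α))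
    (expandTwo_mem (B := B) (J := J) e σ)
  rw [toForm_mul (pow_mem_ext hmem N) (expandTwo_mem e α), toForm_pow hmem, hα', hσ'] at e1
  have e2 := congrArg (fun z : Subalgebra.center ℝ (Ext V) => toForm (2 * N + 2 + 2) (z : Ext V)) hkey
  refine Eq.trans ?_ (e2.trans ?_)
  · rw [← hη']
    exact e1.symm
  · rw [← hη', ← toForm_coe_pow hmem]
    exact _root_.map_smul (toForm (2 * N + 2 + 2)) _ _

end Unitary

end CalabiGray

namespace CalabiGray

/-! ### Positivity of the twistor form -/

section Positivity

variable {V : Type*} [TopologicalSpace V] [AddCommGroup V] [Module ℝ V] [FiniteDimensional ℝ V]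
  {B : V →L[ℝ] V →L[ℝ] ℝ} {J : V →L[ℝ] V}

theorem IsHermitianInner.exists_riesz (h : IsHermitianInner B J) (l : V →L[ℝ] ℝ) :
    ∃ r, ∀ v, B r v = l v := by
  let T : V →ₗ[ℝ] Module.Dual ℝ V :=
    { toFun := fun r => (B r).toLinearMap
      map_add' := fun a b => by ext v; simp
      map_smul' := fun a b => by ext v; simp }
  have hT : Function.Injective T := by
    rw [injective_iff_map_eq_zero]
    intro r hr
    by_contra h0
    exact (h.pos r h0).ne' (LinearMap.congr_fun hr r)
  obtain ⟨r, hr⟩ := (LinearMap.injective_iff_surjective_of_finrank_eq_finrank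
    (Subspace.dual_finrank_eq (K := ℝ) (V := V)).symm).1 hT l.toLinearMap
  exact ⟨r, fun v => LinearMap.congr_fun hr v⟩

/-- Two vectors of the plane `u⊥` one of which is orthogonal to the other and to its rotation. -/
theorem eq_zero_of_orthogonal {u w c : Fin 3 → ℝ} (hu : u 0 ^ 2 + u 1 ^ 2 + u 2 ^ 2 = 1)
    (huw : u 0 * w 0 + u 1 * w 1 + u 2 * w 2 = 0) (huc : u 0 * c 0 + u 1 * c 1 + u 2 * c 2 = 0)
    (hwc : w 0 * c 0 + w 1 * c 1 + w 2 * c 2 = 0)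
    (hw : w 0 * (u 1 * c 2 - u 2 * c 1) + w 1 * (u 2 * c 0 - u 0 * c 2) +
      w 2 * (u 0 * c 1 - u 1 * c 0) = 0) (hw0 : w ≠ 0) (i : Fin 3) : c i = 0 := by
  -- Lagrange's identity `|w|² |c|² = (w · c)² + |w × c|²`. Since `w` and `c` are orthogonal to the
  -- unit vector `u`, `w × c` is a multiple of `u` with coefficient `u · (w × c)`, which is up to
  -- sign the quantity in `hw`.
  have key : (w 0 ^ 2 + w 1 ^ 2 + w 2 ^ 2) * (c 0 ^ 2 + c 1 ^ 2 + c 2 ^ 2) = 0 := by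
    linear_combination (-(w 0 ^ 2 + w 1 ^ 2 + w 2 ^ 2) * (c 0 ^ 2 + c 1 ^ 2 + c 2 ^ 2)) * hu +
      (w 0 * (u 1 * c 2 - u 2 * c 1) + w 1 * (u 2 * c 0 - u 0 * c 2) +
        w 2 * (u 0 * c 1 - u 1 * c 0)) * hw +
      (u 0 ^ 2 + u 1 ^ 2 + u 2 ^ 2) * (w 0 * c 0 + w 1 * c 1 + w 2 * c 2) * hwc +
      ((u 0 * w 0 + u 1 * w 1 + u 2 * w 2) * (c 0 ^ 2 + c 1 ^ 2 + c 2 ^ 2) -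
        2 * (u 0 * c 0 + u 1 * c 1 + u 2 * c 2) * (w 0 * c 0 + w 1 * c 1 + w 2 * c 2)) * huw +
      (u 0 * c 0 + u 1 * c 1 + u 2 * c 2) * (w 0 ^ 2 + w 1 ^ 2 + w 2 ^ 2) * huc
  have hW : w 0 ^ 2 + w 1 ^ 2 + w 2 ^ 2 ≠ 0 := by
    intro h0
    refine hw0 (funext fun j => ?_)
    have h1 : w j ^ 2 = 0 := by
      fin_cases j <;> simp only [Fin.zero_eta, Fin.mk_one, Fin.reduceFinMk] <;>
        nlinarith [sq_nonneg (w 0), sq_nonneg (w 1), sq_nonneg (w 2)]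
    simpa using h1
  have hC : c 0 ^ 2 + c 1 ^ 2 + c 2 ^ 2 = 0 := (mul_eq_zero.1 key).resolve_left hW
  have h1 : c i ^ 2 = 0 := by
    fin_cases i <;> simp only [Fin.zero_eta, Fin.mk_one, Fin.reduceFinMk] <;>
      nlinarith [sq_nonneg (c 0), sq_nonneg (c 1), sq_nonneg (c 2)]
  simpa using h1

/-- Let `D` be a linear map to the tangent plane of the sphere at `u` that intertwines `J` with
the rotation `w ↦ u × w`, and let `σ` be the pullback of the area form. If `α` is a
non-negative `(1, 1)`-form, `η ^ N ∧ α ∧ σ` is a non-negative multiple of `η ^ (N + 2)`. -/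
theorem exists_nonneg_wedge_wedge (h : IsHermitianInner B J) {N : ℕ}
    (hn : Module.finrank ℝ V = 2 * (N + 2)) {η α σ : V [⋀^Fin 2]→L[ℝ] ℝ}
    (hη : ∀ u v, η ![u, v] = B (J u) v) (hα : ∀ v, 0 ≤ α ![v, J v])
    {W : Type*} [AddCommGroup W] [Module ℝ W] (pr : V →ₗ[ℝ] W)
    (hpr : ∀ v, α ![v, J v] = 0 → pr v = 0) {u : Fin 3 → ℝ} {D : Fin 3 → V →L[ℝ] ℝ}
    (hu : u 0 ^ 2 + u 1 ^ 2 + u 2 ^ 2 = 1)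
    (huD : ∀ v, u 0 * D 0 v + u 1 * D 1 v + u 2 * D 2 v = 0)
    (hD0 : ∀ v, D 0 (J v) = u 1 * D 2 v - u 2 * D 1 v)
    (hD1 : ∀ v, D 1 (J v) = u 2 * D 0 v - u 0 * D 2 v)
    (hD2 : ∀ v, D 2 (J v) = u 0 * D 1 v - u 1 * D 0 v)
    (hσ : ∀ v w, σ ![v, w] = u 0 * (D 1 v * D 2 w - D 2 v * D 1 w) +
      u 1 * (D 2 v * D 0 w - D 0 v * D 2 w) + u 2 * (D 0 v * D 1 w - D 1 v * D 0 w)) :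
    ∃ f : ℝ, 0 ≤ f ∧ ((∃ i v, D i v ≠ 0) → (∃ v, (∀ i, D i v = 0) ∧ pr v ≠ 0) → f ≠ 0) ∧
      wedge (wedge (wedgePow η N) α) σ = f • wedgePow η (N + 2) := by
  by_cases hD : ∃ i v, D i v ≠ 0
  swap
  · push Not at hD
    refine ⟨0, le_rfl, fun ⟨i, v, hv⟩ => absurd (hD i v) hv, ?_⟩
    rw [show σ = 0 from form_two_ext fun v w => by rw [hσ]; simp [hD], wedge_zero_right]
    exact (zero_smul ℝ _).symm
  obtain ⟨i₀, v₀, hv₀⟩ := hD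
  -- `w` is a nonzero value of `D`, and `r` below represents `v ↦ w · D v`. As `D` is complex linear
  -- with values in a plane, `r` and `J r` span the orthogonal complement of its kernel. In a
  -- unitary frame starting with `r / |r|` all other vectors lie in the kernel, so `σ` involves only
  -- the first one.
  set w : Fin 3 → ℝ := fun i => D i v₀ with hw
  have hw0 : w ≠ 0 := fun h0 => hv₀ (congrFun h0 i₀)
  obtain ⟨r, hr⟩ := h.exists_riesz (w 0 • D 0 + w 1 • D 1 + w 2 • D 2)
  have hr' : ∀ v, B r v = w 0 * D 0 v + w 1 * D 1 v + w 2 * D 2 v := fun v => by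
    rw [hr]; rfl
  have hr0 : r ≠ 0 := by
    rintro rfl
    have h1 := hr' v₀
    have h2 : w i₀ ^ 2 = 0 := by
      simp only [map_zero, zero_apply] at h1
      change 0 = w 0 * w 0 + w 1 * w 1 + w 2 * w 2 at h1
      fin_cases i₀ <;> simp only [Fin.zero_eta, Fin.mk_one, Fin.reduceFinMk] <;>
        nlinarith [sq_nonneg (w 0), sq_nonneg (w 1), sq_nonneg (w 2)]
    exact hv₀ (by simpa using h2)
  have hp := h.pos r hr0
  set t : ℝ := (Real.sqrt (B r r))⁻¹ with ht
  have ht0 : 0 < t := inv_pos.2 (Real.sqrt_pos.2 hp)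
  have he₀ : B (t • r) (t • r) = 1 := by
    have h1 : Real.sqrt (B r r) * Real.sqrt (B r r) = B r r := Real.mul_self_sqrt hp.le
    have h2 : Real.sqrt (B r r) ≠ 0 := (Real.sqrt_pos.2 hp).ne'
    simp only [map_smul, smul_apply, smul_eq_mul]
    rw [ht]; field_simp; rw [pow_two, h1]
  obtain ⟨e, he, he0⟩ := exists_unitary_extension h he₀ (N + 1) (by omega)
  -- The two conditions say that `D v` is orthogonal to `w` and that `u × D v = D (J v)` is too; in
  -- the tangent plane this forces `D v = 0`.
  have hker : ∀ v, B r v = 0 → B r (J v) = 0 → ∀ i, D i v = 0 := by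
    intro v h1 h2 i
    rw [hr'] at h1 h2
    rw [hD0, hD1, hD2] at h2
    exact eq_zero_of_orthogonal (c := fun i => D i v) hu (huD v₀) (huD v) h1 h2 hw0 i
  have hkerJ : ∀ v, (∀ i, D i v = 0) → ∀ i, D i (J v) = 0 := by
    intro v hv i
    fin_cases i <;> simp [hD0, hD1, hD2, hv]
  have hBr : ∀ v, B (e 0) v = t * B r v := fun v => by rw [he0, map_smul]; rfl
  have hDe : ∀ i ≠ 0, ∀ j, D j (e i) = 0 := by
    intro i hi j
    refine hker _ ?_ ?_ j
    · have h1 := he.inner 0 i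
      rw [hBr, if_neg hi.symm] at h1
      exact (mul_eq_zero.1 h1).resolve_left ht0.ne'
    · have h1 := he.inner_J 0 i
      rw [hBr] at h1
      exact (mul_eq_zero.1 h1).resolve_left ht0.ne'
  -- `σ(e, J e) = u · (D e × (u × D e))`, which is `|D e|²` because `D e` is orthogonal to the unit
  -- vector `u`.
  have hσe : σ ![e 0, J (e 0)] = D 0 (e 0) ^ 2 + D 1 (e 0) ^ 2 + D 2 (e 0) ^ 2 := by
    rw [hσ, hD0, hD1, hD2]
    linear_combination (D 0 (e 0) ^ 2 + D 1 (e 0) ^ 2 + D 2 (e 0) ^ 2) * hu -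
      (u 0 * D 0 (e 0) + u 1 * D 1 (e 0) + u 2 * D 2 (e 0)) * huD (e 0)
  refine ⟨_, ?_, ?_, wedge_wedge_unitary h he hn hη fun i hi v => ⟨?_, ?_⟩⟩
  · rw [hσe]
    have : 0 ≤ ∑ j ∈ Finset.univ.erase 0, α ![e j, J (e j)] :=
      Finset.sum_nonneg fun j _ => hα _
    positivity
  · rintro - ⟨v, hv, hpv⟩
    refine mul_ne_zero (mul_ne_zero ?_ ?_) ?_
    · rw [hσe]
      intro h0
      have h1 : B (e 0) (e 0) = 1 := by rw [he.inner, if_pos rfl]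
      rw [hBr, hr'] at h1
      have h2 : D 0 (e 0) = 0 := by nlinarith [sq_nonneg (D 0 (e 0)), sq_nonneg (D 1 (e 0)), sq_nonneg (D 2 (e 0))]
      have h3 : D 1 (e 0) = 0 := by nlinarith [sq_nonneg (D 0 (e 0)), sq_nonneg (D 1 (e 0)), sq_nonneg (D 2 (e 0))]
      have h4 : D 2 (e 0) = 0 := by nlinarith [sq_nonneg (D 0 (e 0)), sq_nonneg (D 1 (e 0)), sq_nonneg (D 2 (e 0))]
      rw [h2, h3, h4] at h1
      simp at h1
    · exact div_ne_zero (by exact_mod_cast Nat.factorial_ne_zero _)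
        (by exact_mod_cast Nat.factorial_ne_zero _)
    · intro h0
      rw [Finset.sum_eq_zero_iff_of_nonneg fun j _ => hα _] at h0
      -- If the sum vanished, `pr` would kill `e j` and `J (e j)` for all `j ≠ 0`. A vector in the
      -- kernel of `D` has no components along `e 0` and `J (e 0)`, so `pr` would kill it as well.
      have h1 : ∀ j ≠ 0, pr (e j) = 0 := fun j hj =>
        hpr _ (h0 j (Finset.mem_erase.2 ⟨hj, Finset.mem_univ _⟩))
      have h2 : ∀ j ≠ 0, pr (J (e j)) = 0 := fun j hj => by
        refine hpr _ ?_
        rw [h.sq]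
        have h3 : α ![J (e j), -e j] = α ![e j, J (e j)] := by
          have := form_two_sum_left α {()} (fun _ => -1) (fun _ => e j) (J (e j))
          simp only [Finset.sum_singleton, neg_smul, one_smul, neg_mul, one_mul] at this
          rw [form_two_swap, this, neg_neg]
        rw [h3]
        exact h0 j (Finset.mem_erase.2 ⟨hj, Finset.mem_univ _⟩)
      refine hpv ?_
      rw [he.expand h hn v, _root_.map_sum]
      refine Finset.sum_eq_zero ?_
      rintro ⟨j, b⟩ -
      rw [map_smul]
      by_cases hj : j = 0
      · subst hj
        have h3 : B (realFrame J e (0, b)) v = 0 := by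
          have h4 : ∀ v, (∀ i, D i v = 0) → B (e 0) v = 0 := fun v hv => by
            rw [hBr, hr']; simp [hv]
          cases b
          · exact h4 v hv
          · change B (J (e 0)) v = 0
            have h5 := h.inner_J (e 0) v
            rw [h4 _ (hkerJ v hv)] at h5
            linarith
        rw [h3, zero_smul]
      · cases b
        · rw [show realFrame J e (j, false) = e j from rfl, h1 j hj, smul_zero]
        · rw [show realFrame J e (j, true) = J (e j) from rfl, h2 j hj, smul_zero]
  · rw [hσ]; simp [hDe i hi]
  · rw [hσ]; simp [hkerJ _ (hDe i hi)]

end Positivity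

/-! ### Forms of top degree. -/

section TopForms

variable {V : Type*} [NormedAddCommGroup V] [NormedSpace ℝ V] [FiniteDimensional ℝ V]

/-- A complex structure acts trivially on forms of top degree. -/
theorem top_form_comp {n : ℕ} (hn : Module.finrank ℝ V = n) (α : V [⋀^Fin n]→L[ℝ] ℝ)
    {J : V →L[ℝ] V} (hJ : ∀ v, J (J v) = -v) : α.compContinuousLinearMap J = α := by
  have b := Module.finBasisOfFinrankEq ℝ V hn
  have h1 := apply_basis_comp b α J
  have h2 : LinearMap.det (J : V →ₗ[ℝ] V) = 1 := det_eq_one_of_sq_eq_neg_one _ hJ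
  rw [← sub_eq_zero, ← apply_basis_eq_zero_iff b]
  change α.compContinuousLinearMap J b - α b = 0
  rw [h1, sub_eq_zero]
  change LinearMap.det (J : V →ₗ[ℝ] V) * _ = _
  rw [h2, one_mul]

theorem form_eq_zero_of_finrank_lt {n : ℕ} (hn : Module.finrank ℝ V < n) (α : V [⋀^Fin n]→L[ℝ] ℝ) :
    α = 0 := by
  ext v
  refine α.toAlternatingMap.map_linearDependent v fun h => ?_
  have := h.fintype_card_le_finrank
  rw [Fintype.card_fin] at this
  omega

end TopForms

end CalabiGray

namespace CalabiGray

/-! ### Metrics and complex structures in charts -/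

section Charts

variable {E : Type*} [NormedAddCommGroup E] [NormedSpace ℝ E] {H : Type*} [TopologicalSpace H]
  (I : ModelWithCorners ℝ E H) {N : Type*} [TopologicalSpace N] [ChartedSpace H N]

/-- A field of endomorphisms of the tangent spaces. -/
abbrev EndField (I : ModelWithCorners ℝ E H) (N : Type*) [TopologicalSpace N] [ChartedSpace H N] :=
  ∀ x : N, TangentSpace I x →L[ℝ] TangentSpace I x

/-- A field of bilinear forms on the tangent spaces. -/
abbrev BilinField (I : ModelWithCorners ℝ E H) (N : Type*) [TopologicalSpace N]
    [ChartedSpace H N] :=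
  ∀ x : N, TangentSpace I x →L[ℝ] TangentSpace I x →L[ℝ] ℝ

/-- The value of a field of endomorphisms, on the model space. -/
def modelEnd (A : EndField I N) (x : N) : E →L[ℝ] E := A x

/-- The value of a field of bilinear forms, on the model space. -/
def modelBilin (g : BilinField I N) (x : N) : E →L[ℝ] E →L[ℝ] ℝ := g x

/-- A field of endomorphisms read in the preferred chart at `x`. -/
def endRep (A : EndField I N) (x : N) (z : E) : E →L[ℝ] E :=
  (chartJacInv I x z).comp ((modelEnd I A ((extChartAt I x).symm z)).comp (chartJac I x z))

/-- A field of bilinear forms read in the preferred chart at `x`. -/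
def bilinRep (g : BilinField I N) (x : N) (z : E) : E →L[ℝ] E →L[ℝ] ℝ :=
  (modelBilin I g ((extChartAt I x).symm z)).bilinearComp (chartJac I x z) (chartJac I x z)

variable [I.Boundaryless] [IsManifold I ∞ N]

/-- Smoothness of bundle sections is expressed by trivialisations, computations with forms by
`chartJac`. This lemma and the next translate between the two. -/
theorem symmL_eq_chartJac {x : N} {z : E} (hz : z ∈ (extChartAt I x).target) (v : E) :
    (trivializationAt E (TangentSpace I) x).symmL ℝ ((extChartAt I x).symm z) v =
      chartJac I x z v := by
  have : IsManifold I 1 N := IsManifold.of_le (n := ∞) (by simp)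
  have h1 : (extChartAt I x).symm z ∈ (chartAt H x).source := by
    rw [← extChartAt_source I]; exact (extChartAt I x).map_target hz
  rw [TangentBundle.symmL_trivializationAt h1, (extChartAt I x).right_inv hz,
    mfderivWithin_symm_eq I hz]
  rfl

theorem continuousLinearMapAt_eq_chartJacInv {x : N} {z : E} (hz : z ∈ (extChartAt I x).target)
    (v : E) :
    (trivializationAt E (TangentSpace I) x).continuousLinearMapAt ℝ ((extChartAt I x).symm z) v =
      chartJacInv I x z v := by
  have h1 : (extChartAt I x).symm z ∈ (trivializationAt E (TangentSpace I) x).baseSet := by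
    rw [TangentBundle.trivializationAt_baseSet, ← extChartAt_source I]
    exact (extChartAt I x).map_target hz
  have h2 : v = chartJac I x z (chartJacInv I x z v) :=
    (DFunLike.congr_fun (chartJac_comp I hz) v).symm
  conv_lhs => rw [h2]
  rw [← symmL_eq_chartJac I hz]
  exact Trivialization.continuousLinearMapAt_symmL _ h1 _

omit [I.Boundaryless] in
theorem contMDiff_section_iff {F' : Type*} [NormedAddCommGroup F'] [NormedSpace ℝ F']
    {f : N → F'} {s : Set N} (hs : IsOpen s) {x : N} (hx : s = (extChartAt I x).source) :
    ContMDiffOn I 𝓘(ℝ, F') ∞ f s ↔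
      ContDiffOn ℝ ∞ (fun z => f ((extChartAt I x).symm z)) (extChartAt I x).target := by
  subst hx
  rw [← contMDiffOn_iff_contDiffOn]
  constructor
  · intro h
    exact h.comp (contMDiffOn_extChartAt_symm x) fun z hz => (extChartAt I x).map_target hz
  · intro h
    rw [extChartAt_source]
    refine (h.comp (contMDiffOn_extChartAt (I := I) (n := ∞) (x := x) (H := H)) ?_).congr ?_
    · intro y hy; exact (extChartAt I x).map_source (by rwa [extChartAt_source])
    · intro y hy
      exact congrArg f ((extChartAt I x).left_inv (by rwa [extChartAt_source])).symm

theorem contDiffOn_endRep {A : EndField I N}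
    (hA : ContMDiff I (I.prod 𝓘(ℝ, E →L[ℝ] E)) ∞ (fun x => TotalSpace.mk' (E →L[ℝ] E)
      (E := fun x : N => TangentSpace I x →L[ℝ] TangentSpace I x) x (A x))) (x : N) :
    ContDiffOn ℝ ∞ (endRep I A x) (extChartAt I x).target := by
  have h1 := ((trivializationAt (E →L[ℝ] E)
    (fun x : N => TangentSpace I x →L[ℝ] TangentSpace I x) x).contMDiffOn_section_baseSet_iff
      (IB := I) (n := ∞) (s := A)).1 hA.contMDiffOn
  have hbase : (trivializationAt (E →L[ℝ] E)
    (fun x : N => TangentSpace I x →L[ℝ] TangentSpace I x) x).baseSet = (extChartAt I x).source := by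
    rw [hom_trivializationAt_baseSet, inter_self, TangentBundle.trivializationAt_baseSet,
      extChartAt_source]
  rw [contMDiff_section_iff I (Trivialization.open_baseSet _) hbase] at h1
  refine h1.congr fun z hz => ?_
  ext v
  rw [hom_trivializationAt_apply]
  refine Eq.trans ?_ (continuousLinearMapAt_eq_chartJacInv I hz _).symm
  exact congrArg (fun w => chartJacInv I x z (modelEnd I A ((extChartAt I x).symm z) w))
    (symmL_eq_chartJac I hz v).symm

-- Both directions are needed: one reads a given metric in charts, the other shows that the product
-- metric is smooth.
set_option synthInstance.maxHeartbeats 400000 in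
set_option maxHeartbeats 1000000 in
theorem contMDiff_bilin_iff {g : BilinField I N} :
    ContMDiff I (I.prod 𝓘(ℝ, E →L[ℝ] E →L[ℝ] ℝ)) ∞ (fun x => TotalSpace.mk' (E →L[ℝ] E →L[ℝ] ℝ)
      (E := fun x : N => TangentSpace I x →L[ℝ] TangentSpace I x →L[ℝ] ℝ) x (g x)) ↔
    ∀ x, ContDiffOn ℝ ∞ (bilinRep I g x) (extChartAt I x).target := by
  have hbase : ∀ x, (trivializationAt (E →L[ℝ] E →L[ℝ] ℝ)
      (fun x : N => TangentSpace I x →L[ℝ] TangentSpace I x →L[ℝ] ℝ) x).baseSet =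
      (extChartAt I x).source := fun x => by
    rw [hom_trivializationAt_baseSet, hom_trivializationAt_baseSet,
      TangentBundle.trivializationAt_baseSet, extChartAt_source]
    simp
  have key : ∀ x, ContMDiffOn I (I.prod 𝓘(ℝ, E →L[ℝ] E →L[ℝ] ℝ)) ∞
      (fun x => TotalSpace.mk' (E →L[ℝ] E →L[ℝ] ℝ)
        (E := fun x : N => TangentSpace I x →L[ℝ] TangentSpace I x →L[ℝ] ℝ) x (g x))
      (extChartAt I x).source ↔
      ContDiffOn ℝ ∞ (bilinRep I g x) (extChartAt I x).target := by
    intro x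
    rw [← hbase x, Bundle.Trivialization.contMDiffOn_section_baseSet_iff
        (F := E →L[ℝ] E →L[ℝ] ℝ) (IB := I) (n := ∞) (s := g)
        (e := trivializationAt (E →L[ℝ] E →L[ℝ] ℝ)
          (fun x : N => TangentSpace I x →L[ℝ] TangentSpace I x →L[ℝ] ℝ) x),
      contMDiff_section_iff I (Trivialization.open_baseSet _) (hbase x)]
    refine contDiffOn_congr fun z hz => ?_
    ext v w
    have h1 : (extChartAt I x).symm z ∈ (trivializationAt E (TangentSpace I) x).baseSet := by
      rw [TangentBundle.trivializationAt_baseSet, ← extChartAt_source I]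
      exact (extChartAt I x).map_target hz
    rw [hom_trivializationAt_apply]
    refine (inCoordinates_apply_eq₂ h1 h1 (mem_univ _)).trans ?_
    have h2 : ∀ v : E, (trivializationAt E (TangentSpace I) x).symm ((extChartAt I x).symm z) v =
        chartJac I x z v := fun v =>
      (Trivialization.symmL_apply _ h1 v).symm.trans (symmL_eq_chartJac I hz v)
    rw [h2, h2]
    simp
    rfl
  constructor
  · intro h x
    exact (key x).1 h.contMDiffOn
  · intro h x
    exact ((key x).2 (h x)).contMDiffAt (extChartAt_source_mem_nhds x)

end Charts

end CalabiGray

namespace CalabiGray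

/-! ### Smoothness of the forms built from metrics and complex structures -/

section Evaluation

variable {E V : Type*} [NormedAddCommGroup E] [NormedSpace ℝ E]
  [NormedAddCommGroup V] [NormedSpace ℝ V] [FiniteDimensional ℝ V] {s : Set E} {k : ℕ}

theorem form_expand {n : Type*} [Fintype n] (b : Module.Basis n ℝ V) (α : V [⋀^Fin k]→L[ℝ] ℝ) :
    α = ∑ f : Fin k → n, α (fun i => b (f i)) •
      ((k.factorial : ℝ)⁻¹ • detForm k fun i => coord b (f i)) := by
  conv_lhs => rw [eq_toForm_basis b α, _root_.map_smul, _root_.map_sum, Finset.smul_sum]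
  refine Finset.sum_congr rfl fun f _ => ?_
  rw [_root_.map_smul, toForm_ιMulti, smul_comm]

/-- In finite dimension `f z` is a combination of fixed forms whose coefficients are the values of
`f z` on basis vectors. -/
theorem contDiffOn_form {f : E → V [⋀^Fin k]→L[ℝ] ℝ}
    (h : ∀ v : Fin k → V, ContDiffOn ℝ ∞ (fun z => f z v) s) : ContDiffOn ℝ ∞ f s := by
  have h1 : f = fun z => ∑ g : Fin k → Fin (Module.finrank ℝ V),
      f z (fun i => Module.finBasis ℝ V (g i)) •
      ((k.factorial : ℝ)⁻¹ • detForm k fun i => coord (Module.finBasis ℝ V) (g i)) :=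
    funext fun z => form_expand _ _
  rw [h1]
  exact ContDiffOn.sum fun g _ => (h _).smul contDiffOn_const

theorem contDiffOn_form_apply {f : E → V [⋀^Fin k]→L[ℝ] ℝ} {w : Fin k → E → V}
    (hf : ContDiffOn ℝ ∞ f s) (hw : ∀ i, ContDiffOn ℝ ∞ (w i) s) :
    ContDiffOn ℝ ∞ (fun z => f z (fun i => w i z)) s := by
  have h1 : (fun z => f z (fun i => w i z)) = fun z => ∑ g : Fin k → Fin (Module.finrank ℝ V),
      f z (fun i => Module.finBasis ℝ V (g i)) * ((k.factorial : ℝ)⁻¹ *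
        ∑ p : Equiv.Perm (Fin k), (p.sign : ℝ) *
          ∏ i, coord (Module.finBasis ℝ V) (g i) (w (p i) z)) := by
    funext z
    conv_lhs => rw [form_expand (Module.finBasis ℝ V) (f z)]
    rw [ContinuousAlternatingMap.sum_apply]
    refine Finset.sum_congr rfl fun g _ => ?_
    rw [ContinuousAlternatingMap.smul_apply, ContinuousAlternatingMap.smul_apply, detForm_apply,
      Matrix.det_apply', smul_eq_mul, smul_eq_mul]
    rfl
  rw [h1]
  have h2 : ∀ v : Fin k → V, ContDiffOn ℝ ∞ (fun z => f z v) s := fun v =>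
    (ContinuousAlternatingMap.apply ℝ V ℝ v).contDiff.comp_contDiffOn hf
  refine ContDiffOn.sum fun g _ => (h2 _).mul (contDiffOn_const.mul (ContDiffOn.sum fun p _ =>
    contDiffOn_const.mul (contDiffOn_prod fun i _ => ?_)))
  exact (coord (Module.finBasis ℝ V) (g i)).contDiff.comp_contDiffOn (hw (p i))

end Evaluation

section Smooth

variable {E : Type*} [NormedAddCommGroup E] [NormedSpace ℝ E] [FiniteDimensional ℝ E]
  {H : Type*} [TopologicalSpace H]
  {I : ModelWithCorners ℝ E H} {N : Type*} [TopologicalSpace N] [ChartedSpace H N]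

variable (I) in
/-- A smooth field of endomorphisms. -/
def IsSmoothEnd (A : EndField I N) : Prop :=
  ∀ x, ContDiffOn ℝ ∞ (endRep I A x) (extChartAt I x).target

variable [I.Boundaryless] [IsManifold I ∞ N]

omit [FiniteDimensional ℝ E] in
theorem chartJac_endRep (A : EndField I N) {x : N} {z : E} (hz : z ∈ (extChartAt I x).target)
    (v : E) : chartJac I x z (endRep I A x z v) =
      modelEnd I A ((extChartAt I x).symm z) (chartJac I x z v) :=
  DFunLike.congr_fun (chartJac_comp I hz) _

theorem IsSmoothForm.cOp {k : ℕ} {α : DForm I N ℝ k} (hα : IsSmoothForm I α)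
    {J : TangentComplexStructure I N} (hJ : IsSmoothEnd I J.toFun) :
    IsSmoothForm I (cOp J α) := by
  intro x
  have h1 : ContDiffOn ℝ ∞ (fun z => (chartRep I α x z).compContinuousLinearMap
      (endRep I J.toFun x z)) (extChartAt I x).target :=
    contDiffOn_form fun v => contDiffOn_form_apply (w := fun i z => endRep I J.toFun x z (v i))
      (hα x) fun i => (hJ x).clm_apply contDiffOn_const
  refine h1.congr fun z hz => ?_
  rw [chartRep_eq I _ hz, chartRep_eq I _ hz]
  ext v
  refine congrArg (modelForm I α ((extChartAt I x).symm z)) (funext fun i => ?_)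
  exact (chartJac_endRep J.toFun hz (v i)).symm

theorem isSmoothForm_fundamentalForm (g : Metric I N) {J : TangentComplexStructure I N}
    (hJ : IsSmoothEnd I J.toFun) (h : IsHermitian g J) : IsSmoothForm I (fundamentalForm g J h) := by
  intro x
  have hg := (contMDiff_bilin_iff I (g := g.inner)).1 g.contMDiff x
  refine contDiffOn_form fun v => ?_
  have h1 : ContDiffOn ℝ ∞ (fun z => bilinRep I g.inner x z (endRep I J.toFun x z (v 0)) (v 1))
      (extChartAt I x).target :=
    (hg.clm_apply ((hJ x).clm_apply contDiffOn_const)).clm_apply contDiffOn_const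
  refine h1.congr fun z hz => ?_
  rw [chartRep_eq I _ hz]
  exact congrArg (fun w => modelBilin I g.inner ((extChartAt I x).symm z) w (chartJac I x z (v 1)))
    (chartJac_endRep J.toFun hz (v 0)).symm

theorem IsComplex.isSmoothEnd {J : TangentComplexStructure I N} (hJ : IsComplex J) :
    IsSmoothEnd I J.toFun := contDiffOn_endRep I hJ.1

end Smooth

/-! ### Product manifolds and pullback by the projections. -/

section Product

variable {E₁ : Type*} [NormedAddCommGroup E₁] [NormedSpace ℝ E₁] {H₁ : Type*} [TopologicalSpace H₁]
  {I₁ : ModelWithCorners ℝ E₁ H₁} {N₁ : Type*} [TopologicalSpace N₁] [ChartedSpace H₁ N₁]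
  [I₁.Boundaryless] [IsManifold I₁ ∞ N₁]
  {E₂ : Type*} [NormedAddCommGroup E₂] [NormedSpace ℝ E₂] {H₂ : Type*} [TopologicalSpace H₂]
  {I₂ : ModelWithCorners ℝ E₂ H₂} {N₂ : Type*} [TopologicalSpace N₂] [ChartedSpace H₂ N₂]
  [I₂.Boundaryless] [IsManifold I₂ ∞ N₂]
  {G : Type*} [NormedAddCommGroup G] [NormedSpace ℝ G]

theorem mem_target_prod {p : N₁ × N₂} {z : E₁ × E₂} :
    z ∈ (extChartAt (I₁.prod I₂) p).target ↔
      z.1 ∈ (extChartAt I₁ p.1).target ∧ z.2 ∈ (extChartAt I₂ p.2).target := by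
  rw [extChartAt_prod]; rfl

theorem symm_prod (p : N₁ × N₂) (z : E₁ × E₂) :
    (extChartAt (I₁.prod I₂) p).symm z =
      ((extChartAt I₁ p.1).symm z.1, (extChartAt I₂ p.2).symm z.2) := by
  rw [extChartAt_prod]; rfl

theorem trans_prod (p q : N₁ × N₂) :
    trans (I₁.prod I₂) p q = Prod.map (trans I₁ p.1 q.1) (trans I₂ p.2 q.2) := by
  funext z
  simp only [trans, extChartAt_prod]
  rfl

theorem mem_transDomain_prod {p q : N₁ × N₂} {z : E₁ × E₂} :
    z ∈ transDomain (I₁.prod I₂) p q ↔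
      z.1 ∈ transDomain I₁ p.1 q.1 ∧ z.2 ∈ transDomain I₂ p.2 q.2 := by
  simp only [transDomain, extChartAt_prod]
  constructor
  · rintro ⟨⟨h1, h2⟩, h3, h4⟩; exact ⟨⟨h1, h3⟩, h2, h4⟩
  · rintro ⟨⟨h1, h3⟩, h2, h4⟩; exact ⟨⟨h1, h2⟩, h3, h4⟩

theorem fderiv_trans_prod {p q : N₁ × N₂} {z : E₁ × E₂} (hz : z ∈ transDomain (I₁.prod I₂) p q) :
    fderiv ℝ (trans (I₁.prod I₂) p q) z =
      (fderiv ℝ (trans I₁ p.1 q.1) z.1).prodMap (fderiv ℝ (trans I₂ p.2 q.2) z.2) := by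
  obtain ⟨h1, h2⟩ := mem_transDomain_prod.1 hz
  rw [trans_prod]
  exact (HasFDerivAt.prodMap z (differentiableAt_trans I₁ h1).hasFDerivAt
    (differentiableAt_trans I₂ h2).hasFDerivAt).fderiv

theorem chartJac_prod {p : N₁ × N₂} {z : E₁ × E₂} (hz : z ∈ (extChartAt (I₁.prod I₂) p).target) :
    chartJac (I₁.prod I₂) p z = (chartJac I₁ p.1 z.1).prodMap (chartJac I₂ p.2 z.2) := by
  rw [chartJac, fderiv_trans_prod (mem_transDomain_self _ hz), symm_prod]
  rfl

theorem chartJacInv_prod {p : N₁ × N₂} {z : E₁ × E₂}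
    (hz : z ∈ (extChartAt (I₁.prod I₂) p).target) :
    chartJacInv (I₁.prod I₂) p z = (chartJacInv I₁ p.1 z.1).prodMap (chartJacInv I₂ p.2 z.2) := by
  rw [chartJacInv, fderiv_trans_prod (trans_mem_transDomain _ (mem_transDomain_self _ hz)),
    trans_prod, symm_prod]
  rfl

/-- The pullback of a form by the first projection. -/
def pullFst (N₂ : Type*) [TopologicalSpace N₂] [ChartedSpace H₂ N₂]
    {k : ℕ} (α : DForm I₁ N₁ G k) : DForm (I₁.prod I₂) (N₁ × N₂) G k := fun p =>
  (modelForm I₁ α p.1).compContinuousLinearMap (ContinuousLinearMap.fst ℝ E₁ E₂)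

/-- The pullback of a form by the second projection. -/
def pullSnd (N₁ : Type*) [TopologicalSpace N₁] [ChartedSpace H₁ N₁]
    {k : ℕ} (α : DForm I₂ N₂ G k) : DForm (I₁.prod I₂) (N₁ × N₂) G k := fun p =>
  (modelForm I₂ α p.2).compContinuousLinearMap (ContinuousLinearMap.snd ℝ E₁ E₂)

theorem chartRep_pullFst {k : ℕ} (α : DForm I₁ N₁ G k) {p : N₁ × N₂} {z : E₁ × E₂}
    (hz : z ∈ (extChartAt (I₁.prod I₂) p).target) :
    chartRep (I₁.prod I₂) (pullFst N₂ α) p z =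
      (chartRep I₁ α p.1 z.1).compContinuousLinearMap (ContinuousLinearMap.fst ℝ E₁ E₂) := by
  rw [chartRep_eq _ _ hz, chartRep_eq I₁ _ (mem_target_prod.1 hz).1, chartJac_prod hz, symm_prod]
  rfl

theorem chartRep_pullSnd {k : ℕ} (α : DForm I₂ N₂ G k) {p : N₁ × N₂} {z : E₁ × E₂}
    (hz : z ∈ (extChartAt (I₁.prod I₂) p).target) :
    chartRep (I₁.prod I₂) (pullSnd N₁ α) p z =
      (chartRep I₂ α p.2 z.2).compContinuousLinearMap (ContinuousLinearMap.snd ℝ E₁ E₂) := by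
  rw [chartRep_eq _ _ hz, chartRep_eq I₂ _ (mem_target_prod.1 hz).2, chartJac_prod hz, symm_prod]
  rfl

theorem IsSmoothForm.pullFst {k : ℕ} {α : DForm I₁ N₁ G k} (hα : IsSmoothForm I₁ α) :
    IsSmoothForm (I₁.prod I₂) (pullFst N₂ α) := fun p =>
  ((show (E₁ [⋀^Fin k]→L[ℝ] G) →L[ℝ] ((E₁ × E₂) [⋀^Fin k]→L[ℝ] G) from
    ContinuousAlternatingMap.compContinuousLinearMapCLM
      (ContinuousLinearMap.fst ℝ E₁ E₂)).contDiff.comp_contDiffOn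
      ((hα p.1).comp contDiffOn_fst fun _ hz => (mem_target_prod.1 hz).1)).congr
    fun _ hz => chartRep_pullFst α hz

theorem IsSmoothForm.pullSnd {k : ℕ} {α : DForm I₂ N₂ G k} (hα : IsSmoothForm I₂ α) :
    IsSmoothForm (I₁.prod I₂) (pullSnd N₁ α) := fun p =>
  ((show (E₂ [⋀^Fin k]→L[ℝ] G) →L[ℝ] ((E₁ × E₂) [⋀^Fin k]→L[ℝ] G) from
    ContinuousAlternatingMap.compContinuousLinearMapCLM
      (ContinuousLinearMap.snd ℝ E₁ E₂)).contDiff.comp_contDiffOn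
      ((hα p.2).comp contDiffOn_snd fun _ hz => (mem_target_prod.1 hz).2)).congr
    fun _ hz => chartRep_pullSnd α hz

theorem d_pullFst {k : ℕ} {α : DForm I₁ N₁ G k} (hα : IsSmoothForm I₁ α) :
    d (I₁.prod I₂) (pullFst N₂ α) = pullFst N₂ (d I₁ α) := by
  funext p
  set c := extChartAt (I₁.prod I₂) p p with hc
  have hct : c ∈ (extChartAt (I₁.prod I₂) p).target := mem_extChartAt_target p
  have h1 : chartRep (I₁.prod I₂) (pullFst N₂ α) p =ᶠ[nhds c] fun z =>
      (chartRep I₁ α p.1 z.1).compContinuousLinearMap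
        (fderiv ℝ (Prod.fst : E₁ × E₂ → E₁) z) := by
    filter_upwards [(isOpen_extChartAt_target p).mem_nhds hct] with z hz
    rw [chartRep_pullFst α hz, fderiv_fst]
  rw [d_eq, h1.extDeriv_eq, extDeriv_pullback (r := ∞) (f := Prod.fst)
    (hα.differentiableAt (mem_target_prod.1 hct).1) contDiffAt_fst
    (by simpa using WithTop.coe_le_coe.2 (le_top : (2 : ℕ∞) ≤ ⊤)), fderiv_fst]
  have h2 : c.1 = extChartAt I₁ p.1 p.1 := by rw [hc, extChartAt_prod]; rfl
  rw [h2, pullFst, modelForm, d_eq]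
  rfl

theorem d_pullSnd {k : ℕ} {α : DForm I₂ N₂ G k} (hα : IsSmoothForm I₂ α) :
    d (I₁.prod I₂) (pullSnd N₁ α) = pullSnd N₁ (d I₂ α) := by
  funext p
  set c := extChartAt (I₁.prod I₂) p p with hc
  have hct : c ∈ (extChartAt (I₁.prod I₂) p).target := mem_extChartAt_target p
  have h1 : chartRep (I₁.prod I₂) (pullSnd N₁ α) p =ᶠ[nhds c] fun z =>
      (chartRep I₂ α p.2 z.2).compContinuousLinearMap
        (fderiv ℝ (Prod.snd : E₁ × E₂ → E₂) z) := by
    filter_upwards [(isOpen_extChartAt_target p).mem_nhds hct] with z hz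
    rw [chartRep_pullSnd α hz, fderiv_snd]
  rw [d_eq, h1.extDeriv_eq, extDeriv_pullback (r := ∞) (f := Prod.snd)
    (hα.differentiableAt (mem_target_prod.1 hct).2) contDiffAt_snd
    (by simpa using WithTop.coe_le_coe.2 (le_top : (2 : ℕ∞) ≤ ⊤)), fderiv_snd]
  have h2 : c.2 = extChartAt I₂ p.2 p.2 := by rw [hc, extChartAt_prod]; rfl
  rw [h2, pullSnd, modelForm, d_eq]
  rfl

end Product

end CalabiGray

namespace CalabiGray

/-! ### The complex structure of a complex manifold in charts -/

section Complex

variable {F : Type*} [NormedAddCommGroup F] [NormedSpace ℂ F]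
  {Y : Type*} [TopologicalSpace Y] [ChartedSpace F Y]

variable (F) in
/-- Multiplication by `i`, as a real linear map. -/
def mulI : F →L[ℝ] F := (Complex.I • ContinuousLinearMap.id ℂ F).restrictScalars ℝ

variable [IsManifold 𝓘(ℂ, F) ω Y]

/-- The holomorphic atlas enters here: coordinate changes are complex differentiable, so their real
derivatives commute with `i`. Hence the complex structure of `Y` is constant in charts. -/
theorem fderiv_trans_mulI {x x' : Y} {z : F} (hz : z ∈ transDomain 𝓘(ℝ, F) x x') (v : F) :
    fderiv ℝ (trans 𝓘(ℝ, F) x x') z (mulI F v) = mulI F (fderiv ℝ (trans 𝓘(ℝ, F) x x') z v) := by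
  have h1 : ContDiffOn ℂ ω (trans 𝓘(ℝ, F) x x') (transDomain 𝓘(ℝ, F) x x') := by
    have := contDiffOn_ext_coord_change (I := 𝓘(ℂ, F)) (n := ω) x' x
    exact this.mono fun z hz => by
      have h2 : z ∈ ((extChartAt 𝓘(ℂ, F) x).symm ≫ extChartAt 𝓘(ℂ, F) x').source := by
        simpa [transDomain] using hz
      simpa using h2
  have h2 : DifferentiableAt ℂ (trans 𝓘(ℝ, F) x x') z :=
    (h1.contDiffAt ((isOpen_transDomain 𝓘(ℝ, F) x x').mem_nhds hz)).differentiableAt (by simp)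
  rw [h2.fderiv_restrictScalars ℝ]
  exact (fderiv ℂ (trans 𝓘(ℝ, F) x x') z).map_smul Complex.I v

theorem endRep_complexStructure {x : Y} {z : F} (hz : z ∈ (extChartAt 𝓘(ℝ, F) x).target) :
    endRep 𝓘(ℝ, F) (complexStructure F Y).toFun x z = mulI F := by
  ext v
  have h1 : endRep 𝓘(ℝ, F) (complexStructure F Y).toFun x z v =
      chartJacInv 𝓘(ℝ, F) x z (mulI F (chartJac 𝓘(ℝ, F) x z v)) := rfl
  rw [h1, chartJac, ← fderiv_trans_mulI (mem_transDomain_self _ hz)]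
  exact DFunLike.congr_fun (chartJacInv_comp 𝓘(ℝ, F) hz) _

end Complex

/-! ### Smoothness of the twisted complex structure. -/

section Twisted

variable {E : Type*} [NormedAddCommGroup E] [NormedSpace ℝ E]
  {M : Type*} [TopologicalSpace M] [ChartedSpace E M] [IsManifold 𝓘(ℝ, E) ∞ M]
  {F : Type*} [NormedAddCommGroup F] [NormedSpace ℂ F]
  {Y : Type*} [TopologicalSpace Y] [ChartedSpace F Y] [IsManifold 𝓘(ℂ, F) ω Y]

/-- The components of a map to the sphere. -/
def comp (φ : Y → Sphere2) (i : Fin 3) (y : Y) : ℝ := (φ y).1 i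

theorem comp_sq (φ : Y → Sphere2) (y : Y) :
    comp φ 0 y ^ 2 + comp φ 1 y ^ 2 + comp φ 2 y ^ 2 = 1 := by
  have h1 : ‖(φ y).1‖ = 1 := by simp
  have h2 := EuclideanSpace.real_norm_sq_eq (φ y).1
  rw [h1, Fin.sum_univ_three] at h2
  simp only [comp]
  linarith

theorem IsHolomorphicToSphere.contMDiff_comp {φ : Y → Sphere2}
    (hφ : IsHolomorphicToSphere (F := F) φ) (i : Fin 3) : ContMDiff 𝓘(ℝ, F) 𝓘(ℝ, ℝ) ∞ (comp φ i) :=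
  (EuclideanSpace.proj (𝕜 := ℝ) i : EuclideanSpace ℝ (Fin 3) →L[ℝ] ℝ).contMDiff.comp hφ.1

/-- The three complex structures of a hyperkähler manifold. -/
def Hyperkahler.cs (h : Hyperkahler 𝓘(ℝ, E) M) : Fin 3 → TangentComplexStructure 𝓘(ℝ, E) M :=
  ![h.I, h.J, h.K]

theorem isSmoothEnd_twisted (h : Hyperkahler 𝓘(ℝ, E) M) {φ : Y → Sphere2}
    (hφ : IsHolomorphicToSphere (F := F) φ) :
    IsSmoothEnd (𝓘(ℝ, E).prod 𝓘(ℝ, F)) (twistedStructure h φ).toFun := by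
  intro p
  have ha : ∀ i, ContDiffOn ℝ ∞ (fun z : E × F => comp φ i ((extChartAt 𝓘(ℝ, F) p.2).symm z.2))
      (extChartAt (𝓘(ℝ, E).prod 𝓘(ℝ, F)) p).target := fun i =>
    (contDiffOn_comp_symm (hφ.contMDiff_comp i) p.2).comp contDiffOn_snd
      fun z hz => (mem_target_prod.1 hz).2
  have hJ : ∀ J : TangentComplexStructure 𝓘(ℝ, E) M, IsComplex J →
      ContDiffOn ℝ ∞ (fun z : E × F => endRep 𝓘(ℝ, E) J.toFun p.1 z.1)
        (extChartAt (𝓘(ℝ, E).prod 𝓘(ℝ, F)) p).target := fun J hJ =>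
    (contDiffOn_endRep 𝓘(ℝ, E) hJ.1 p.1).comp contDiffOn_fst fun z hz => (mem_target_prod.1 hz).1
  let A : E × F → E →L[ℝ] E := fun z =>
    comp φ 0 ((extChartAt 𝓘(ℝ, F) p.2).symm z.2) • endRep 𝓘(ℝ, E) h.I.toFun p.1 z.1 +
    comp φ 1 ((extChartAt 𝓘(ℝ, F) p.2).symm z.2) • endRep 𝓘(ℝ, E) h.J.toFun p.1 z.1 +
    comp φ 2 ((extChartAt 𝓘(ℝ, F) p.2).symm z.2) • endRep 𝓘(ℝ, E) h.K.toFun p.1 z.1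
  have hA : ContDiffOn ℝ ∞ A (extChartAt (𝓘(ℝ, E).prod 𝓘(ℝ, F)) p).target :=
    (((ha 0).smul (hJ _ h.isComplex_I)).add ((ha 1).smul (hJ _ h.isComplex_J))).add
      ((ha 2).smul (hJ _ h.isComplex_K))
  have h1 : ContDiffOn ℝ ∞ (fun z => (ContinuousLinearMap.prodMapL ℝ E E F F) (A z, mulI F))
      (extChartAt (𝓘(ℝ, E).prod 𝓘(ℝ, F)) p).target :=
    (ContinuousLinearMap.prodMapL ℝ E E F F).contDiff.comp_contDiffOn (hA.prodMk contDiffOn_const)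
  refine h1.congr fun z hz => ?_
  have h2 := endRep_complexStructure (mem_target_prod.1 hz).2
  rw [ContinuousLinearMap.prodMapL_apply, ← h2, endRep, chartJac_prod hz, chartJacInv_prod hz,
    symm_prod]
  refine ContinuousLinearMap.ext fun v => Prod.ext ?_ rfl
  change chartJacInv 𝓘(ℝ, E) p.1 z.1 _ = A z v.1
  simp only [A, add_apply, smul_apply]
  refine (map_add _ _ _).trans (congrArg₂ _ ((map_add _ _ _).trans (congrArg₂ _ ?_ ?_)) ?_)
  all_goals exact map_smul _ _ _

end Twisted

end CalabiGray

namespace CalabiGray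

/-! ### Real and imaginary parts of `i ∂ ∂̄` -/

section Push

variable {E : Type*} [NormedAddCommGroup E] [NormedSpace ℝ E] {H : Type*} [TopologicalSpace H]
  {I : ModelWithCorners ℝ E H} {N : Type*} [TopologicalSpace N] [ChartedSpace H N]
  [I.Boundaryless] [IsManifold I ∞ N]
  {G G' : Type*} [NormedAddCommGroup G] [NormedSpace ℝ G] [NormedAddCommGroup G'] [NormedSpace ℝ G']

/-- Composition of the values of a form with a linear map. -/
def push (L : G →L[ℝ] G') {k : ℕ} (α : DForm I N G k) : DForm I N G' k :=
  fun x => L.compContinuousAlternatingMap (α x)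

theorem chartRep_push (L : G →L[ℝ] G') {k : ℕ} (α : DForm I N G k) {x : N} {z : E}
    (hz : z ∈ (extChartAt I x).target) :
    chartRep I (push L α) x z = L.compContinuousAlternatingMap (chartRep I α x z) := by
  rw [chartRep_eq I _ hz, chartRep_eq I _ hz]; rfl

theorem IsSmoothForm.push (L : G →L[ℝ] G') {k : ℕ} {α : DForm I N G k} (hα : IsSmoothForm I α) :
    IsSmoothForm I (push L α) := fun x =>
  ((ContinuousLinearMap.compContinuousAlternatingMapCLM ℝ E G G' (Fin k)
    L).contDiff.comp_contDiffOn (hα x)).congr fun _ hz => chartRep_push L α hz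

theorem d_push (L : G →L[ℝ] G') {k : ℕ} {α : DForm I N G k} (hα : IsSmoothForm I α) :
    d I (push L α) = push L (d I α) := by
  funext x
  have hx := mem_extChartAt_target (I := I) x
  have h : chartRep I (CalabiGray.push L α) x =ᶠ[nhds (extChartAt I x x)]
      fun z => L.compContinuousAlternatingMap (chartRep I α x z) := by
    filter_upwards [(isOpen_extChartAt_target x).mem_nhds hx] with w hw
    exact chartRep_push L α hw
  have h1 := hα.differentiableAt hx
  have h2 : DifferentiableAt ℝ (fun z => L.compContinuousAlternatingMap (chartRep I α x z))
      (extChartAt I x x) := ((hα.push L).differentiableAt hx).congr_of_eventuallyEq h.symm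
  rw [CalabiGray.push, d_eq, h.extDeriv_eq, d_eq]
  ext v
  rw [extDeriv_apply h2]
  refine Eq.trans ?_ (congrArg L (extDeriv_apply h1 v)).symm
  rw [_root_.map_sum]
  refine Finset.sum_congr rfl fun i _ => ?_
  rw [map_zsmul]
  congr 1
  have h3 : DifferentiableAt ℝ (fun z => chartRep I α x z (i.removeNth v)) (extChartAt I x x) :=
    (ContinuousAlternatingMap.apply ℝ E G (i.removeNth v)).differentiableAt.comp _ h1
  exact congrArg (fun T : E →L[ℝ] G' => T (v i)) (L.hasFDerivAt.comp _ h3.hasFDerivAt).fderiv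

variable {J : TangentComplexStructure I N}

theorem cOpInv_push (L : G →L[ℝ] G') {k : ℕ} (α : DForm I N G k) :
    cOpInv J (push L α) = push L (cOpInv J α) := rfl

theorem cOpInv_eq {k : ℕ} (α : DForm I N G k) (x : N) :
    cOpInv J α x = (-1 : ℝ) ^ k • cOp J α x := by
  ext v
  have h1 : (fun i => (-(J x)) (v i)) = fun i => (-1 : ℝ) • J x (v i) := by
    funext i; rw [neg_one_smul]; rfl
  refine (congrArg (α x) h1).trans ?_
  have := (α x).toMultilinearMap.map_smul_univ (fun _ => (-1 : ℝ)) fun i => J x (v i)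
  rw [Finset.prod_const, Finset.card_univ, Fintype.card_fin] at this
  exact this

theorem cOp_cOp {k : ℕ} (α : DForm I N G k) (x : N) :
    cOp J (cOp J α) x = (-1 : ℝ) ^ k • α x := by
  ext v
  have h1 : (fun i => J x (J x (v i))) = fun i => (-1 : ℝ) • v i := by
    funext i; rw [neg_one_smul, J.sq]
  refine (congrArg (α x) h1).trans ?_
  have := (α x).toMultilinearMap.map_smul_univ (fun _ => (-1 : ℝ)) v
  rw [Finset.prod_const, Finset.card_univ, Fintype.card_fin] at this
  exact this

end Push

/-! ### A real equation from `i ∂ ∂̄ β = 0`. -/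

section Astheno

variable {E : Type*} [NormedAddCommGroup E] [NormedSpace ℝ E] [FiniteDimensional ℝ E]
  {H : Type*} [TopologicalSpace H]
  {I : ModelWithCorners ℝ E H} {N : Type*} [TopologicalSpace N] [ChartedSpace H N]
  [I.Boundaryless] [IsManifold I ∞ N] {J : TangentComplexStructure I N}

/-- For a real form `β` of type `(p, p)`, the imaginary part of `∂ ∂̄ β = 0` says that
`d C d β + C⁻¹ d C d β = 0`. -/
theorem dCd_of_iDelDelbar_eq_zero (hJ : IsSmoothEnd I J.toFun) {k : ℕ} {β : DForm I N ℝ (2 * k)}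
    (hβ : IsSmoothForm I β) (hC : cOp J β = β) (h : iDelDelbar J β = 0) (x : N) :
    d I (cOp J (d I β)) x + cOpInv J (d I (cOp J (d I β))) x = 0 := by
  have hdβ := hβ.d
  set μ := cOp J (d I β) with hμ
  have hμs : IsSmoothForm I μ := hdβ.cOp hJ
  let L : ℝ →L[ℝ] ℂ := (1 / 2 : ℝ) • Complex.ofRealCLM
  let L' : ℝ →L[ℝ] ℂ := (1 / 2 : ℝ) • (Complex.I • Complex.ofRealCLM)
  have hodd : (-1 : ℝ) ^ (2 * k + 1) = -1 := by rw [pow_succ, pow_mul]; norm_num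
  -- `∂̄ β = (dβ + i μ) / 2`: the invariance of `β` gives `dᶜβ = C⁻¹ dβ`, which is `-μ` because `dβ`
  -- has odd degree.
  have e1 : delbar J (toComplex β) = fun y => push L (d I β) y + push L' μ y := by
    funext y
    have h1 : d I (toComplex β) = push Complex.ofRealCLM (d I β) := d_push _ hβ
    have h2 : dc J (toComplex β) y = push Complex.ofRealCLM (cOpInv J (d I β)) y := by
      have : cOp J (toComplex β) = toComplex β := by
        change push Complex.ofRealCLM (cOp J β) = _
        rw [hC]; rfl
      rw [dc, this, h1]; rfl
    ext v
    have h3 : cOpInv J (d I β) y v = -μ y v := by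
      rw [cOpInv_eq, hodd, ← hμ]
      simp
    change (1 / 2 : ℂ) • (d I (toComplex β) y v - Complex.I • dc J (toComplex β) y v) = _
    rw [h1, h2]
    change (1 / 2 : ℂ) • ((d I β y v : ℂ) - Complex.I • ((cOpInv J (d I β) y v : ℝ) : ℂ)) =
      (1 / 2 : ℝ) • (d I β y v : ℂ) + (1 / 2 : ℝ) • (Complex.I • (μ y v : ℂ))
    rw [h3]
    simp only [Complex.real_smul, smul_eq_mul]
    push_cast
    ring
  have e2 : d I (delbar J (toComplex β)) x = push L' (d I μ) x := by
    rw [e1, d_add (hdβ.push L) (hμs.push L'), d_push L hdβ, d_push L' hμs, hβ.d_d]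
    have : push L (0 : DForm I N ℝ (2 * k + 1 + 1)) x = 0 := by
      ext v; exact map_zero L
    rw [this, zero_add]
  have e3 : cOp J (delbar J (toComplex β)) = fun y => push L μ y + push (-L') (d I β) y := by
    rw [e1]
    funext y
    ext v
    have h1 : cOp J μ y v = -d I β y v := by
      rw [hμ, cOp_cOp, hodd]; simp
    change L (μ y v) + L' (cOp J μ y v) = L (μ y v) + -(L' (d I β y v))
    rw [h1, map_neg]
  have e4 : d I (cOp J (delbar J (toComplex β))) = push L (d I μ) := by
    funext y
    rw [e3, d_add (hμs.push L) (hdβ.push (-L')), d_push L hμs, d_push (-L') hdβ, hβ.d_d]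
    have : push (-L') (0 : DForm I N ℝ (2 * k + 1 + 1)) y = 0 := by
      ext v; exact map_zero (-L')
    rw [this, add_zero]
  ext v
  have h1 := congrArg (fun α : DForm I N ℂ (2 * k + 2) => α x v) h
  change Complex.I • ((1 / 2 : ℂ) • (d I (delbar J (toComplex β)) x v +
    Complex.I • cOpInv J (d I (cOp J (delbar J (toComplex β)))) x v)) = 0 at h1
  rw [e2, e4, cOpInv_push] at h1
  change Complex.I • ((1 / 2 : ℂ) • ((1 / 2 : ℝ) • (Complex.I • (d I μ x v : ℂ)) +
    Complex.I • ((1 / 2 : ℝ) • ((cOpInv J (d I μ) x v : ℝ) : ℂ)))) = 0 at h1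
  -- The computation has brought `i ∂ ∂̄ β` to the form `-(dμ + C⁻¹ dμ) / 4`, which is real.
  have h2 := congrArg Complex.re h1
  simp at h2
  change d I μ x v + cOpInv J (d I μ) x v = 0
  linarith

end Astheno

end CalabiGray

namespace CalabiGray

/-! ### The obstruction to astheno-Kähler metrics -/

open ExteriorAlgebra

section Rep

variable {E : Type*} [NormedAddCommGroup E] [NormedSpace ℝ E]

/-- The element `y` of the exterior algebra represents the form `α`. -/
structure Rep {k : ℕ} (y : Ext E) (α : E [⋀^Fin k]→L[ℝ] ℝ) : Prop where
  mem : y ∈ ⋀[ℝ]^k (E →L[ℝ] ℝ)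
  eq : toForm k y = α

theorem Rep.wedge {k l : ℕ} {x y : Ext E} {α : E [⋀^Fin k]→L[ℝ] ℝ} {β : E [⋀^Fin l]→L[ℝ] ℝ}
    (hx : Rep x α) (hy : Rep y β) : Rep (x * y) (wedge α β) :=
  ⟨mul_mem_ext hx.mem hy.mem, by rw [toForm_mul hx.mem hy.mem, hx.eq, hy.eq]⟩

theorem Rep.add {k : ℕ} {x y : Ext E} {α β : E [⋀^Fin k]→L[ℝ] ℝ}
    (hx : Rep x α) (hy : Rep y β) : Rep (x + y) (α + β) :=
  ⟨add_mem hx.mem hy.mem, by rw [map_add, hx.eq, hy.eq]⟩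

theorem Rep.sub {k : ℕ} {x y : Ext E} {α β : E [⋀^Fin k]→L[ℝ] ℝ}
    (hx : Rep x α) (hy : Rep y β) : Rep (x - y) (α - β) :=
  ⟨sub_mem hx.mem hy.mem, by rw [map_sub, hx.eq, hy.eq]⟩

theorem Rep.smul {k : ℕ} {x : Ext E} {α : E [⋀^Fin k]→L[ℝ] ℝ} (hx : Rep x α) (c : ℝ) :
    Rep (c • x) (c • α) :=
  ⟨Submodule.smul_mem _ _ hx.mem, by rw [_root_.map_smul, hx.eq]⟩

theorem Rep.pow {x : Ext E} {α : E [⋀^Fin 2]→L[ℝ] ℝ} (hx : Rep x α) (k : ℕ) :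
    Rep (x ^ k) (wedgePow α k) :=
  ⟨pow_mem_ext hx.mem k, by rw [toForm_pow hx.mem, hx.eq]⟩

theorem Rep.comp {E' : Type*} [NormedAddCommGroup E'] [NormedSpace ℝ E'] {k : ℕ} {x : Ext E}
    {α : E [⋀^Fin k]→L[ℝ] ℝ} (hx : Rep x α) (A : E' →L[ℝ] E) :
    Rep (extMap A x) (α.compContinuousLinearMap A) :=
  ⟨extMap_mem A hx.mem, by rw [toForm_extMap A hx.mem, hx.eq]⟩

theorem rep_toForm {k : ℕ} {x : Ext E} (hx : x ∈ ⋀[ℝ]^k (E →L[ℝ] ℝ)) : Rep x (toForm k x) :=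
  ⟨hx, rfl⟩

theorem rep_lift [FiniteDimensional ℝ E] {k : ℕ} (α : E [⋀^Fin k]→L[ℝ] ℝ) : Rep (lift α) α :=
  ⟨lift_mem α, toForm_lift α⟩

theorem rep_zero {k : ℕ} : Rep 0 (0 : E [⋀^Fin k]→L[ℝ] ℝ) := ⟨zero_mem _, map_zero _⟩

end Rep

section Leibniz

variable {E : Type*} [NormedAddCommGroup E] [NormedSpace ℝ E] [FiniteDimensional ℝ E]
  {H : Type*} [TopologicalSpace H]
  {I : ModelWithCorners ℝ E H} {N : Type*} [TopologicalSpace N] [ChartedSpace H N]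
  [I.Boundaryless] [IsManifold I ∞ N]

theorem rep_d_wedge {k l : ℕ} {α : DForm I N ℝ k} {β : DForm I N ℝ l} (hα : IsSmoothForm I α)
    (hβ : IsSmoothForm I β) {x : N} {a a' b b' : Ext E} (ha : Rep a (modelForm I α x))
    (ha' : Rep a' (modelForm I (d I α) x)) (hb : Rep b (modelForm I β x))
    (hb' : Rep b' (modelForm I (d I β) x)) :
    Rep (a' * b + (-1 : ℝ) ^ k • (a * b')) (modelForm I (d I (fun y => wedge (α y) (β y))) x) := by
  refine ⟨add_mem ?_ (Submodule.smul_mem _ _ ?_),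
    (d_wedge hα hβ x ha.mem ha'.mem hb.mem hb'.mem ha.eq ha'.eq hb.eq hb'.eq).symm⟩
  · rw [show k + l + 1 = (k + 1) + l by omega]; exact mul_mem_ext ha'.mem hb.mem
  · exact mul_mem_ext (k := k) (l := l + 1) ha.mem hb'.mem

theorem rep_d_fun_smul {k : ℕ} {α : DForm I N ℝ k} (hα : IsSmoothForm I α) {f : N → ℝ}
    (hf : ContMDiff I 𝓘(ℝ, ℝ) ∞ f) {x : N} {a a' : Ext E} (ha : Rep a (modelForm I α x))
    (ha' : Rep a' (modelForm I (d I α) x)) :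
    Rep (ι ℝ (dFun I f x) * a + f x • a') (modelForm I (d I (fun y => f y • α y)) x) := by
  refine ⟨add_mem (ι_mul_mem _ ha.mem) (Submodule.smul_mem _ _ ha'.mem), ?_⟩
  rw [d_fun_smul hα hf x ha.mem ha.eq, map_add, _root_.map_smul, ha'.eq]

theorem rep_d_add {k : ℕ} {α β : DForm I N ℝ k} (hα : IsSmoothForm I α) (hβ : IsSmoothForm I β)
    {x : N} {a b : Ext E} (ha : Rep a (modelForm I (d I α) x))
    (hb : Rep b (modelForm I (d I β) x)) :
    Rep (a + b) (modelForm I (d I (fun y => α y + β y)) x) := by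
  have : modelForm I (d I (fun y => α y + β y)) x =
    modelForm I (d I α) x + modelForm I (d I β) x := d_add hα hβ x
  rw [this]
  exact ha.add hb

end Leibniz

/-! ### The twistor form and its derivatives. -/

section Twistor

variable {E : Type*} [NormedAddCommGroup E] [NormedSpace ℝ E] [FiniteDimensional ℝ E]
  {H : Type*} [TopologicalSpace H]
  {I : ModelWithCorners ℝ E H} {N : Type*} [TopologicalSpace N] [ChartedSpace H N]

/-- The form `∑ i, a i • w i`. -/
def combine (a : Fin 3 → N → ℝ) (w : Fin 3 → DForm I N ℝ 2) : DForm I N ℝ 2 :=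
  fun x => a 0 x • w 0 x + a 1 x • w 1 x + a 2 x • w 2 x

variable [I.Boundaryless] [IsManifold I ∞ N]

/-- Closed two-forms `w i` and a holomorphic map `a` to the sphere, related like the pullbacks of
the Kähler forms of a hyperkähler manifold to a pullback of its twistor space. -/
structure IsTwistor (J : TangentComplexStructure I N) (a : Fin 3 → N → ℝ)
    (w : Fin 3 → DForm I N ℝ 2) : Prop where
  smooth_J : IsSmoothEnd I J.toFun
  smooth_a : ∀ i, ContMDiff I 𝓘(ℝ, ℝ) ∞ (a i)
  smooth_w : ∀ i, IsSmoothForm I (w i)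
  closed : ∀ i, d I (w i) = 0
  sphere : ∀ x, a 0 x ^ 2 + a 1 x ^ 2 + a 2 x ^ 2 = 1
  hol0 : ∀ x v, dFun I (a 0) x (modelEnd I J.toFun x v) =
    a 1 x * dFun I (a 2) x v - a 2 x * dFun I (a 1) x v
  hol1 : ∀ x v, dFun I (a 1) x (modelEnd I J.toFun x v) =
    a 2 x * dFun I (a 0) x v - a 0 x * dFun I (a 2) x v
  hol2 : ∀ x v, dFun I (a 2) x (modelEnd I J.toFun x v) =
    a 0 x * dFun I (a 1) x v - a 1 x * dFun I (a 0) x v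
  comp_J : ∀ i x, cOp J (w i) x = (2 * a i x) • combine a w x - w i x

variable {J : TangentComplexStructure I N} {a : Fin 3 → N → ℝ} {w : Fin 3 → DForm I N ℝ 2}

theorem IsTwistor.smooth_combine (h : IsTwistor J a w) : IsSmoothForm I (combine a w) :=
  (((h.smooth_w 0).smul (h.smooth_a 0)).add ((h.smooth_w 1).smul (h.smooth_a 1))).add
    ((h.smooth_w 2).smul (h.smooth_a 2))

/-- Weighting `comp_J` by `a i` and summing gives `2 (∑ a i ^ 2) ω - ω`. -/
theorem IsTwistor.cOp_combine (h : IsTwistor J a w) : cOp J (combine a w) = combine a w := by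
  funext x
  have h1 : cOp J (combine a w) x = a 0 x • cOp J (w 0) x + a 1 x • cOp J (w 1) x +
    a 2 x • cOp J (w 2) x := rfl
  rw [h1, h.comp_J, h.comp_J, h.comp_J]
  ext v
  have hs := h.sphere x
  simp only [combine, ContinuousAlternatingMap.add_apply, ContinuousAlternatingMap.sub_apply,
    ContinuousAlternatingMap.smul_apply, smul_eq_mul]
  linear_combination (2 * (a 0 x * w 0 x v + a 1 x * w 1 x v + a 2 x * w 2 x v)) * hs

/-- Instead of differentiating the equation of the sphere, write `v = J u`: holomorphy makes the sum
`a · (a × da(u))`, which is zero. -/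
theorem IsTwistor.tangent (h : IsTwistor J a w) (x : N) (v : E) :
    a 0 x * dFun I (a 0) x v + a 1 x * dFun I (a 1) x v + a 2 x * dFun I (a 2) x v = 0 := by
  obtain ⟨u, rfl⟩ : ∃ u, v = modelEnd I J.toFun x u :=
    ⟨modelEnd I J.toFun x (-v), ((J.sq x (-v)).trans (neg_neg (G := E) v)).symm⟩
  rw [h.hol0, h.hol1, h.hol2]
  ring

/-- The form `∑ i, (a × da) i ∧ w i`, written as a sum of exact forms with coefficients. -/
def rotated (a : Fin 3 → N → ℝ) (w : Fin 3 → DForm I N ℝ 2) : DForm I N ℝ 3 := fun x =>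
  ((a 1 x • d I (fun y => a 2 y • w 0 y) x + (-a 2 x) • d I (fun y => a 1 y • w 0 y) x) +
    (a 2 x • d I (fun y => a 0 y • w 1 y) x + (-a 0 x) • d I (fun y => a 2 y • w 1 y) x)) +
    (a 0 x • d I (fun y => a 1 y • w 2 y) x + (-a 1 x) • d I (fun y => a 0 y • w 2 y) x)

theorem IsTwistor.smooth_rotated (h : IsTwistor J a w) : IsSmoothForm I (rotated a w) := by
  have h1 : ∀ i j k, IsSmoothForm I (fun x => a i x • d I (fun y => a j y • w k y) x) :=
    fun i j k => (((h.smooth_w k).smul (h.smooth_a j)).d).smul (h.smooth_a i)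
  have h2 : ∀ i j k, IsSmoothForm I (fun x => (-a i x) • d I (fun y => a j y • w k y) x) :=
    fun i j k => (((h.smooth_w k).smul (h.smooth_a j)).d).smul (h.smooth_a i).neg
  exact (((h1 1 2 0).add (h2 2 1 0)).add ((h1 2 0 1).add (h2 0 2 1))).add
    ((h1 0 1 2).add (h2 1 0 2))

variable {x : N} {o : Fin 3 → Ext E}

theorem rep_combine (ho : ∀ i, Rep (o i) (modelForm I (w i) x)) :
    Rep (a 0 x • o 0 + a 1 x • o 1 + a 2 x • o 2) (modelForm I (combine a w) x) :=
  (((ho 0).smul _).add ((ho 1).smul _)).add ((ho 2).smul _)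

theorem IsTwistor.rep_d_smul (h : IsTwistor J a w) (ho : ∀ i, Rep (o i) (modelForm I (w i) x))
    (i j : Fin 3) : Rep (ι ℝ (dFun I (a i) x) * o j)
      (modelForm I (d I (fun y => a i y • w j y)) x) := by
  have h0 : Rep (0 : Ext E) (modelForm I (d I (w j)) x) := by
    rw [h.closed j]; exact rep_zero
  have := rep_d_fun_smul (h.smooth_w j) (h.smooth_a i) (ho j) h0
  rwa [smul_zero, add_zero] at this

theorem IsTwistor.rep_d_combine (h : IsTwistor J a w)
    (ho : ∀ i, Rep (o i) (modelForm I (w i) x)) :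
    Rep (ι ℝ (dFun I (a 0) x) * o 0 + ι ℝ (dFun I (a 1) x) * o 1 + ι ℝ (dFun I (a 2) x) * o 2)
      (modelForm I (d I (combine a w)) x) := by
  have hs : ∀ i, IsSmoothForm I (fun y => a i y • w i y) := fun i =>
    (h.smooth_w i).smul (h.smooth_a i)
  exact rep_d_add ((hs 0).add (hs 1)) (hs 2)
    (rep_d_add (hs 0) (hs 1) (h.rep_d_smul ho 0 0) (h.rep_d_smul ho 1 1)) (h.rep_d_smul ho 2 2)

theorem IsTwistor.rep_rotated (h : IsTwistor J a w) (ho : ∀ i, Rep (o i) (modelForm I (w i) x)) :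
    Rep ((a 1 x • (ι ℝ (dFun I (a 2) x) * o 0) + (-a 2 x) • (ι ℝ (dFun I (a 1) x) * o 0)) +
      (a 2 x • (ι ℝ (dFun I (a 0) x) * o 1) + (-a 0 x) • (ι ℝ (dFun I (a 2) x) * o 1)) +
      (a 0 x • (ι ℝ (dFun I (a 1) x) * o 2) + (-a 1 x) • (ι ℝ (dFun I (a 0) x) * o 2)))
      (modelForm I (rotated a w) x) := by
  have h1 := fun i j (c : ℝ) => (h.rep_d_smul ho i j).smul c
  exact (((h1 2 0 _).add (h1 1 0 _)).add ((h1 0 1 _).add (h1 2 1 _))).add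
    ((h1 1 2 _).add (h1 0 2 _))

theorem dFun_neg (f : N → ℝ) (x : N) : dFun I (fun y => -f y) x = -dFun I f x := by
  exact mfderiv_neg (f := f) (x := x)

/-- Each pair `a i d(a j w) - a j d(a i w)` has derivative `2 da i ∧ da j ∧ w`, since the outer `d`
sees only the coefficients. -/
theorem IsTwistor.rep_d_rotated (h : IsTwistor J a w)
    (ho : ∀ i, Rep (o i) (modelForm I (w i) x)) :
    Rep ((2 : ℝ) • (ι ℝ (dFun I (a 1) x) * (ι ℝ (dFun I (a 2) x) * o 0) +
      ι ℝ (dFun I (a 2) x) * (ι ℝ (dFun I (a 0) x) * o 1) +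
      ι ℝ (dFun I (a 0) x) * (ι ℝ (dFun I (a 1) x) * o 2))) (modelForm I (d I (rotated a w)) x) := by
  have hs : ∀ j k, IsSmoothForm I (d I (fun y => a j y • w k y)) := fun j k =>
    ((h.smooth_w k).smul (h.smooth_a j)).d
  have h1 : ∀ (f : N → ℝ), ContMDiff I 𝓘(ℝ, ℝ) ∞ f → ∀ j k,
      Rep (ι ℝ (dFun I f x) * (ι ℝ (dFun I (a j) x) * o k))
        (modelForm I (d I (fun x => f x • d I (fun y => a j y • w k y) x)) x) := by
    intro f hf j k
    have h0 : Rep (0 : Ext E) (modelForm I (d I (d I (fun y => a j y • w k y))) x) := by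
      rw [((h.smooth_w k).smul (h.smooth_a j)).d_d]; exact rep_zero
    have := rep_d_fun_smul (hs j k) hf (h.rep_d_smul ho j k) h0
    rwa [smul_zero, add_zero] at this
  have h2 : ∀ i j k, IsSmoothForm I (fun x => a i x • d I (fun y => a j y • w k y) x) :=
    fun i j k => (hs j k).smul (h.smooth_a i)
  have h3 : ∀ i j k, IsSmoothForm I (fun x => (-a i x) • d I (fun y => a j y • w k y) x) :=
    fun i j k => (hs j k).smul (h.smooth_a i).neg
  have h4 : ∀ i j k, Rep (ι ℝ (dFun I (a i) x) * (ι ℝ (dFun I (a j) x) * o k) +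
      ι ℝ (dFun I (fun y => -a j y) x) * (ι ℝ (dFun I (a i) x) * o k))
      (modelForm I (d I (fun x => a i x • d I (fun y => a j y • w k y) x +
        (-a j x) • d I (fun y => a i y • w k y) x)) x) := fun i j k =>
    rep_d_add (h2 i j k) (h3 j i k) (h1 _ (h.smooth_a i) j k) (h1 _ (h.smooth_a j).neg i k)
  have h5 := rep_d_add (((h2 1 2 0).add (h3 2 1 0)).add ((h2 2 0 1).add (h3 0 2 1)))
    ((h2 0 1 2).add (h3 1 0 2)) (rep_d_add ((h2 1 2 0).add (h3 2 1 0))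
      ((h2 2 0 1).add (h3 0 2 1)) (h4 1 2 0) (h4 2 0 1)) (h4 0 1 2)
  have h6 : ∀ i j k, ι ℝ (dFun I (a i) x) * (ι ℝ (dFun I (a j) x) * o k) +
      ι ℝ (dFun I (fun y => -a j y) x) * (ι ℝ (dFun I (a i) x) * o k) =
      (2 : ℝ) • (ι ℝ (dFun I (a i) x) * (ι ℝ (dFun I (a j) x) * o k)) := by
    intro i j k
    rw [dFun_neg, map_neg, neg_mul, ← mul_assoc (ι ℝ (dFun I (a j) x)),
      ι_swap (dFun I (a j) x), neg_mul, neg_neg, mul_assoc, two_smul]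
  rw [h6, h6, h6, ← smul_add, ← smul_add] at h5
  exact h5

end Twistor

end CalabiGray

namespace CalabiGray

open ExteriorAlgebra

section Area

variable {V : Type*} [TopologicalSpace V] [AddCommGroup V] [Module ℝ V]

/-- The area form of the sphere at `u`, pulled back by `D`, in the exterior algebra. -/
def area (u : Fin 3 → ℝ) (D : Fin 3 → V →L[ℝ] ℝ) : Ext V :=
  u 0 • (ι ℝ (D 1) * ι ℝ (D 2)) + u 1 • (ι ℝ (D 2) * ι ℝ (D 0)) + u 2 • (ι ℝ (D 0) * ι ℝ (D 1))

theorem area_mem (u : Fin 3 → ℝ) (D : Fin 3 → V →L[ℝ] ℝ) : area u D ∈ ⋀[ℝ]^2 (V →L[ℝ] ℝ) :=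
  add_mem (add_mem (Submodule.smul_mem _ _ (ι_mul_ι_mem _ _))
    (Submodule.smul_mem _ _ (ι_mul_ι_mem _ _))) (Submodule.smul_mem _ _ (ι_mul_ι_mem _ _))

theorem toForm_area (u : Fin 3 → ℝ) (D : Fin 3 → V →L[ℝ] ℝ) (v w : V) :
    toForm 2 (area u D) ![v, w] = u 0 * (D 1 v * D 2 w - D 2 v * D 1 w) +
      u 1 * (D 2 v * D 0 w - D 0 v * D 2 w) + u 2 * (D 0 v * D 1 w - D 1 v * D 0 w) := by
  rw [area, map_add, map_add, _root_.map_smul, _root_.map_smul, _root_.map_smul]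
  simp only [ContinuousAlternatingMap.add_apply, ContinuousAlternatingMap.smul_apply, smul_eq_mul,
    toForm_ι_mul_ι, Matrix.cons_val_zero, Matrix.cons_val_one]
  ring

/-- The differentials satisfy `u · D = 0`, so the vector of two-forms with components `D₁ ∧ D₂`, `D₂
∧ D₀`, `D₀ ∧ D₁` is parallel to the unit vector `u`. Its coefficient along `u` is the area form. -/
theorem ι_mul_ι_eq_area {u₀ u₁ u₂ : ℝ} {D₀ D₁ D₂ : V →L[ℝ] ℝ} (hu : u₀ ^ 2 + u₁ ^ 2 + u₂ ^ 2 = 1)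
    (hD : u₀ • D₀ + u₁ • D₁ + u₂ • D₂ = 0) :
    ι ℝ D₁ * ι ℝ D₂ = u₀ • (u₀ • (ι ℝ D₁ * ι ℝ D₂) + u₁ • (ι ℝ D₂ * ι ℝ D₀) +
      u₂ • (ι ℝ D₀ * ι ℝ D₁)) := by
  have h0 : u₀ • ι ℝ D₀ = -(u₁ • ι ℝ D₁) - u₂ • ι ℝ D₂ := by
    have h1 := congrArg (ι ℝ) hD
    rw [map_add, map_add, map_smul, map_smul, map_smul, map_zero] at h1
    rw [← sub_eq_zero, ← h1]
    module
  have h1 : u₀ • (u₀ • (ι ℝ D₁ * ι ℝ D₂) + u₁ • (ι ℝ D₂ * ι ℝ D₀) + u₂ • (ι ℝ D₀ * ι ℝ D₁)) =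
      (u₀ * u₀) • (ι ℝ D₁ * ι ℝ D₂) + u₁ • (ι ℝ D₂ * (u₀ • ι ℝ D₀)) +
      u₂ • ((u₀ • ι ℝ D₀) * ι ℝ D₁) := by
    rw [mul_smul_comm, smul_mul_assoc]
    module
  have h2 : ι ℝ D₁ * ι ℝ D₂ = (u₀ ^ 2 + u₁ ^ 2 + u₂ ^ 2) • (ι ℝ D₁ * ι ℝ D₂) := by
    rw [hu, one_smul]
  rw [h1, h0]
  simp only [mul_sub, sub_mul, mul_neg, neg_mul, mul_smul_comm, smul_mul_assoc, ι_sq_zero,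
    ι_swap D₂ D₁]
  conv_lhs => rw [h2]
  module

end Area

section Obstruction

variable {E : Type*} [NormedAddCommGroup E] [NormedSpace ℝ E] [FiniteDimensional ℝ E]
  {H : Type*} [TopologicalSpace H]
  {I : ModelWithCorners ℝ E H} {N : Type*} [TopologicalSpace N] [ChartedSpace H N]
  [I.Boundaryless] [IsManifold I ∞ N]
  {J : TangentComplexStructure I N} {a : Fin 3 → N → ℝ} {w : Fin 3 → DForm I N ℝ 2}

/-- The differentials of the components of `a`. -/
def dMap (a : Fin 3 → N → ℝ) (x : N) (i : Fin 3) : E →L[ℝ] ℝ := dFun I (a i) x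

/-- Replacing each `da i ∧ da j` by the corresponding multiple of the area form `σ` gives `dP = 2 σ
∧ ω`, that is, the formula for `ddᶜω`. -/
theorem IsTwistor.rep_d_rotated' (h : IsTwistor J a w) {x : N} {o : Fin 3 → Ext E}
    (ho : ∀ i, Rep (o i) (modelForm I (w i) x)) :
    Rep ((2 : ℝ) • (area (fun i => a i x) (dMap (I := I) a x) *
      (a 0 x • o 0 + a 1 x • o 1 + a 2 x • o 2))) (modelForm I (d I (rotated a w)) x) := by
  have h1 := h.rep_d_rotated ho
  have hs := h.sphere x
  have ht : a 0 x • dFun I (a 0) x + a 1 x • dFun I (a 1) x + a 2 x • dFun I (a 2) x = 0 := by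
    ext v; exact h.tangent x v
  have e0 := ι_mul_ι_eq_area hs ht
  have e1 := ι_mul_ι_eq_area (u₀ := a 1 x) (u₁ := a 2 x) (u₂ := a 0 x) (D₀ := dFun I (a 1) x)
    (D₁ := dFun I (a 2) x) (D₂ := dFun I (a 0) x) (by rw [← hs]; ring) (by rw [← ht]; module)
  have e2 := ι_mul_ι_eq_area (u₀ := a 2 x) (u₁ := a 0 x) (u₂ := a 1 x) (D₀ := dFun I (a 2) x)
    (D₁ := dFun I (a 0) x) (D₂ := dFun I (a 1) x) (by rw [← hs]; ring) (by rw [← ht]; module)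
  have key : ι ℝ (dFun I (a 1) x) * (ι ℝ (dFun I (a 2) x) * o 0) +
      ι ℝ (dFun I (a 2) x) * (ι ℝ (dFun I (a 0) x) * o 1) +
      ι ℝ (dFun I (a 0) x) * (ι ℝ (dFun I (a 1) x) * o 2) =
      area (fun i => a i x) (dMap (I := I) a x) * (a 0 x • o 0 + a 1 x • o 1 + a 2 x • o 2) := by
    set S := area (fun i => a i x) (dMap (I := I) a x) with hS
    have e0' : ι ℝ (dFun I (a 1) x) * ι ℝ (dFun I (a 2) x) = a 0 x • S := e0
    have e1' : ι ℝ (dFun I (a 2) x) * ι ℝ (dFun I (a 0) x) = a 1 x • S := by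
      rw [hS, area, add_rotate]; exact e1
    have e2' : ι ℝ (dFun I (a 0) x) * ι ℝ (dFun I (a 1) x) = a 2 x • S := by
      rw [hS, area, ← add_rotate]; exact e2
    rw [← mul_assoc, ← mul_assoc, ← mul_assoc, e0', e1', e2']
    simp only [mul_add, smul_mul_assoc, mul_smul_comm]
  rwa [key] at h1

/-- Pulling `∑ da i ∧ w i` back by `J` gives `∑ (a × da) i ∧ (2 a i ω - w i)`, and the terms with
`ω` cancel because `a · (a × da) = 0`. Thus `rotated a w` is `dᶜω`. -/
theorem IsTwistor.rep_comp_d_combine (h : IsTwistor J a w) {x : N} {o : Fin 3 → Ext E}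
    (ho : ∀ i, Rep (o i) (modelForm I (w i) x)) :
    (modelForm I (d I (combine a w)) x).compContinuousLinearMap (modelEnd I J.toFun x) =
      -modelForm I (rotated a w) x := by
  have hι : ∀ l : E →L[ℝ] ℝ, Rep (ι ℝ l) (toForm 1 (ι ℝ l)) := fun l => rep_toForm (ι_mem l)
  set D := fun i => dFun I (a i) x with hD
  set W := a 0 x • o 0 + a 1 x • o 1 + a 2 x • o 2 with hW
  have h1 : modelForm I (d I (combine a w)) x =
      wedge (toForm 1 (ι ℝ (D 0))) (modelForm I (w 0) x) +
      wedge (toForm 1 (ι ℝ (D 1))) (modelForm I (w 1) x) +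
      wedge (toForm 1 (ι ℝ (D 2))) (modelForm I (w 2) x) :=
    (h.rep_d_combine ho).eq.symm.trans
      ((((hι _).wedge (ho 0)).add ((hι _).wedge (ho 1))).add ((hι _).wedge (ho 2))).eq
  have h2 : ∀ i, Rep (ι ℝ ((D i).comp (modelEnd I J.toFun x)) * ((2 * a i x) • W - o i))
      ((wedge (toForm 1 (ι ℝ (D i))) (modelForm I (w i) x)).compContinuousLinearMap
        (modelEnd I J.toFun x)) := by
    intro i
    rw [wedge_compContinuousLinearMap]
    refine Rep.wedge ?_ ?_
    · rw [← extMap_ι]; exact (hι _).comp _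
    · have h3 : (modelForm I (w i) x).compContinuousLinearMap (modelEnd I J.toFun x) =
        (2 * a i x) • modelForm I (combine a w) x - modelForm I (w i) x := h.comp_J i x
      rw [h3]
      exact ((rep_combine ho).smul _).sub (ho i)
  have d0 : (D 0).comp (modelEnd I J.toFun x) = a 1 x • D 2 - a 2 x • D 1 := by
    ext v; exact h.hol0 x v
  have d1 : (D 1).comp (modelEnd I J.toFun x) = a 2 x • D 0 - a 0 x • D 2 := by
    ext v; exact h.hol1 x v
  have d2 : (D 2).comp (modelEnd I J.toFun x) = a 0 x • D 1 - a 1 x • D 0 := by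
    ext v; exact h.hol2 x v
  have h4 := (((h2 0).add (h2 1)).add (h2 2)).eq
  have h5 := (h.rep_rotated ho).eq
  rw [h1]
  refine h4.symm.trans ?_
  rw [← h5, ← map_neg]
  congr 1
  rw [d0, d1, d2]
  simp only [hW, map_sub, map_smul, mul_sub, sub_mul, mul_add, smul_mul_assoc, mul_smul_comm, hD]
  module

theorem eq_zero_of_neg_one_smul {V : Type*} [AddCommGroup V] [Module ℝ V] {v : V}
    (h : (-1 : ℝ) • v = v) : v = 0 := by
  have h2 : (2 : ℝ) • v = 0 := by
    rw [two_smul]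
    nth_rewrite 1 [← h]
    rw [neg_one_smul, neg_add_cancel]
  exact (smul_eq_zero_iff_right two_ne_zero).1 h2

theorem neg_one_smul_add_add {V : Type*} [AddCommGroup V] [Module ℝ V] (v v' : V) :
    (-1 : ℝ) • v + (v + v') = v' := by
  rw [neg_one_smul, neg_add_cancel_left]

/-- On a complex manifold carrying a twistor family of closed forms, let `β` be a form of type
`(k, k)` with `∂ ∂̄ β = 0` and `2 k + 4` the dimension. Then `β ∧ ω ∧ σ` is exact, where `ω` is the
twistor form and `σ` the pullback of the area form of the sphere. -/
theorem IsTwistor.exists_primitive (h : IsTwistor J a w) {k : ℕ}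
    (hn : Module.finrank ℝ E = 2 * (k + 2)) {β : DForm I N ℝ (2 * k)} (hβ : IsSmoothForm I β)
    (hdd : ∀ x, d I (cOp J (d I β)) x + cOpInv J (d I (cOp J (d I β))) x = 0) :
    ∃ γ : DForm I N ℝ (2 * k + 3), IsSmoothForm I γ ∧ ∀ x, modelForm I (d I γ) x =
      (2 : ℝ) • wedge (wedge (modelForm I β x) (modelForm I (combine a w) x))
        (toForm 2 (area (fun i => a i x) (dMap (I := I) a x))) := by
  set μ := cOp J (d I β) with hμ
  have hμs : IsSmoothForm I μ := hβ.d.cOp h.smooth_J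
  have hW := h.smooth_combine
  have hP := h.smooth_rotated
  have hμW := hμs.wedge hW
  have hβP := hβ.wedge hP
  -- The primitive is `μ ∧ ω + β ∧ P` with `μ = J* dβ` and `P = rotated a w`. In its differential
  -- `dμ ∧ ω` vanishes (`t1`) and `-μ ∧ dω` cancels `dβ ∧ P` (`t2`, `t3`), which leaves `β ∧ dP`.
  refine ⟨_, IsSmoothForm.add (k := 2 * k + 3) hμW hβP, fun x => ?_⟩
  set Jx := modelEnd I J.toFun x with hJx
  have hJ : ∀ v, Jx (Jx v) = -v := J.sq x
  have hJ' : ∀ v, (-Jx) ((-Jx) v) = -v := fun v => by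
    have : (-Jx) ((-Jx) v) = Jx (Jx v) := by simp
    rw [this, hJ]
  obtain ⟨o, ho⟩ : ∃ o : Fin 3 → Ext E, ∀ i, Rep (o i) (modelForm I (w i) x) :=
    ⟨fun i => lift (modelForm I (w i) x), fun i => rep_lift _⟩
  have rW := rep_combine (a := a) ho
  have rdW := h.rep_d_combine ho
  have rP := h.rep_rotated ho
  have rdP := h.rep_d_rotated' ho
  set W := a 0 x • o 0 + a 1 x • o 1 + a 2 x • o 2
  set S := area (fun i => a i x) (dMap (I := I) a x)
  have rb := rep_lift (modelForm I β x)
  have rdb := rep_lift (modelForm I (d I β) x)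
  have rm := rep_lift (modelForm I μ x)
  have rdm := rep_lift (modelForm I (d I μ) x)
  have r1 := rep_d_wedge hμs hW rm rdm rW rdW
  have r2 := rep_d_wedge hβ hP rb rdb rP rdP
  have r3 := rep_d_add hμW hβP r1 r2
  set b := lift (modelForm I β x)
  set db := lift (modelForm I (d I β) x)
  set m := lift (modelForm I μ x)
  set dm := lift (modelForm I (d I μ) x)
  have hodd : (-1 : ℝ) ^ (2 * k + 1) = -1 := by rw [pow_succ, pow_mul]; norm_num
  have heven : (-1 : ℝ) ^ (2 * k) = 1 := by rw [pow_mul]; norm_num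
  -- A top form is fixed by `(-J)*`. But `(-J)*` negates `dμ` by `hdd` and fixes `ω`, so the product
  -- equals its own negative.
  have t1 : toForm (2 * k + 3 + 1) (dm * W) = 0 := by
    have e1 : toForm (2 * k + 3 + 1) (dm * W) =
      wedge (modelForm I (d I μ) x) (modelForm I (combine a w) x) := (rdm.wedge rW).eq
    have e2 : (wedge (modelForm I (d I μ) x)
        (modelForm I (combine a w) x)).compContinuousLinearMap (-Jx) =
        wedge (modelForm I (d I μ) x) (modelForm I (combine a w) x) :=
      top_form_comp (by rw [hn]; ring) _ hJ'
    rw [wedge_compContinuousLinearMap] at e2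
    have e3 : (modelForm I (d I μ) x).compContinuousLinearMap (-Jx) =
        (-1 : ℝ) • modelForm I (d I μ) x := by
      rw [neg_one_smul]
      exact eq_neg_of_add_eq_zero_right (hdd x)
    have e4 : (modelForm I (combine a w) x).compContinuousLinearMap (-Jx) =
        modelForm I (combine a w) x := by
      have := cOpInv_eq (J := J) (combine a w) x
      rw [h.cOp_combine, neg_one_sq, one_smul] at this
      exact this
    rw [e3, e4, wedge_smul_left] at e2
    exact e1.trans (eq_zero_of_neg_one_smul e2)
  -- Pull the whole top form back by `J`: `J* μ = -dβ`, since `J*` applied twice is `-1` in odd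
  -- degree, and `J* dω = -P`.
  have t2 : toForm (2 * k + 3 + 1) (m * (ι ℝ (dFun I (a 0) x) * o 0 +
      ι ℝ (dFun I (a 1) x) * o 1 + ι ℝ (dFun I (a 2) x) * o 2)) =
      wedge (modelForm I (d I β) x) (modelForm I (rotated a w) x) := by
    refine (rm.wedge rdW).eq.trans ?_
    have e2 : (wedge (modelForm I μ x)
        (modelForm I (d I (combine a w)) x)).compContinuousLinearMap Jx =
        wedge (modelForm I μ x) (modelForm I (d I (combine a w)) x) :=
      top_form_comp (by rw [hn]; ring) _ hJ
    rw [← e2, wedge_compContinuousLinearMap, h.rep_comp_d_combine ho]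
    have e3 : (modelForm I μ x).compContinuousLinearMap Jx = (-1 : ℝ) • modelForm I (d I β) x := by
      have := cOp_cOp (J := J) (d I β) x
      rw [hodd] at this
      exact this
    rw [e3, ← neg_one_smul ℝ (modelForm I (rotated a w) x), wedge_smul_left, wedge_smul_right,
      smul_smul]
    norm_num
  have t3 : toForm (2 * k + 3 + 1) (db * ((a 1 x • (ι ℝ (dFun I (a 2) x) * o 0) +
      (-a 2 x) • (ι ℝ (dFun I (a 1) x) * o 0)) +
      (a 2 x • (ι ℝ (dFun I (a 0) x) * o 1) + (-a 0 x) • (ι ℝ (dFun I (a 2) x) * o 1)) +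
      (a 0 x • (ι ℝ (dFun I (a 1) x) * o 2) + (-a 1 x) • (ι ℝ (dFun I (a 0) x) * o 2)))) =
      wedge (modelForm I (d I β) x) (modelForm I (rotated a w) x) := (rdb.wedge rP).eq
  have t4 : toForm (2 * k + 3 + 1) (b * W * S) =
      wedge (wedge (modelForm I β x) (modelForm I (combine a w) x)) (toForm 2 S) :=
    ((rb.wedge rW).wedge (rep_toForm (area_mem _ _))).eq
  have hc : S * W = W * S := (ext_comm_of_even (k := 1) (area_mem _ _) rW.mem).eq
  refine r3.eq.symm.trans ?_
  rw [hodd, heven, one_smul, hc, mul_smul_comm, ← mul_assoc, map_add, map_add, map_add,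
    _root_.map_smul, _root_.map_smul, t1, t2, t3, t4, zero_add]
  exact neg_one_smul_add_add _ _

/-- The differential of `a` vanishes wherever the twistor form `ω` is positive on its kernel, if
`∂ ∂̄ η ^ k = 0` for a Hermitian form `η`, with `2 k + 4` the dimension. -/
theorem IsTwistor.eq_zero_of_dCd [T2Space N] [CompactSpace N] (h : IsTwistor J a w) {k : ℕ}
    (hn : Module.finrank ℝ E = 2 * (k + 2)) (g : Metric I N) (hg : IsHermitian g J)
    (hdd : ∀ x, d I (cOp J (d I fun y => wedgePow (fundamentalForm g J hg y) k)) x +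
      cOpInv J (d I (cOp J (d I fun y => wedgePow (fundamentalForm g J hg y) k))) x = 0)
    (hpos : ∀ x v, 0 ≤ modelForm I (combine a w) x ![v, modelEnd I J.toFun x v])
    {W : Type*} [AddCommGroup W] [Module ℝ W] (pr : E →ₗ[ℝ] W)
    (hpr : ∀ x v, modelForm I (combine a w) x ![v, modelEnd I J.toFun x v] = 0 → pr v = 0)
    (x : N) (hx : ∃ i v, dFun I (a i) x v ≠ 0) (v : E) (hv : ∀ i, dFun I (a i) x v = 0) :
    pr v = 0 := by
  set η := fundamentalForm g J hg with hη
  have hηs : IsSmoothForm I η := isSmoothForm_fundamentalForm g h.smooth_J hg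
  obtain ⟨γ, hγ, hdγ⟩ := h.exists_primitive hn (isSmoothForm_wedgePow hηs k) hdd
  have hH : ∀ x, IsHermitianInner (modelBilin I g.inner x) (modelEnd I J.toFun x) := fun x =>
    ⟨g.symm x, g.pos x, J.sq x, hg x⟩
  have hηx : ∀ x u v, modelForm I η x ![u, v] = modelBilin I g.inner x (modelEnd I J.toFun x u) v :=
    fun x u v => rfl
  have hex := fun x => exists_nonneg_wedge_wedge (hH x) hn (hηx x) (hpos x) pr (hpr x)
    (u := fun i => a i x) (D := dMap (I := I) a x) (h.sphere x) (h.tangent x) (h.hol0 x)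
    (h.hol1 x) (h.hol2 x) (σ := toForm 2 (area (fun i => a i x) (dMap (I := I) a x)))
    (toForm_area _ _)
  choose f hf0 hf1 hf using hex
  -- The exact form `dγ = 2 f η ^ (k + 2)` is non-negative for the orientation given by `η ^ (k +
  -- 2)`, so `f` vanishes identically.
  have hz := exact_nonneg_eq_zero (n := 2 * k + 3) (by rw [hn]; ring)
    (V := fun x => wedgePow (η x) (k + 2)) (isSmoothForm_wedgePow hηs (k + 2))
    (fun x => wedgePow_ne_zero (hH x) hn (hηx x)) hγ (f := fun x => 2 * f x)
    (fun x => mul_nonneg zero_le_two (hf0 x)) (fun x => by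
      rw [hdγ x, mul_smul]
      exact congrArg _ (hf x)) x
  by_contra hne
  exact hf1 x hx ⟨v, hv, hne⟩ (by linarith)

end Obstruction

end CalabiGray

namespace CalabiGray

/-! ### Twistor families on hyperkähler manifolds -/

section Quaternionic

variable {V : Type*} [NormedAddCommGroup V] [NormedSpace ℝ V]

/-- An inner product and orthogonal complex structures satisfying the quaternion relations. -/
structure IsQuaternionic (B : V →L[ℝ] V →L[ℝ] ℝ) (I J K : V →L[ℝ] V) : Prop where
  symm : ∀ u v, B u v = B v u
  sqI : ∀ v, I (I v) = -v
  sqJ : ∀ v, J (J v) = -v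
  sqK : ∀ v, K (K v) = -v
  IJ : ∀ v, I (J v) = K v
  mapI : ∀ u v, B (I u) (I v) = B u v
  mapJ : ∀ u v, B (J u) (J v) = B u v
  mapK : ∀ u v, B (K u) (K v) = B u v

variable {B : V →L[ℝ] V →L[ℝ] ℝ} {I J K : V →L[ℝ] V}

theorem IsQuaternionic.IK (h : IsQuaternionic B I J K) (v : V) : I (K v) = -J v := by
  rw [← h.IJ, h.sqI]

theorem IsQuaternionic.JK (h : IsQuaternionic B I J K) (v : V) : J (K v) = I v := by
  have h1 : I (J (K v)) = I (I v) := by rw [h.IJ, h.sqK, h.sqI]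
  have h2 := congrArg I h1
  rw [h.sqI, h.sqI] at h2
  exact neg_injective h2

theorem IsQuaternionic.rotate (h : IsQuaternionic B I J K) : IsQuaternionic B J K I :=
  ⟨h.symm, h.sqJ, h.sqK, h.sqI, h.JK, h.mapJ, h.mapK, h.mapI⟩

theorem IsQuaternionic.skew (h : IsQuaternionic B I J K) (u v : V) : B (I u) v = -B u (I v) := by
  have h1 := h.mapI u (I v)
  rw [h.sqI, map_neg] at h1
  linarith

/-- For `A = a I + b J + c K` one has `A I + I A = -2 a` and `A² = -1`, hence `A I A = I - 2 a A`,
and `A` is skew. The analogues for `J` and `K` come from `rotate`. -/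
theorem IsQuaternionic.map_comp (h : IsQuaternionic B I J K) {a b c : ℝ}
    (hs : a ^ 2 + b ^ 2 + c ^ 2 = 1) (u v : V) :
    B (I ((a • I + b • J + c • K) u)) ((a • I + b • J + c • K) v) =
      2 * a * B ((a • I + b • J + c • K) u) v - B (I u) v := by
  have e1 : ∀ u v, B (J u) v = -B u (J v) := h.rotate.skew
  have e2 : ∀ u v, B (K u) v = -B u (K v) := h.rotate.rotate.skew
  have f1 : ∀ v, J (I v) = -K v := h.rotate.IK
  have f2 : ∀ v, K (J v) = -I v := h.rotate.rotate.IK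
  have f3 : ∀ v, K (I v) = J v := h.rotate.JK
  simp only [add_apply, smul_apply, map_add, map_smul, h.sqI, h.IJ, h.IK, map_neg, neg_apply,
    smul_eq_mul, h.skew, e1, e2, h.sqJ, h.sqK, f1, f2, f3, h.JK]
  linear_combination (B u (I v)) * hs

end Quaternionic

/-! ### The twistor family on `M × Y`. -/

section Twisted

variable {E : Type*} [NormedAddCommGroup E] [NormedSpace ℝ E]
  {M : Type*} [TopologicalSpace M] [ChartedSpace E M] [IsManifold 𝓘(ℝ, E) ∞ M]

theorem Hyperkahler.isKahler_cs (h : Hyperkahler 𝓘(ℝ, E) M) (i : Fin 3) :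
    IsKahler h.g (h.cs i) := by
  fin_cases i
  exacts [h.isKahler_I, h.isKahler_J, h.isKahler_K]

theorem Hyperkahler.isComplex_cs (h : Hyperkahler 𝓘(ℝ, E) M) (i : Fin 3) :
    IsComplex (h.cs i) := by
  fin_cases i
  exacts [h.isComplex_I, h.isComplex_J, h.isComplex_K]

/-- The three Kähler forms of a hyperkähler manifold. -/
def Hyperkahler.form (h : Hyperkahler 𝓘(ℝ, E) M) (i : Fin 3) : DForm 𝓘(ℝ, E) M ℝ 2 :=
  fundamentalForm h.g (h.cs i) (h.isKahler_cs i).fst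

theorem Hyperkahler.d_form (h : Hyperkahler 𝓘(ℝ, E) M) (i : Fin 3) :
    d 𝓘(ℝ, E) (h.form i) = 0 := (h.isKahler_cs i).snd

theorem Hyperkahler.isQuaternionic (h : Hyperkahler 𝓘(ℝ, E) M) (x : M) :
    IsQuaternionic (modelBilin 𝓘(ℝ, E) h.g.inner x) (modelEnd 𝓘(ℝ, E) h.I.toFun x)
      (modelEnd 𝓘(ℝ, E) h.J.toFun x) (modelEnd 𝓘(ℝ, E) h.K.toFun x) where
  symm := h.g.symm x
  sqI := h.I.sq x
  sqJ := h.J.sq x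
  sqK := h.K.sq x
  IJ := by
    have h1 : ∀ v : TangentSpace 𝓘(ℝ, E) x, h.I x (h.J x v) = h.K x v := fun v => by
      have h1 := h.quaternion x (h.K x v)
      rw [h.K.sq, map_neg, map_neg] at h1
      exact neg_injective h1
    exact h1
  mapI := h.isKahler_I.fst x
  mapJ := h.isKahler_J.fst x
  mapK := h.isKahler_K.fst x

/-- The complex structure `a I + b J + c K` at a point of a hyperkähler manifold. -/
def Hyperkahler.unit (h : Hyperkahler 𝓘(ℝ, E) M) (x : M) (a : Fin 3 → ℝ) : E →L[ℝ] E :=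
  a 0 • modelEnd 𝓘(ℝ, E) h.I.toFun x + a 1 • modelEnd 𝓘(ℝ, E) h.J.toFun x +
    a 2 • modelEnd 𝓘(ℝ, E) h.K.toFun x

theorem Hyperkahler.form_apply_unit (h : Hyperkahler 𝓘(ℝ, E) M) (x : M) {a : Fin 3 → ℝ}
    (hs : a 0 ^ 2 + a 1 ^ 2 + a 2 ^ 2 = 1) (i : Fin 3) (v : Fin 2 → E) :
    modelForm 𝓘(ℝ, E) (h.form i) x (fun j => h.unit x a (v j)) =
      2 * a i * modelBilin 𝓘(ℝ, E) h.g.inner x (h.unit x a (v 0)) (v 1) -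
      modelForm 𝓘(ℝ, E) (h.form i) x v := by
  have hq := h.isQuaternionic x
  have e1 : h.unit x a = a 1 • modelEnd 𝓘(ℝ, E) h.J.toFun x +
      a 2 • modelEnd 𝓘(ℝ, E) h.K.toFun x + a 0 • modelEnd 𝓘(ℝ, E) h.I.toFun x := by
    rw [Hyperkahler.unit]; abel
  have e2 : h.unit x a = a 2 • modelEnd 𝓘(ℝ, E) h.K.toFun x +
      a 0 • modelEnd 𝓘(ℝ, E) h.I.toFun x + a 1 • modelEnd 𝓘(ℝ, E) h.J.toFun x := by
    rw [Hyperkahler.unit]; abel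
  fin_cases i
  · exact hq.map_comp hs _ _
  · rw [e1]
    exact hq.rotate.map_comp (by linarith) _ _
  · rw [e2]
    exact hq.rotate.rotate.map_comp (by linarith) _ _

theorem Hyperkahler.sum_form (h : Hyperkahler 𝓘(ℝ, E) M) (x : M) (a : Fin 3 → ℝ) (v : Fin 2 → E) :
    a 0 * modelForm 𝓘(ℝ, E) (h.form 0) x v + a 1 * modelForm 𝓘(ℝ, E) (h.form 1) x v +
      a 2 * modelForm 𝓘(ℝ, E) (h.form 2) x v =
    modelBilin 𝓘(ℝ, E) h.g.inner x (h.unit x a (v 0)) (v 1) := by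
  simp only [Hyperkahler.unit, add_apply, smul_apply, map_add, map_smul, smul_eq_mul]
  rfl

/-- With `A = h.unit x a`, this is the `A`-invariance of `ω` evaluated at `(A u, v)`, simplified by
`A² = -1`. -/
theorem Hyperkahler.bilin_unit (h : Hyperkahler 𝓘(ℝ, E) M) (x : M) {a : Fin 3 → ℝ}
    (hs : a 0 ^ 2 + a 1 ^ 2 + a 2 ^ 2 = 1) (u v : E) :
    modelBilin 𝓘(ℝ, E) h.g.inner x (h.unit x a u) (h.unit x a v) =
      modelBilin 𝓘(ℝ, E) h.g.inner x u v := by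
  have h1 := h.form_apply_unit x hs
  have h2 : h.unit x a (h.unit x a u) = -u := h.unit_sq x hs u
  have h3 := h.sum_form x a (fun j => h.unit x a (![h.unit x a u, v] j))
  have h4 := h.sum_form x a ![h.unit x a u, v]
  simp only [h1, Matrix.cons_val_zero, Matrix.cons_val_one, h2, map_neg, neg_apply] at h3 h4
  linear_combination h3 + h4 + 2 * (modelBilin 𝓘(ℝ, E) h.g.inner x u v) * hs

variable {F : Type*} [NormedAddCommGroup F] [NormedSpace ℂ F]
  {Y : Type*} [TopologicalSpace Y] [ChartedSpace F Y] [IsManifold 𝓘(ℂ, F) ω Y]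
  {φ : Y → Sphere2}

theorem modelEnd_twisted (h : Hyperkahler 𝓘(ℝ, E) M) (φ : Y → Sphere2) (p : M × Y) (v : E × F) :
    modelEnd (𝓘(ℝ, E).prod 𝓘(ℝ, F)) (twistedStructure (F := F) h φ).toFun p v =
      (h.unit p.1 (fun i => comp φ i p.2) v.1, mulI F v.2) := rfl

theorem dFun_comp_snd {f : Y → ℝ} (hf : ContMDiff 𝓘(ℝ, F) 𝓘(ℝ, ℝ) ∞ f) (p : M × Y) (v : E × F) :
    dFun (𝓘(ℝ, E).prod 𝓘(ℝ, F)) (fun p : M × Y => f p.2) p v = dFun 𝓘(ℝ, F) f p.2 v.2 := by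
  have h1 := mfderiv_comp (I := 𝓘(ℝ, E).prod 𝓘(ℝ, F)) (I' := 𝓘(ℝ, F)) (I'' := 𝓘(ℝ, ℝ))
    (f := (Prod.snd : M × Y → Y)) (g := f) p (hf.mdifferentiable (by simp) p.2)
    mdifferentiableAt_snd
  rw [mfderiv_snd] at h1
  exact DFunLike.congr_fun h1 v

theorem dFun_comp (hφ : IsHolomorphicToSphere (F := F) φ) (i : Fin 3) (y : Y) (v : F) :
    dFun 𝓘(ℝ, F) (comp φ i) y v = (show EuclideanSpace ℝ (Fin 3) from
      mfderiv 𝓘(ℝ, F) 𝓘(ℝ, EuclideanSpace ℝ (Fin 3))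
        (fun y => (φ y : EuclideanSpace ℝ (Fin 3))) y v) i := by
  have h1 := mfderiv_comp (I := 𝓘(ℝ, F)) (I' := 𝓘(ℝ, EuclideanSpace ℝ (Fin 3))) (I'' := 𝓘(ℝ, ℝ))
    (f := fun y => (φ y : EuclideanSpace ℝ (Fin 3)))
    (g := (EuclideanSpace.proj (𝕜 := ℝ) i : EuclideanSpace ℝ (Fin 3) →L[ℝ] ℝ)) y
    (EuclideanSpace.proj (𝕜 := ℝ) i : EuclideanSpace ℝ (Fin 3) →L[ℝ] ℝ).mdifferentiableAt
    (hφ.1.mdifferentiable (by simp) y)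
  rw [ContinuousLinearMap.mfderiv_eq] at h1
  exact DFunLike.congr_fun h1 v

theorem IsHolomorphicToSphere.dFun_mulI (hφ : IsHolomorphicToSphere (F := F) φ) (y : Y) (v : F) :
    dFun 𝓘(ℝ, F) (comp φ 0) y (mulI F v) = comp φ 1 y * dFun 𝓘(ℝ, F) (comp φ 2) y v -
      comp φ 2 y * dFun 𝓘(ℝ, F) (comp φ 1) y v ∧
    dFun 𝓘(ℝ, F) (comp φ 1) y (mulI F v) = comp φ 2 y * dFun 𝓘(ℝ, F) (comp φ 0) y v -
      comp φ 0 y * dFun 𝓘(ℝ, F) (comp φ 2) y v ∧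
    dFun 𝓘(ℝ, F) (comp φ 2) y (mulI F v) = comp φ 0 y * dFun 𝓘(ℝ, F) (comp φ 1) y v -
      comp φ 1 y * dFun 𝓘(ℝ, F) (comp φ 0) y v := by
  simp only [dFun_comp hφ]
  have h1 := hφ.2 y v
  have key : ∀ i, (show EuclideanSpace ℝ (Fin 3) from
      mfderiv 𝓘(ℝ, F) 𝓘(ℝ, EuclideanSpace ℝ (Fin 3))
        (fun y => (φ y : EuclideanSpace ℝ (Fin 3))) y (mulI F v)) i = _ := fun i =>
    congrArg (fun w : EuclideanSpace ℝ (Fin 3) => w i) h1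
  refine ⟨(key 0).trans ?_, (key 1).trans ?_, (key 2).trans ?_⟩ <;>
  simp [sphereJ, cross_apply, comp]

variable [FiniteDimensional ℝ E] [FiniteDimensional ℂ F]

theorem Hyperkahler.isSmoothForm_form (h : Hyperkahler 𝓘(ℝ, E) M) (i : Fin 3) :
    IsSmoothForm 𝓘(ℝ, E) (h.form i) :=
  isSmoothForm_fundamentalForm h.g (h.isComplex_cs i).isSmoothEnd _

theorem isTwistor_twisted (h : Hyperkahler 𝓘(ℝ, E) M) (hφ : IsHolomorphicToSphere (F := F) φ) :
    IsTwistor (twistedStructure (F := F) h φ) (fun i (p : M × Y) => comp φ i p.2)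
      (fun i => pullFst Y (h.form i)) where
  smooth_J := isSmoothEnd_twisted h hφ
  smooth_a i := (hφ.contMDiff_comp i).comp contMDiff_snd
  smooth_w i := (h.isSmoothForm_form i).pullFst
  closed i := by
    rw [d_pullFst (h.isSmoothForm_form i), h.d_form]
    rfl
  sphere p := comp_sq φ p.2
  hol0 p v := by
    simp only [dFun_comp_snd (hφ.contMDiff_comp _), modelEnd_twisted]
    exact (hφ.dFun_mulI p.2 v.2).1
  hol1 p v := by
    simp only [dFun_comp_snd (hφ.contMDiff_comp _), modelEnd_twisted]
    exact (hφ.dFun_mulI p.2 v.2).2.1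
  hol2 p v := by
    simp only [dFun_comp_snd (hφ.contMDiff_comp _), modelEnd_twisted]
    exact (hφ.dFun_mulI p.2 v.2).2.2
  comp_J i p := by
    ext v
    let u : Fin 2 → E := fun j => (show E × F from v j).1
    refine (h.form_apply_unit p.1 (a := fun i => comp φ i p.2) (comp_sq φ p.2) i u).trans ?_
    have h1 := h.sum_form p.1 (fun i => comp φ i p.2) u
    rw [mul_assoc, ← h1, ← mul_assoc]
    rfl

/-- This gives both that `ω` is non-negative and that it degenerates only along `Y`. -/
theorem combine_twisted_apply (h : Hyperkahler 𝓘(ℝ, E) M) (p : M × Y) (v : E × F) :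
    modelForm (𝓘(ℝ, E).prod 𝓘(ℝ, F)) (combine (fun i (p : M × Y) => comp φ i p.2)
      (fun i => pullFst Y (h.form i))) p
      ![v, modelEnd (𝓘(ℝ, E).prod 𝓘(ℝ, F)) (twistedStructure (F := F) h φ).toFun p v] =
    modelBilin 𝓘(ℝ, E) h.g.inner p.1 v.1 v.1 := by
  rw [← h.bilin_unit p.1 (a := fun i => comp φ i p.2) (comp_sq φ p.2), modelEnd_twisted]
  exact h.sum_form p.1 (fun i => comp φ i p.2)
    ![v.1, h.unit p.1 (fun i => comp φ i p.2) v.1]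

end Twisted

end CalabiGray

namespace CalabiGray

/-! ### Functions with vanishing differential. -/

section Constant

variable {E : Type*} [NormedAddCommGroup E] [NormedSpace ℝ E] {H : Type*} [TopologicalSpace H]
  {I : ModelWithCorners ℝ E H} {N : Type*} [TopologicalSpace N] [ChartedSpace H N]
  [I.Boundaryless] [IsManifold I ∞ N]

theorem dFun_eq_fderiv {f : N → ℝ} (hf : ContMDiff I 𝓘(ℝ, ℝ) ∞ f) {x : N} {z : E}
    (hz : z ∈ (extChartAt I x).target) :
    fderiv ℝ (fun z => f ((extChartAt I x).symm z)) z =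
      (dFun I f ((extChartAt I x).symm z)).comp (chartJac I x z) := by
  have : IsManifold I 1 N := IsManifold.of_le (n := ∞) (by simp)
  have h2 : mfderiv 𝓘(ℝ, E) I (extChartAt I x).symm z = chartJac I x z := by
    rw [← mfderivWithin_symm_eq I hz, I.range_eq_univ, mfderivWithin_univ]
  have h3 : MDifferentiableAt 𝓘(ℝ, E) I (extChartAt I x).symm z :=
    ((contMDiffOn_extChartAt_symm (n := ∞) x).contMDiffAt
      ((isOpen_extChartAt_target x).mem_nhds hz)).mdifferentiableAt (by simp)
  have h1 := mfderiv_comp (I := 𝓘(ℝ, E)) (I' := I) (I'' := 𝓘(ℝ, ℝ)) z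
    (hf.mdifferentiable (by simp) _) h3
  rw [h2, mfderiv_eq_fderiv] at h1
  exact h1

theorem eq_of_dFun_eq_zero [PreconnectedSpace N] {f : N → ℝ} (hf : ContMDiff I 𝓘(ℝ, ℝ) ∞ f)
    (h : ∀ x v, dFun I f x v = 0) (x y : N) : f x = f y := by
  refine IsLocallyConstant.apply_eq_of_preconnectedSpace ?_ x y
  rw [IsLocallyConstant.iff_eventually_eq]
  intro x
  obtain ⟨r, hr, hs⟩ := Metric.isOpen_iff.1 (isOpen_extChartAt_target (I := I) x) _
    (mem_extChartAt_target (I := I) x)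
  have h1 : ∀ z ∈ Metric.ball (extChartAt I x x) r, f ((extChartAt I x).symm z) = f x := by
    intro z hz
    have h2 := Metric.isOpen_ball.is_const_of_fderiv_eq_zero (𝕜 := ℝ)
      (f := fun z => f ((extChartAt I x).symm z)) (convex_ball _ _).isPreconnected
      (((contDiffOn_comp_symm hf x).mono hs).differentiableOn (by simp)) (fun z hz => by
        rw [dFun_eq_fderiv hf (hs hz)]
        ext v
        exact h _ _) hz (Metric.mem_ball_self hr)
    simpa using h2
  filter_upwards [(continuousAt_extChartAt (I := I) x).preimage_mem_nhds (Metric.ball_mem_nhds _ hr),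
    extChartAt_source_mem_nhds (I := I) x] with y hy hy'
  rw [← h1 _ hy, (extChartAt I x).left_inv hy']

end Constant

/-! ### Powers of a two-form. -/

section Powers

variable {E : Type*} [NormedAddCommGroup E] [NormedSpace ℝ E] [FiniteDimensional ℝ E]
  {H : Type*} [TopologicalSpace H]
  {I : ModelWithCorners ℝ E H} {N : Type*} [TopologicalSpace N] [ChartedSpace H N]
  [I.Boundaryless] [IsManifold I ∞ N]

open ExteriorAlgebra

theorem d_wedgePow_zero (η : DForm I N ℝ 2) : d I (fun y => wedgePow (η y) 0) = 0 := by
  funext x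
  have h : chartRep I (fun y => wedgePow (η y) 0) x =ᶠ[nhds (extChartAt I x x)]
      fun _ => ContinuousAlternatingMap.constOfIsEmpty ℝ E (Fin 0) (1 : ℝ) := by
    filter_upwards [(isOpen_extChartAt_target x).mem_nhds (mem_extChartAt_target x)] with w hw
    rw [chartRep_eq I _ hw]; rfl
  rw [d_eq, h.extDeriv_eq, extDeriv, fderiv_const_apply]
  change ContinuousAlternatingMap.alternatizeUncurryFin 0 = (0 : E [⋀^Fin (0 + 1)]→L[ℝ] ℝ)
  ext v
  rw [ContinuousAlternatingMap.alternatizeUncurryFin_apply]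
  simp

theorem rep_d_wedgePow {η : DForm I N ℝ 2} (hη : IsSmoothForm I η) {x : N} {e e' : Ext E}
    (he : Rep e (modelForm I η x)) (he' : Rep e' (modelForm I (d I η) x)) (k : ℕ) :
    Rep (((k + 1 : ℕ) : ℝ) • (e ^ k * e'))
      (modelForm I (d I fun y => wedgePow (η y) (k + 1)) x) := by
  induction k with
  | zero =>
    have h1 := rep_d_wedge (isSmoothForm_wedgePow hη 0) hη (he.pow 0)
      (a' := 0) (by rw [d_wedgePow_zero]; exact rep_zero) he he'
    have h2 : ((0 + 1 : ℕ) : ℝ) • (e ^ 0 * e') =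
        0 * e + (-1 : ℝ) ^ (2 * 0) • (e ^ 0 * e') := by simp
    rw [h2]
    exact h1
  | succ k ih =>
    have h1 := rep_d_wedge (isSmoothForm_wedgePow hη (k + 1)) hη (he.pow (k + 1)) ih he he'
    have h2 : e' * e = e * e' := (ext_comm_of_even (k := 1) he.mem he'.mem).eq.symm
    have h3 : ((k + 1 : ℕ) : ℝ) • (e ^ k * e') * e +
        (-1 : ℝ) ^ (2 * (k + 1)) • (e ^ (k + 1) * e') =
        ((k + 1 + 1 : ℕ) : ℝ) • (e ^ (k + 1) * e') := by
      rw [pow_mul, neg_one_sq, one_pow, smul_mul_assoc, mul_assoc, h2, ← mul_assoc, ← pow_succ,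
        ← add_smul]
      push_cast
      rfl
    rw [← h3]
    exact h1

theorem d_wedgePow_eq_zero {η : DForm I N ℝ 2} (hη : IsSmoothForm I η) (h0 : d I η = 0) (k : ℕ) :
    d I (fun y => wedgePow (η y) k) = 0 := by
  cases k with
  | zero => exact d_wedgePow_zero η
  | succ k =>
    funext x
    have h1 := rep_d_wedgePow hη (rep_lift (modelForm I η x)) (e' := 0)
      (by rw [h0]; exact rep_zero) k
    have h2 := h1.eq
    rw [mul_zero, smul_zero, map_zero] at h2
    exact h2.symm

theorem cOp_wedgePow {J : TangentComplexStructure I N} {η : DForm I N ℝ 2} (h : cOp J η = η)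
    (k : ℕ) : cOp J (fun y => wedgePow (η y) k) = fun y => wedgePow (η y) k := by
  funext x
  refine (wedgePow_compContinuousLinearMap (η x) (J x) k).trans ?_
  exact congrArg (fun α => wedgePow α k) (congrFun h x)

theorem cOp_fundamentalForm {J : TangentComplexStructure I N} {g : Metric I N}
    (h : IsHermitian g J) : cOp J (fundamentalForm g J h) = fundamentalForm g J h := by
  funext x
  ext v
  exact h x (J x (v 0)) (v 1)

end Powers

/-! ### Non-existence of astheno-Kähler and Kähler metrics. -/

section Obstruction

variable {E : Type*} [NormedAddCommGroup E] [NormedSpace ℝ E] [FiniteDimensional ℝ E]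
  {M : Type*} [TopologicalSpace M] [ChartedSpace E M] [IsManifold 𝓘(ℝ, E) ∞ M]
  [T2Space M] [CompactSpace M] [Nonempty M]
  {F : Type*} [NormedAddCommGroup F] [NormedSpace ℂ F] [FiniteDimensional ℂ F]
  {Y : Type*} [TopologicalSpace Y] [ChartedSpace F Y] [IsManifold 𝓘(ℂ, F) ω Y]
  [T2Space Y] [CompactSpace Y] [ConnectedSpace Y]
  {φ : Y → Sphere2}

theorem exists_dFun_comp_ne_zero (hφ : IsHolomorphicToSphere (F := F) φ)
    (hφ' : ∃ y y' : Y, φ y ≠ φ y') : ∃ (y : Y) (i : Fin 3) (v : F),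
      dFun 𝓘(ℝ, F) (comp φ i) y v ≠ 0 := by
  by_contra! h
  obtain ⟨y, y', hne⟩ := hφ'
  refine hne (Subtype.ext ?_)
  ext i
  exact eq_of_dFun_eq_zero (hφ.contMDiff_comp i) (fun y v => h y i v) y y'

omit [FiniteDimensional ℂ F] in
variable (F) in
theorem finrank_real_eq : Module.finrank ℝ F = 2 * Module.finrank ℂ F :=
  finrank_real_of_complex F

/-- The assumption `hdd` follows from either metric condition, so both cases share this lemma. Over
a point of `Y` where `dφ ≠ 0`, a nonzero vector tangent to `M` is killed by `dφ`, yet `ω` is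
positive on it, contrary to `eq_zero_of_dCd`. -/
theorem not_dCd {m : ℕ} (hm : 1 ≤ m) (hE : Module.finrank ℝ E = 4 * m)
    (h : Hyperkahler 𝓘(ℝ, E) M) (hφ : IsHolomorphicToSphere (F := F) φ)
    (hφ' : ∃ y y' : Y, φ y ≠ φ y') (g : Metric (𝓘(ℝ, E).prod 𝓘(ℝ, F)) (M × Y))
    (hg : IsHermitian g (twistedStructure h φ)) {k : ℕ}
    (hk : k = complexDim (𝓘(ℝ, E).prod 𝓘(ℝ, F)) - 2)
    (hdd : ∀ x, d (𝓘(ℝ, E).prod 𝓘(ℝ, F)) (cOp (twistedStructure h φ)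
        (d (𝓘(ℝ, E).prod 𝓘(ℝ, F))
          fun y => wedgePow (fundamentalForm g (twistedStructure h φ) hg y) k)) x +
      cOpInv (twistedStructure h φ) (d (𝓘(ℝ, E).prod 𝓘(ℝ, F)) (cOp (twistedStructure h φ)
        (d (𝓘(ℝ, E).prod 𝓘(ℝ, F))
          fun y => wedgePow (fundamentalForm g (twistedStructure h φ) hg y) k))) x = 0) :
    False := by
  obtain ⟨y, i, v, hv⟩ := exists_dFun_comp_ne_zero hφ hφ'
  obtain ⟨x⟩ := ‹Nonempty M›
  have : Nontrivial E := Module.nontrivial_of_finrank_pos (R := ℝ) (by omega)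
  obtain ⟨u, hu⟩ := exists_ne (0 : E)
  -- The subtraction in `hk` is not truncated, because `M` already has complex dimension `2 m ≥ 2`.
  have hn : Module.finrank ℝ (E × F) = 2 * (k + 2) := by
    rw [complexDim] at hk
    have h2 := finrank_real_eq F
    rw [Module.finrank_prod] at hk ⊢
    omega
  have hB : ∀ p v, modelBilin 𝓘(ℝ, E) h.g.inner p v v = 0 → v = 0 := fun p v h0 => by
    by_contra hne
    exact (h.g.pos p v hne).ne' h0
  have h1 := (isTwistor_twisted h hφ).eq_zero_of_dCd hn g hg hdd
    (fun p v => by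
      rw [combine_twisted_apply]
      by_cases hv : v.1 = 0
      · rw [hv, map_zero]
      · exact (h.g.pos p.1 v.1 hv).le)
    (LinearMap.fst ℝ E F) (fun p v h0 => by
      rw [combine_twisted_apply] at h0
      exact hB _ _ h0) (x, y) ⟨i, (0, v), by
        rw [dFun_comp_snd (hφ.contMDiff_comp _)]; exact hv⟩ (u, 0) (fun j => by
        rw [dFun_comp_snd (hφ.contMDiff_comp _)]; exact map_zero _)
  exact hu h1

theorem not_isAsthenoKahler {m : ℕ} (hm : 1 ≤ m) (hE : Module.finrank ℝ E = 4 * m)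
    (h : Hyperkahler 𝓘(ℝ, E) M) (hφ : IsHolomorphicToSphere (F := F) φ)
    (hφ' : ∃ y y' : Y, φ y ≠ φ y') (g : Metric (𝓘(ℝ, E).prod 𝓘(ℝ, F)) (M × Y)) :
    ¬ IsAsthenoKahler g (twistedStructure h φ) := by
  rintro ⟨hg, h0⟩
  have hJ := isSmoothEnd_twisted h hφ
  exact not_dCd hm hE h hφ hφ' g hg rfl fun x => dCd_of_iDelDelbar_eq_zero hJ
    (isSmoothForm_wedgePow (isSmoothForm_fundamentalForm g hJ hg) _)
    (cOp_wedgePow (cOp_fundamentalForm hg) _) h0 x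

theorem not_isKahler {m : ℕ} (hm : 1 ≤ m) (hE : Module.finrank ℝ E = 4 * m)
    (h : Hyperkahler 𝓘(ℝ, E) M) (hφ : IsHolomorphicToSphere (F := F) φ)
    (hφ' : ∃ y y' : Y, φ y ≠ φ y') (g : Metric (𝓘(ℝ, E).prod 𝓘(ℝ, F)) (M × Y)) :
    ¬ IsKahler g (twistedStructure h φ) := by
  rintro ⟨hg, h0⟩
  have hs := isSmoothForm_fundamentalForm g (isSmoothEnd_twisted h hφ) hg
  refine not_dCd hm hE h hφ hφ' g hg rfl fun x => ?_
  rw [d_wedgePow_eq_zero hs h0]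
  have h1 : ∀ {k : ℕ}, cOp (twistedStructure h φ)
      (0 : DForm (𝓘(ℝ, E).prod 𝓘(ℝ, F)) (M × Y) ℝ k) = 0 := rfl
  have h2 : ∀ {k : ℕ}, cOpInv (twistedStructure h φ)
      (0 : DForm (𝓘(ℝ, E).prod 𝓘(ℝ, F)) (M × Y) ℝ k) = 0 := rfl
  rw [h1, d_zero, h2]
  exact add_zero _

end Obstruction

end CalabiGray

namespace CalabiGray

/-! ### Balanced metrics -/

open ExteriorAlgebra

section Algebra

variable {E F : Type*} [NormedAddCommGroup E] [NormedSpace ℝ E] [FiniteDimensional ℝ E]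
  [NormedAddCommGroup F] [NormedSpace ℝ F] [FiniteDimensional ℝ F]

theorem toForm_extMap_mul_extMap_eq_zero {k l j : ℕ} (hj : j = k + l) {x : Ext E} {y : Ext F}
    (hx : x ∈ ⋀[ℝ]^k (E →L[ℝ] ℝ)) (hy : y ∈ ⋀[ℝ]^l (F →L[ℝ] ℝ))
    (h : toForm k x = 0 ∨ toForm l y = 0) :
    toForm j (extMap (ContinuousLinearMap.fst ℝ E F) x *
      extMap (ContinuousLinearMap.snd ℝ E F) y) = 0 := by
  obtain h | h := h
  · refine toForm_mul_eq_zero_of_left hj (extMap_mem _ hx) (extMap_mem _ hy) ?_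
    rw [toForm_extMap _ hx, h]; rfl
  · refine toForm_mul_eq_zero_of_right hj (extMap_mem _ hx) (extMap_mem _ hy) ?_
    rw [toForm_extMap _ hy, h]; rfl

/-- The pointwise computation for the balanced metric: `w`, `q` and `q'` stand for the twistor form,
the fundamental form of `Y` and its differential. Each binomial term is a product of a form on `E`
and a form on `F`. The dimensions `4 m` and `2 l` leave one pair of exponents for each type of term,
and `hA` and `hB` dispose of it. -/
theorem toForm_pow_mul_eq_zero {m l K : ℕ} (hE : Module.finrank ℝ E = 4 * m)
    (hF : Module.finrank ℝ F = 2 * l) (hK : K + 2 = 2 * m + l) {o : Fin 3 → Ext E} {a : Fin 3 → ℝ}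
    {D : Fin 3 → F →L[ℝ] ℝ} {w : Ext E} {q q' : Ext F}
    (hw : w = a 0 • o 0 + a 1 • o 1 + a 2 • o 2)
    (ho : ∀ i, o i ∈ ⋀[ℝ]^2 (E →L[ℝ] ℝ)) (hD : a 0 • D 0 + a 1 • D 1 + a 2 • D 2 = 0)
    (hq : q ∈ ⋀[ℝ]^2 (F →L[ℝ] ℝ)) (hq' : q' ∈ ⋀[ℝ]^3 (F →L[ℝ] ℝ))
    (hA : ∀ i j, 2 * j + 2 = 4 * m → toForm (2 * j + 2) (w ^ j * (o i - a i • w)) = 0)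
    (hB : ∀ r, r + 2 = l → toForm (2 * r + 3) (q ^ r * q') = 0) :
    toForm (2 * K + 3) ((extMap (ContinuousLinearMap.fst ℝ E F) w +
        extMap (ContinuousLinearMap.snd ℝ E F) q) ^ K *
      (ι ℝ ((D 0).comp (ContinuousLinearMap.snd ℝ E F)) *
          extMap (ContinuousLinearMap.fst ℝ E F) (o 0) +
        ι ℝ ((D 1).comp (ContinuousLinearMap.snd ℝ E F)) *
          extMap (ContinuousLinearMap.fst ℝ E F) (o 1) +
        ι ℝ ((D 2).comp (ContinuousLinearMap.snd ℝ E F)) *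
          extMap (ContinuousLinearMap.fst ℝ E F) (o 2) +
        extMap (ContinuousLinearMap.snd ℝ E F) q')) = 0 := by
  set f := extMap (ContinuousLinearMap.fst ℝ E F)
  set s := extMap (ContinuousLinearMap.snd ℝ E F)
  have hwm : w ∈ ⋀[ℝ]^2 (E →L[ℝ] ℝ) := by
    rw [hw]
    exact add_mem (add_mem (Submodule.smul_mem _ _ (ho 0)) (Submodule.smul_mem _ _ (ho 1)))
      (Submodule.smul_mem _ _ (ho 2))
  have hAm : ∀ i, o i - a i • w ∈ ⋀[ℝ]^2 (E →L[ℝ] ℝ) := fun i =>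
    sub_mem (ho i) (Submodule.smul_mem _ _ hwm)
  have hf : ∀ {x : Ext E}, x ∈ ⋀[ℝ]^2 (E →L[ℝ] ℝ) → ∀ {k : ℕ} {y : Ext F},
      y ∈ ⋀[ℝ]^k (F →L[ℝ] ℝ) → f x * s y = s y * f x := fun hx _ _ hy =>
    (ext_comm_of_even (k := 1) (extMap_mem _ hx) (extMap_mem _ hy)).eq
  have hι : ∀ i, ι ℝ ((D i).comp (ContinuousLinearMap.snd ℝ E F)) = s (ι ℝ (D i)) := fun i =>
    (extMap_ι _ _).symm
  have hDs : a 0 • s (ι ℝ (D 0)) + a 1 • s (ι ℝ (D 1)) + a 2 • s (ι ℝ (D 2)) = 0 := by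
    rw [← map_smul, ← map_smul, ← map_smul, ← map_smul, ← map_smul, ← map_smul, ← map_add,
      ← map_add, ← map_add, ← map_add, hD, map_zero, map_zero]
  -- Subtracting `w ∧ ∑ a i D i`, which is zero, replaces `o i` by `o i - a i w`.
  have h1 : ι ℝ ((D 0).comp (ContinuousLinearMap.snd ℝ E F)) * f (o 0) +
      ι ℝ ((D 1).comp (ContinuousLinearMap.snd ℝ E F)) * f (o 1) +
      ι ℝ ((D 2).comp (ContinuousLinearMap.snd ℝ E F)) * f (o 2) + s q' =
      f (o 0 - a 0 • w) * s (ι ℝ (D 0)) + f (o 1 - a 1 • w) * s (ι ℝ (D 1)) +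
      f (o 2 - a 2 • w) * s (ι ℝ (D 2)) + s q' := by
    have h2 : f w * (a 0 • s (ι ℝ (D 0)) + a 1 • s (ι ℝ (D 1)) + a 2 • s (ι ℝ (D 2))) = 0 := by
      rw [hDs, mul_zero]
    simp only [hι, ← hf (ho _) (ι_mem (D _)), map_sub, map_smul, sub_mul, smul_mul_assoc, mul_add,
      mul_smul_comm] at h2 ⊢
    rw [← sub_eq_zero, ← h2]
    module
  rw [h1]
  have key : ∀ j r, j + r = K → toForm (2 * K + 3) (f w ^ j * s q ^ r *
      (f (o 0 - a 0 • w) * s (ι ℝ (D 0)) + f (o 1 - a 1 • w) * s (ι ℝ (D 1)) +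
      f (o 2 - a 2 • w) * s (ι ℝ (D 2)) + s q')) = 0 := by
    intro j r hjr
    have t1 : ∀ i, toForm (2 * K + 3) (f w ^ j * s q ^ r *
        (f (o i - a i • w) * s (ι ℝ (D i)))) = 0 := fun i => by
      have e1 : f w ^ j * s q ^ r * (f (o i - a i • w) * s (ι ℝ (D i))) =
          f (w ^ j * (o i - a i • w)) * s (q ^ r * ι ℝ (D i)) := by
        rw [map_mul, map_mul, map_pow, map_pow, mul_assoc, ← mul_assoc (s q ^ r), ← map_pow s,
          ← hf (hAm i) (pow_mem_ext hq r)]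
        simp only [mul_assoc]
      rw [e1]
      refine toForm_extMap_mul_extMap_eq_zero (k := 2 * j + 2) (l := 2 * r + 1) (by omega)
        (mul_mem_ext (pow_mem_ext hwm j) (hAm i)) (mul_mem_ext (pow_mem_ext hq r) (ι_mem _)) ?_
      -- Only `j = 2 m - 1`, `r = l - 1` passes the degree count.
      by_cases hr : l ≤ r
      · exact Or.inr (form_eq_zero_of_finrank_lt (by omega) _)
      · by_cases hj : 2 * m ≤ j
        · exact Or.inl (form_eq_zero_of_finrank_lt (by omega) _)
        · exact Or.inl (hA i j (by omega))
    have t2 : toForm (2 * K + 3) (f w ^ j * s q ^ r * s q') = 0 := by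
      have e1 : f w ^ j * s q ^ r * s q' = f (w ^ j) * s (q ^ r * q') := by
        rw [map_mul, map_pow, map_pow, mul_assoc]
      rw [e1]
      refine toForm_extMap_mul_extMap_eq_zero (k := 2 * j) (l := 2 * r + 3) (by omega)
        (pow_mem_ext hwm j) (mul_mem_ext (pow_mem_ext hq r) hq') ?_
      -- Here only `j = 2 m`, `r = l - 2` passes the degree count.
      by_cases hr : 2 * l < 2 * r + 3
      · exact Or.inr (form_eq_zero_of_finrank_lt (by omega) _)
      · by_cases hj : 2 * m < j
        · exact Or.inl (form_eq_zero_of_finrank_lt (by omega) _)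
        · exact Or.inr (hB r (by omega))
    rw [mul_add, mul_add, mul_add, map_add, map_add, map_add, t1, t1, t1, t2]
    simp
  rw [(show Commute (f w) (s q) from hf hwm hq).add_pow, Finset.sum_mul, map_sum]
  refine Finset.sum_eq_zero fun j hj => ?_
  rw [← Nat.cast_comm, mul_assoc, ← nsmul_eq_mul, map_nsmul,
    key j (K - j) (by have := Finset.mem_range.1 hj; omega), nsmul_zero]

end Algebra

/-! ### The product metric. -/

section Product

variable {E₁ : Type*} [NormedAddCommGroup E₁] [NormedSpace ℝ E₁] [FiniteDimensional ℝ E₁]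
  {H₁ : Type*} [TopologicalSpace H₁]
  {I₁ : ModelWithCorners ℝ E₁ H₁} {N₁ : Type*} [TopologicalSpace N₁] [ChartedSpace H₁ N₁]
  [I₁.Boundaryless] [IsManifold I₁ ∞ N₁]
  {E₂ : Type*} [NormedAddCommGroup E₂] [NormedSpace ℝ E₂] [FiniteDimensional ℝ E₂]
  {H₂ : Type*} [TopologicalSpace H₂]
  {I₂ : ModelWithCorners ℝ E₂ H₂} {N₂ : Type*} [TopologicalSpace N₂] [ChartedSpace H₂ N₂]
  [I₂.Boundaryless] [IsManifold I₂ ∞ N₂]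

/-- The product of two fields of bilinear forms. -/
def prodBilin (g₁ : BilinField I₁ N₁) (g₂ : BilinField I₂ N₂) :
    BilinField (I₁.prod I₂) (N₁ × N₂) := fun p =>
  (show (E₁ × E₂) →L[ℝ] (E₁ × E₂) →L[ℝ] ℝ from
    (modelBilin I₁ g₁ p.1).bilinearComp (ContinuousLinearMap.fst ℝ E₁ E₂)
      (ContinuousLinearMap.fst ℝ E₁ E₂) +
    (modelBilin I₂ g₂ p.2).bilinearComp (ContinuousLinearMap.snd ℝ E₁ E₂)
      (ContinuousLinearMap.snd ℝ E₁ E₂))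

theorem contDiffOn_bilinRep_prodBilin {g₁ : BilinField I₁ N₁} {g₂ : BilinField I₂ N₂}
    (h₁ : ∀ x, ContDiffOn ℝ ∞ (bilinRep I₁ g₁ x) (extChartAt I₁ x).target)
    (h₂ : ∀ x, ContDiffOn ℝ ∞ (bilinRep I₂ g₂ x) (extChartAt I₂ x).target) (p : N₁ × N₂) :
    ContDiffOn ℝ ∞ (bilinRep (I₁.prod I₂) (prodBilin g₁ g₂) p)
      (extChartAt (I₁.prod I₂) p).target := by
  refine contDiffOn_clm_apply.2 fun u => contDiffOn_clm_apply.2 fun v => ?_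
  have e1 : ContDiffOn ℝ ∞ (fun z : E₁ × E₂ => bilinRep I₁ g₁ p.1 z.1 u.1 v.1)
      (extChartAt (I₁.prod I₂) p).target :=
    (((h₁ p.1).comp contDiffOn_fst fun z hz => (mem_target_prod.1 hz).1).clm_apply
      contDiffOn_const).clm_apply contDiffOn_const
  have e2 : ContDiffOn ℝ ∞ (fun z : E₁ × E₂ => bilinRep I₂ g₂ p.2 z.2 u.2 v.2)
      (extChartAt (I₁.prod I₂) p).target :=
    (((h₂ p.2).comp contDiffOn_snd fun z hz => (mem_target_prod.1 hz).2).clm_apply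
      contDiffOn_const).clm_apply contDiffOn_const
  refine (e1.add e2).congr fun z hz => ?_
  rw [bilinRep, chartJac_prod hz, symm_prod]
  rfl

omit [FiniteDimensional ℝ E₁] [I₁.Boundaryless] in
theorem bilin_nonneg (g : Metric I₁ N₁) (x : N₁) (u : E₁) :
    0 ≤ modelBilin I₁ g.inner x u u := by
  by_cases hu : u = 0
  · rw [hu, map_zero]
  · exact (g.pos x u hu).le

/-- The product of two Riemannian metrics. -/
def prodMetric (g₁ : Metric I₁ N₁) (g₂ : Metric I₂ N₂) : Metric (I₁.prod I₂) (N₁ × N₂) where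
  inner := prodBilin g₁.inner g₂.inner
  symm p u v := congrArg₂ (· + ·) (g₁.symm p.1 _ _) (g₂.symm p.2 _ _)
  pos p v hv := by
    by_cases h0 : (show E₁ × E₂ from v).1 = 0
    · exact add_pos_of_nonneg_of_pos (bilin_nonneg g₁ _ _) (g₂.pos p.2 _ fun h => hv (Prod.ext (α := E₁) (β := E₂) h0 h))
    · exact add_pos_of_pos_of_nonneg (g₁.pos p.1 _ h0) (bilin_nonneg g₂ _ _)
  -- Both quadratic forms are non-negative, so the unit ball of their sum lies in the product of the
  -- two unit balls.
  isVonNBounded p := by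
    have h₁ := (NormedSpace.isVonNBounded_iff ℝ (E := E₁)).1 (g₁.isVonNBounded p.1)
    have h₂ := (NormedSpace.isVonNBounded_iff ℝ (E := E₂)).1 (g₂.isVonNBounded p.2)
    refine (NormedSpace.isVonNBounded_iff ℝ (E := E₁ × E₂)).2 ((h₁.prod h₂).subset ?_)
    intro v hv
    have hv' : modelBilin I₁ g₁.inner p.1 v.1 v.1 + modelBilin I₂ g₂.inner p.2 v.2 v.2 < 1 := hv
    exact ⟨lt_of_le_of_lt (le_add_of_nonneg_right (bilin_nonneg g₂ _ _)) hv',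
      lt_of_le_of_lt (le_add_of_nonneg_left (bilin_nonneg g₁ _ _)) hv'⟩
  contMDiff := (contMDiff_bilin_iff _).2 (contDiffOn_bilinRep_prodBilin
    ((contMDiff_bilin_iff _).1 g₁.contMDiff) ((contMDiff_bilin_iff _).1 g₂.contMDiff))

end Product

/-! ### The product metric is balanced. -/

section Balanced

variable {E : Type*} [NormedAddCommGroup E] [NormedSpace ℝ E] [FiniteDimensional ℝ E]
  {M : Type*} [TopologicalSpace M] [ChartedSpace E M] [IsManifold 𝓘(ℝ, E) ∞ M]

/-- The structure `h.unit x a` fixes `ω`, negates `w i - a i ω` and acts trivially on top forms, so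
this top form equals its own negative. -/
theorem Hyperkahler.toForm_pow_mul_eq_zero (h : Hyperkahler 𝓘(ℝ, E) M) (x : M) {a : Fin 3 → ℝ}
    (hs : a 0 ^ 2 + a 1 ^ 2 + a 2 ^ 2 = 1) {j : ℕ} (hj : Module.finrank ℝ E = 2 * j + 2)
    {o : Fin 3 → Ext E} (ho : ∀ i, Rep (o i) (modelForm 𝓘(ℝ, E) (h.form i) x)) (i : Fin 3) :
    toForm (2 * j + 2) ((a 0 • o 0 + a 1 • o 1 + a 2 • o 2) ^ j *
      (o i - a i • (a 0 • o 0 + a 1 • o 1 + a 2 • o 2))) = 0 := by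
  have hW := (((ho 0).smul (a 0)).add ((ho 1).smul (a 1))).add ((ho 2).smul (a 2))
  set W := a 0 • modelForm 𝓘(ℝ, E) (h.form 0) x + a 1 • modelForm 𝓘(ℝ, E) (h.form 1) x +
    a 2 • modelForm 𝓘(ℝ, E) (h.form 2) x
  have hWv : ∀ v : Fin 2 → E, W v = modelBilin 𝓘(ℝ, E) h.g.inner x (h.unit x a (v 0)) (v 1) :=
    h.sum_form x a
  have e1 : W.compContinuousLinearMap (h.unit x a) = W := by
    ext v
    refine (hWv _).trans (Eq.trans ?_ (hWv v).symm)
    exact h.bilin_unit x hs (h.unit x a (v 0)) (v 1)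
  have e2 : (modelForm 𝓘(ℝ, E) (h.form i) x - a i • W).compContinuousLinearMap (h.unit x a) =
      (-1 : ℝ) • (modelForm 𝓘(ℝ, E) (h.form i) x - a i • W) := by
    ext v
    have h1 := h.form_apply_unit x hs i v
    have h2 := DFunLike.congr_fun e1 v
    rw [← hWv] at h1
    simp only [ContinuousAlternatingMap.compContinuousLinearMap_apply,
      ContinuousAlternatingMap.sub_apply, ContinuousAlternatingMap.smul_apply, smul_eq_mul] at h2 ⊢
    refine (congrArg₂ (fun s t => s - a i * t) h1 h2).trans ?_
    ring
  have h3 := ((hW.pow j).wedge ((ho i).sub (hW.smul (a i)))).eq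
  have h4 := top_form_comp hj (wedge (wedgePow W j)
    (modelForm 𝓘(ℝ, E) (h.form i) x - a i • W)) (J := h.unit x a) (h.unit_sq x hs)
  rw [wedge_compContinuousLinearMap, wedgePow_compContinuousLinearMap, e1, e2,
    wedge_smul_right] at h4
  exact h3.trans (eq_zero_of_neg_one_smul h4)

variable
  {F : Type*} [NormedAddCommGroup F] [NormedSpace ℂ F] [FiniteDimensional ℂ F]
  {Y : Type*} [TopologicalSpace Y] [ChartedSpace F Y] [IsManifold 𝓘(ℂ, F) ω Y]
  {φ : Y → Sphere2}

theorem isHermitian_prodMetric (h : Hyperkahler 𝓘(ℝ, E) M) (φ : Y → Sphere2)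
    {g : Metric 𝓘(ℝ, F) Y} (hg : IsHermitian g (complexStructure F Y)) :
    IsHermitian (prodMetric h.g g) (twistedStructure h φ) := fun p _ _ =>
  congrArg₂ (· + ·) (h.bilin_unit p.1 (a := fun i => comp φ i p.2) (comp_sq φ p.2) _ _)
    (hg p.2 _ _)

theorem fundamentalForm_prodMetric (h : Hyperkahler 𝓘(ℝ, E) M) (φ : Y → Sphere2)
    {g : Metric 𝓘(ℝ, F) Y} (hg : IsHermitian g (complexStructure F Y)) :
    fundamentalForm (prodMetric h.g g) (twistedStructure h φ) (isHermitian_prodMetric h φ hg) =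
      fun p => combine (fun i (p : M × Y) => comp φ i p.2) (fun i => pullFst Y (h.form i)) p +
        pullSnd M (fundamentalForm g (complexStructure F Y) hg) p := by
  funext p
  ext v
  let u : Fin 2 → E := fun j => (show E × F from v j).1
  exact congrArg (· + modelBilin 𝓘(ℝ, F) g.inner p.2 (mulI F (show E × F from v 0).2)
    (show E × F from v 1).2) (h.sum_form p.1 (fun i => comp φ i p.2) u).symm

theorem isBalanced_prodMetric {m : ℕ} (hm : 1 ≤ m) (hE : Module.finrank ℝ E = 4 * m)
    (h : Hyperkahler 𝓘(ℝ, E) M) (hφ : IsHolomorphicToSphere (F := F) φ)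
    {g : Metric 𝓘(ℝ, F) Y} (hg : IsBalanced g (complexStructure F Y)) :
    IsBalanced (prodMetric h.g g) (twistedStructure h φ) := by
  obtain ⟨hg, h0⟩ := hg
  refine ⟨isHermitian_prodMetric h φ hg, ?_⟩
  have hF := finrank_real_eq F
  set l := Module.finrank ℂ F
  have hJY : IsSmoothEnd 𝓘(ℝ, F) (complexStructure F Y).toFun := fun x =>
    contDiffOn_const.congr fun z hz => endRep_complexStructure hz
  have hY := isSmoothForm_fundamentalForm g hJY hg
  -- With `n = 2 m + l` the complex dimension, `K = n - 2` is the exponent left after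
  -- differentiating the power `n - 1`.
  obtain ⟨K, hK⟩ : ∃ K, K + 2 = 2 * m + l := ⟨2 * m + l - 2, by omega⟩
  have hK' : complexDim (𝓘(ℝ, E).prod 𝓘(ℝ, F)) - 1 = K + 1 := by
    rw [complexDim, Module.finrank_prod]; omega
  rw [hK', fundamentalForm_prodMetric]
  have hT := isTwistor_twisted h hφ
  have hs := hT.smooth_combine.add (IsSmoothForm.pullSnd (N₁ := M) (I₁ := 𝓘(ℝ, E)) hY)
  funext p
  obtain ⟨o, ho⟩ : ∃ o : Fin 3 → Ext E, ∀ i, Rep (o i) (modelForm 𝓘(ℝ, E) (h.form i) p.1) :=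
    ⟨fun i => lift (modelForm 𝓘(ℝ, E) (h.form i) p.1), fun i => rep_lift _⟩
  have ho' : ∀ i, Rep (extMap (ContinuousLinearMap.fst ℝ E F) (o i))
      (modelForm (𝓘(ℝ, E).prod 𝓘(ℝ, F)) (pullFst Y (h.form i)) p) := fun i => (ho i).comp _
  have rq := rep_lift (modelForm 𝓘(ℝ, F) (fundamentalForm g (complexStructure F Y) hg) p.2)
  have rq' := rep_lift
    (modelForm 𝓘(ℝ, F) (d 𝓘(ℝ, F) (fundamentalForm g (complexStructure F Y) hg)) p.2)
  set q := lift (modelForm 𝓘(ℝ, F) (fundamentalForm g (complexStructure F Y) hg) p.2)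
  set q' := lift (modelForm 𝓘(ℝ, F) (d 𝓘(ℝ, F) (fundamentalForm g (complexStructure F Y) hg)) p.2)
  have r1 := rq.comp (ContinuousLinearMap.snd ℝ E F)
  have r2 : Rep (extMap (ContinuousLinearMap.snd ℝ E F) q') (modelForm (𝓘(ℝ, E).prod 𝓘(ℝ, F))
      (d (𝓘(ℝ, E).prod 𝓘(ℝ, F))
        (pullSnd M (fundamentalForm g (complexStructure F Y) hg))) p) := by
    rw [d_pullSnd hY]
    exact rq'.comp (ContinuousLinearMap.snd ℝ E F)
  have r3 := rep_d_wedgePow hs ((rep_combine (a := fun i (p : M × Y) => comp φ i p.2) ho').add r1)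
    (rep_d_add hT.smooth_combine hY.pullSnd (hT.rep_d_combine ho') r2) K
  refine r3.eq.symm.trans ?_
  have hD : ∀ i, dFun (𝓘(ℝ, E).prod 𝓘(ℝ, F)) (fun p : M × Y => comp φ i p.2) p =
      (dFun 𝓘(ℝ, F) (comp φ i) p.2).comp (ContinuousLinearMap.snd ℝ E F) := fun i =>
    ContinuousLinearMap.ext fun v => dFun_comp_snd (hφ.contMDiff_comp i) p v
  have key := toForm_pow_mul_eq_zero hE hF hK (o := o) (a := fun i => comp φ i p.2)
    (D := fun i => dFun 𝓘(ℝ, F) (comp φ i) p.2) (q := q) (q' := q') rfl (fun i => (ho i).mem)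
    (by
      ext v
      have := hT.tangent p (0, v)
      simp only [dFun_comp_snd (hφ.contMDiff_comp _)] at this
      exact this)
    rq.mem rq'.mem
    (fun i j hj => h.toForm_pow_mul_eq_zero p.1 (a := fun i => comp φ i p.2) (comp_sq φ p.2)
      (by omega) ho i)
    -- That `Y` is balanced means `(r + 1) q ^ r ∧ q' = 0` with `r = l - 2`, and the factor `r + 1`
    -- is nonzero. For `l = 1` no such `r` exists.
    (fun r hr => by
      have hl : complexDim 𝓘(ℝ, F) - 1 = r + 1 := by
        rw [complexDim]; omega
      rw [hl] at h0
      have h1 := (rep_d_wedgePow hY rq rq' r).eq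
      rw [h0, _root_.map_smul] at h1
      exact (smul_eq_zero_iff_right (Nat.cast_ne_zero.2 r.succ_ne_zero)).1 h1)
  rw [_root_.map_smul]
  refine (congrArg _ ?_).trans (smul_zero _)
  simp only [hD]
  rw [← key]
  simp only [map_add, map_smul]
  rfl

end Balanced

end CalabiGray

end

open CalabiGray in
theorem mainTheorem4
    {E : Type*} [NormedAddCommGroup E] [NormedSpace ℝ E] [FiniteDimensional ℝ E]
    {M : Type*} [TopologicalSpace M] [ChartedSpace E M] [IsManifold 𝓘(ℝ, E) ∞ M]
    [T2Space M] [CompactSpace M] [Nonempty M]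
    {F : Type*} [NormedAddCommGroup F] [NormedSpace ℂ F] [FiniteDimensional ℂ F]
    {Y : Type*} [TopologicalSpace Y] [ChartedSpace F Y] [IsManifold 𝓘(ℂ, F) ω Y]
    [T2Space Y] [CompactSpace Y] [ConnectedSpace Y]
    (m : ℕ) (hm : 1 ≤ m) (hE : Module.finrank ℝ E = 4 * m)
    (h : Hyperkahler 𝓘(ℝ, E) M)
    (φ : Y → Sphere2) (hφ : IsHolomorphicToSphere (F := F) φ) (hφ' : ∃ y y' : Y, φ y ≠ φ y') :
    ((∃ g : Metric 𝓘(ℝ, F) Y, IsBalanced g (complexStructure F Y)) →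
      ∃ g : Metric (𝓘(ℝ, E).prod 𝓘(ℝ, F)) (M × Y), IsBalanced g (twistedStructure h φ)) ∧
    ¬ ((∃ g : Metric (𝓘(ℝ, E).prod 𝓘(ℝ, F)) (M × Y), IsAsthenoKahler g (twistedStructure h φ)) ∧
      ∃ g : Metric (𝓘(ℝ, E).prod 𝓘(ℝ, F)) (M × Y),
        IsPlurisubharmonic g (twistedStructure h φ)) ∧
    ¬ ∃ g : Metric (𝓘(ℝ, E).prod 𝓘(ℝ, F)) (M × Y), IsKahler g (twistedStructure h φ) := by
  refine ⟨fun ⟨g, hg⟩ => ⟨prodMetric h.g g, isBalanced_prodMetric hm hE h hφ hg⟩,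
    fun ⟨⟨g, hg⟩, _⟩ => not_isAsthenoKahler hm hE h hφ hφ' g hg,
    fun ⟨g, hg⟩ => not_isKahler hm hE h hφ hφ' g hg⟩
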